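/- Let $T>0$, $K>0$. Let $M$ be the set of bounded signed measures on $[0,T]$, and $V_r$ the set of right-continuous functions with left limits $x:[0,T]\to\mathbb R$ of bounded variation ($x_0$ is free). Consider the Asian put log-payoff $$H(x)=\log\Big(K-\frac1T\int_0^T e^{x_t}\,dt\Big)^+\qquad(\log 0=-\infty),\qquad \widehat H(\theta)=\sup_{x\in V_r}\Big\{H(x)-\int_{[0,T]}x_t\,\theta(dt)\Big\},\quad \theta\in M .$$ (i) If $\theta\in M$ is absolutely continuous, with density (also denoted by $\theta_t$) satisfying $\theta_t\le 0$ for (almost) all $t\in[0,T]$, then $$\widehat H(\theta)=\log\frac{K}{1-\int_0^T\theta_t\,dt}-\int_0^T\theta_t\log\frac{-KT\theta_t}{1-\int_0^T\theta_s\,ds}\,dt ,$$ where $0\log 0=0$ and the last integral, whose integrand is bounded above, takes values in $[-\infty,\infty)$, so that $\widehat H(\theta)=+\infty$ when it equals $-\infty$. Otherwise $\widehat H(\theta)=+\infty$. (ii) Consider a real Lévy process without diffusion part, with drift $\gamma\in\mathbb R$ and Lévy measure $\nu$, and let $$G(\lambda)=\lambda\gamma+\int_{\mathbb R}\big(e^{\lambda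 x}-1-\lambda x1_{|x|\le1}\big)\,\nu(dx)\in(-\infty,+\infty].$$ Assume that (A1) $\int_{|x|>1}e^{\lambda_0|x|}\nu(dx)<\infty$ for some $\lambda_0>0$, and (A2) $G$ is lower semicontinuous and its effective domain $\{G<\infty\}$ is bounded. For $x\in V_r$ let $\bar J(x)=\sup_{\mu\in M}\{\int_{[0,T]}x_t\,\mu(dt)-\int_0^TG(\mu([t,T]))\,dt\}$. Let $\theta^*\in M$ be asymptotically optimal, that is, let it minimize $$\theta\mapsto\sup_{x\in V_r}\Big\{2H(x)-\int_{[0,T]}x_t\,\theta(dt)+\int_0^TG(\theta([t,T]))\,dt-\bar J(x)\Big\}$$ over $M$, and suppose that $\theta^*((0,T])$ lies in the interior of the effective domain of $G$. Then the restriction of $\theta^*$ to $(0,T]$ is absolutely continuous with a nonpositive density $\theta^*_t$, the function $\psi^*_t=\int_{T-t}^T\theta^*_s\,ds$ takes its values in the interior of the effective domain of $G$, $G$ is differentiable at these values, and, for some function $p$ on $[0,T]$, the pair $(p,\psi^*)$ is the unique solution, with second component in that interior, of the boundary value problem $$\dot p_t=-G'(\psi^*_t),\quad p_T=-\log\frac{K}{1-\psi^*_T}+1,\qquad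 \dot\psi^*_t=-\frac1T e^{p_t-1},\quad \psi^*_0=0,\qquad t\in[0,T].$$ -/

import Mathlib

open MeasureTheory Set Filter Topology

namespace AsianPut

noncomputable section

/-- The integral of an extended real valued function, `∫ f⁺ dμ - ∫ f⁻ dμ`. It is the usual
`(-∞, +∞]`-valued (resp. `[-∞, +∞)`-valued) integral as soon as the negative (resp. positive)
part of `f` is integrable. -/
def extIntegral {α : Type*} [MeasurableSpace α] (μ : Measure α) (f : α → EReal) : EReal :=
  ((∫⁻ a, (f a).toENNReal ∂μ : ENNReal) : EReal) - ((∫⁻ a, (-f a).toENNReal ∂μ : ENNReal) : EReal)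

/-! ### The Lévy process, through its triplet `(0, ν, γ)` -/

/-- `ν` is a Lévy measure on `ℝ`. -/
def IsLevyMeasure (ν : Measure ℝ) : Prop :=
  ν {0} = 0 ∧ ∫⁻ x, ENNReal.ofReal (min (x ^ 2) 1) ∂ν < ⊤

/-- The log-Laplace exponent
`G(l) = l γ + ∫ (e^{l x} - 1 - l x 1_{|x| ≤ 1}) ν(dx) ∈ (-∞, +∞]`
of the Lévy process with drift `γ`, Lévy measure `ν` and no diffusion part. The negative part of
the integrand is always `ν`-integrable. -/
def G (γ : ℝ) (ν : Measure ℝ) (l : ℝ) : EReal :=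
  ((l * γ : ℝ) : EReal) + extIntegral ν (fun x =>
    ((Real.exp (l * x) - 1 - l * x * indicator {y : ℝ | |y| ≤ 1} 1 x : ℝ) : EReal))

/-- The effective domain of `G`. -/
def effDom (γ : ℝ) (ν : Measure ℝ) : Set ℝ := {l | G γ ν l < ⊤}

/-- Assumption (A1): the Lévy measure has some exponential moment at infinity. -/
def AssumptionA1 (ν : Measure ℝ) : Prop :=
  ∃ l₀ : ℝ, 0 < l₀ ∧ ∫⁻ x in {x : ℝ | 1 < |x|}, ENNReal.ofReal (Real.exp (l₀ * |x|)) ∂ν < ⊤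

/-- Assumption (A2): `G` is lower semicontinuous with bounded effective domain. -/
def AssumptionA2 (γ : ℝ) (ν : Measure ℝ) : Prop :=
  LowerSemicontinuous (G γ ν) ∧ Bornology.IsBounded (effDom γ ν)

/-! ### Path space and space of measures

Paths on `[0, T]` are functions `ℝ → ℝ` of which only the values on `[0, T]` matter; measures on
`[0, T]` are signed measures on `ℝ` that vanish outside `[0, T]`. -/

/-- Right-continuous paths with left limits on `[0, T]`. -/
def D (T : ℝ) : Set (ℝ → ℝ) :=
  {x | (∀ t ∈ Ico 0 T, ContinuousWithinAt x (Ioi t) t) ∧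
    ∀ t ∈ Ioc 0 T, ∃ l : ℝ, Tendsto x (𝓝[<] t) (𝓝 l)}

/-- Paths in `D` of bounded variation on `[0, T]`. The value at `0` is free. -/
def Vr (T : ℝ) : Set (ℝ → ℝ) := {x ∈ D T | BoundedVariationOn x (Icc 0 T)}

/-- Bounded signed measures on `[0, T]`. -/
def M (T : ℝ) : Set (SignedMeasure ℝ) :=
  {θ | ∀ B : Set ℝ, MeasurableSet B → Disjoint B (Icc 0 T) → θ B = 0}

/-- The pairing `∫_{[0,T]} x_t θ(dt)`. -/
def pairing (x : ℝ → ℝ) (θ : SignedMeasure ℝ) : ℝ := ∫ᵛ t, x t ∂<•θ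

/-- `∫_0^T G(θ([t,T])) dt`. -/
def cumG (γ : ℝ) (ν : Measure ℝ) (T : ℝ) (θ : SignedMeasure ℝ) : EReal :=
  extIntegral (volume.restrict (Icc 0 T)) (fun t => G γ ν (θ (Icc t T)))

/-- The rate function `J̄`, on paths of bounded variation:
`J̄(x) = sup_{μ ∈ M} { ∫ x dμ - ∫_0^T G(μ([t,T])) dt }`. -/
def rate (γ : ℝ) (ν : Measure ℝ) (T : ℝ) (x : ℝ → ℝ) : EReal :=
  ⨆ μ ∈ M T, (pairing x μ : EReal) - cumG γ ν T μ

/-! ### The Asian put -/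

/-- Log-payoff of the Asian put, `H(x) = log (K - (1/T) ∫_0^T e^{x_t} dt)^+`,
with `log 0 = -∞`. -/
def H (K T : ℝ) (x : ℝ → ℝ) : EReal :=
  ENNReal.log (ENNReal.ofReal (K - 1 / T * ∫ t in (0 : ℝ)..T, Real.exp (x t)))

/-- The conjugate `Ĥ(θ) = sup_{x ∈ V_r} { H(x) - ∫ x dθ }`. -/
def Hhat (K T : ℝ) (θ : SignedMeasure ℝ) : EReal :=
  ⨆ x ∈ Vr T, H K T x - (pairing x θ : EReal)

/-- The variance proxy
`sup_{x ∈ V_r} { 2 H(x) - ∫ x dθ + ∫_0^T G(θ([t,T])) dt - J̄(x) }`. -/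
def varProxy (γ : ℝ) (ν : Measure ℝ) (K T : ℝ) (θ : SignedMeasure ℝ) : EReal :=
  ⨆ x ∈ Vr T, 2 * H K T x - (pairing x θ : EReal) + cumG γ ν T θ - rate γ ν T x

/-- `θ` is asymptotically optimal: it minimizes the variance proxy over `M`. -/
def IsAsymptoticallyOptimal (γ : ℝ) (ν : Measure ℝ) (K T : ℝ) (θ : SignedMeasure ℝ) : Prop :=
  θ ∈ M T ∧ ∀ η ∈ M T, varProxy γ ν K T θ ≤ varProxy γ ν K T η

/-- `θ` is absolutely continuous on `[0, T]`, with nonpositive density `g`. -/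
def HasNonposDensity (T : ℝ) (θ : SignedMeasure ℝ) (g : ℝ → ℝ) : Prop :=
  IntegrableOn g (Icc 0 T) ∧ (∀ᵐ t ∂volume.restrict (Icc 0 T), g t ≤ 0) ∧
    θ = (volume.restrict (Icc 0 T)).withDensityᵥ g

/-- `(p, ψ)` solves on `[0, T]` the boundary value problem
`p' = -G'(ψ)`, `p(T) = -log (K / (1 - ψ(T))) + 1`, `ψ' = -(1/T) e^{p - 1}`, `ψ(0) = 0`,
where `ψ` takes its values in the interior of the effective domain of `G`. -/
structure SolvesBVP (γ : ℝ) (ν : Measure ℝ) (K T : ℝ) (p ψ : ℝ → ℝ) : Prop where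
  mem_interior : ∀ t ∈ Icc 0 T, ψ t ∈ interior (effDom γ ν)
  differentiable : ∀ t ∈ Icc 0 T, DifferentiableAt ℝ (fun l => (G γ ν l).toReal) (ψ t)
  adjoint : ∀ t ∈ Icc 0 T,
    HasDerivWithinAt p (-deriv (fun l => (G γ ν l).toReal) (ψ t)) (Icc 0 T) t
  adjoint_final : p T = -Real.log (K / (1 - ψ T)) + 1
  state : ∀ t ∈ Icc 0 T, HasDerivWithinAt ψ (-(1 / T) * Real.exp (p t - 1)) (Icc 0 T) t
  state_initial : ψ 0 = 0

end

end AsianPut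

namespace AsianPut

/-! ### Paths and the pairing -/

/-! Part (i) is Fenchel duality for an exponential. Let `θ` have density `-b`, and put `A = 1 + ∫
b`, `κ = K T / A`. The tangent to `log` at `K / A` and Young's inequality `x b ≤ e^x / κ - b + b log
(κ b)` add up so that the exponential terms cancel (`log_payoff_add_le`). Equality holds at `x = log
(κ b)`, which need not be in `Vr`. Truncating `b`, smoothing by Lipschitz averages and applying
Fatou's lemma recovers the entropy, and shows it integrable as soon as the conjugate is finite
(`entropy_le_of_Hhat_le`). If there is no nonpositive density, some closed set has positive mass, or
negative mass and zero Lebesgue measure, and a large multiple of its indicator makes the conjugate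
infinite (`Hhat_eq_top_of_isClosed`).

Part (ii) replaces abstract minimax arguments by an explicit saddle point: a path `X` and a dual
variable `h_s = θ([s,T])` with `X' = G'(h)`, `h' = e^X (1 - h_0) / (K T)`, `h_T = 0`, and `X_0` in
the normal cone of the effective domain at `h_0`. A nonzero `X_0` is a jump of the path at time `0`.
Along such a pair `h' - G(h)` is constant, so `y_t = -h_{T-t}` solves the scalar equation `y' =
G(-y) + c`, which is integrated by quadrature. The constant `c` and the final value `Y` of `y` come
from two intermediate value arguments (`exists_saddle`).

The pair carries a number `V` (`Saddle.value`). The dual measure of the pair has variance proxy at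
most `2 V` (`term_dual_le`), while ramped versions of `X` make `H - J̄` exceed `V - ε`
(`exists_near_value`). Comparing an optimal `θ` with the midpoint between it and the dual measure,
strict convexity of `G` forces `θ([s,T]) = h_s` for almost every `s`. This determines `θ` on
`(0,T]`, but not its mass at `0`.

If `θ((0,T]) = h_0` is interior, the normal cone is trivial and `X_0 = 0`; reversing time gives the
boundary value problem. Conversely every solution of that problem is a saddle point, so it can be
read off from `θ`, which is uniqueness. -/

instance isFiniteMeasure_variation_signed (θ : SignedMeasure ℝ) :
    IsFiniteMeasure θ.variation := by
  rw [← SignedMeasure.totalVariation_eq_variation, SignedMeasure.totalVariation]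
  infer_instance

lemma variation_compl_Icc {T : ℝ} {θ : SignedMeasure ℝ} (hθ : θ ∈ M T) :
    θ.variation (Icc 0 T)ᶜ = 0 := by
  rw [VectorMeasure.variation_apply_eq_zero measurableSet_Icc.compl]
  intro B hsub hB
  exact hθ B hB (subset_compl_iff_disjoint_right.1 hsub)

lemma variation_restrict_Icc {T : ℝ} {θ : SignedMeasure ℝ} (hθ : θ ∈ M T) :
    θ.variation.restrict (Icc 0 T) = θ.variation :=
  Measure.restrict_eq_self_of_ae_mem (by
    rw [ae_iff]; exact variation_compl_Icc hθ)

lemma ae_variation_mem {T : ℝ} {θ : SignedMeasure ℝ} (hθ : θ ∈ M T) :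
    ∀ᵐ t ∂θ.variation, t ∈ Icc 0 T := by
  rw [ae_iff]; exact variation_compl_Icc hθ

lemma posPart_le_variation (θ : SignedMeasure ℝ) :
    θ.toJordanDecomposition.posPart ≤ θ.variation := by
  rw [← SignedMeasure.totalVariation_eq_variation, SignedMeasure.totalVariation]
  exact Measure.le_add_right le_rfl

lemma negPart_le_variation (θ : SignedMeasure ℝ) :
    θ.toJordanDecomposition.negPart ≤ θ.variation := by
  rw [← SignedMeasure.totalVariation_eq_variation, SignedMeasure.totalVariation]
  exact Measure.le_add_left le_rfl

lemma pairing_eq_sub {x : ℝ → ℝ} {θ : SignedMeasure ℝ} (hx : Integrable x θ.variation) :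
    pairing x θ = ∫ t, x t ∂θ.toJordanDecomposition.posPart
      - ∫ t, x t ∂θ.toJordanDecomposition.negPart := by
  have h := θ.toSignedMeasure_toJordanDecomposition
  rw [JordanDecomposition.toSignedMeasure] at h
  rw [pairing]
  conv_lhs => rw [← h]
  rw [VectorMeasure.integral_sub_vectorMeasure, VectorMeasure.integral_toSignedMeasure,
    VectorMeasure.integral_toSignedMeasure]
  · rw [VectorMeasure.Integrable, Measure.variation_toSignedMeasure]
    exact hx.mono_measure (posPart_le_variation θ)
  · rw [VectorMeasure.Integrable, Measure.variation_toSignedMeasure]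
    exact hx.mono_measure (negPart_le_variation θ)

lemma apply_eq_sub (θ : SignedMeasure ℝ) {s : Set ℝ} (hs : MeasurableSet s) :
    θ s = θ.toJordanDecomposition.posPart.real s - θ.toJordanDecomposition.negPart.real s :=
  θ.apply_eq_posPart_real_sub_negPart_real hs

lemma BoundedVariationOn.exists_bound {x : ℝ → ℝ} {T : ℝ} (hT : 0 < T)
    (hx : BoundedVariationOn x (Icc 0 T)) : ∃ C, ∀ t ∈ Icc 0 T, |x t| ≤ C := by
  refine ⟨|x 0| + (eVariationOn x (Icc 0 T)).toReal, fun t ht => ?_⟩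
  have := hx.dist_le ht (left_mem_Icc.2 hT.le)
  rw [Real.dist_eq] at this
  have h2 := abs_sub_abs_le_abs_sub (x t) (x 0)
  linarith

lemma BoundedVariationOn.aemeasurable_restrict {x : ℝ → ℝ} {T : ℝ} (μ : Measure ℝ)
    (hx : BoundedVariationOn x (Icc 0 T)) : AEMeasurable x (μ.restrict (Icc 0 T)) := by
  obtain ⟨p, q, hp, hq, rfl⟩ :=
    hx.locallyBoundedVariationOn.exists_monotoneOn_sub_monotoneOn
  exact (aemeasurable_restrict_of_monotoneOn measurableSet_Icc hp).sub
    (aemeasurable_restrict_of_monotoneOn measurableSet_Icc hq)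

lemma Vr.integrable {x : ℝ → ℝ} {T : ℝ} (hT : 0 < T) (hx : x ∈ Vr T) (μ : Measure ℝ)
    [IsFiniteMeasure (μ.restrict (Icc 0 T))] : IntegrableOn x (Icc 0 T) μ := by
  obtain ⟨C, hC⟩ := BoundedVariationOn.exists_bound hT hx.2
  refine Integrable.of_bound (BoundedVariationOn.aemeasurable_restrict μ hx.2).aestronglyMeasurable
    C ?_
  filter_upwards [ae_restrict_mem measurableSet_Icc] with t ht using hC t ht

lemma Vr.integrable_variation {x : ℝ → ℝ} {T : ℝ} (hT : 0 < T) (hx : x ∈ Vr T)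
    {θ : SignedMeasure ℝ} (hθ : θ ∈ M T) : Integrable x θ.variation := by
  rw [← variation_restrict_Icc hθ]
  exact Vr.integrable hT hx _

lemma Vr.integrable_exp {x : ℝ → ℝ} {T : ℝ} (hT : 0 < T) (hx : x ∈ Vr T) :
    IntegrableOn (fun t => Real.exp (x t)) (Icc 0 T) := by
  obtain ⟨C, hC⟩ := BoundedVariationOn.exists_bound hT hx.2
  refine Integrable.of_bound (Real.measurable_exp.comp_aemeasurable
    (BoundedVariationOn.aemeasurable_restrict volume hx.2)).aestronglyMeasurable (Real.exp C) ?_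
  filter_upwards [ae_restrict_mem measurableSet_Icc] with t ht
  rw [Real.norm_eq_abs, Real.abs_exp]
  exact Real.exp_le_exp.2 (le_of_abs_le (hC t ht))

lemma mem_M_withDensity (T : ℝ) (g : ℝ → ℝ) :
    (volume.restrict (Icc 0 T)).withDensityᵥ g ∈ M T := by
  intro B hB hd
  refine Measure.withDensityᵥ_absolutelyContinuous _ _ ?_
  rw [Measure.toENNRealVectorMeasure_apply_measurable hB, Measure.restrict_apply hB,
    hd.inter_eq, measure_empty]

/-- Membership in `Vr` is not required because the formula is also applied to logarithms of
truncated densities, which are only bounded and measurable. -/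
lemma pairing_withDensity_of_bound {x g : ℝ → ℝ} {T C : ℝ}
    (hxm : AEMeasurable x (volume.restrict (Icc 0 T))) (hC : ∀ t ∈ Icc 0 T, |x t| ≤ C)
    (hg : IntegrableOn g (Icc 0 T)) :
    pairing x ((volume.restrict (Icc 0 T)).withDensityᵥ g) = ∫ t in Icc 0 T, x t * g t := by
  have key : ∀ f : ℝ → ℝ, IntegrableOn f (Icc 0 T) →
      IsFiniteMeasure ((volume.restrict (Icc 0 T)).withDensity fun t => ENNReal.ofReal (f t)) := by
    intro f hf
    exact isFiniteMeasure_withDensity_ofReal hf.2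
  have := key g hg
  have := key (fun t => - g t) hg.neg
  rw [pairing]
  rw [withDensityᵥ_eq_withDensity_pos_part_sub_withDensity_neg_part hg]
  have hint : ∀ f : ℝ → ℝ, ∀ hf : IntegrableOn f (Icc 0 T),
      Integrable x ((volume.restrict (Icc 0 T)).withDensity fun t => ENNReal.ofReal (f t)) := by
    intro f hf
    have := key f hf
    refine Integrable.of_bound
        (hxm.mono_ac (withDensity_absolutelyContinuous _ _)).aestronglyMeasurable
      C ?_
    refine (withDensity_absolutelyContinuous _ _).ae_le ?_
    filter_upwards [ae_restrict_mem measurableSet_Icc] with t ht using hC t ht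
  have hval : ∀ f : ℝ → ℝ, ∀ hf : IntegrableOn f (Icc 0 T),
      ∫ t, x t ∂((volume.restrict (Icc 0 T)).withDensity fun t => ENNReal.ofReal (f t))
        = ∫ t in Icc 0 T, max (f t) 0 * x t := by
    intro f hf
    rw [integral_withDensity_eq_integral_toReal_smul₀ hf.1.aemeasurable.ennreal_ofReal (by simp)]
    simp [ENNReal.toReal_ofReal']
  have hI : ∀ f : ℝ → ℝ, ∀ hf : IntegrableOn f (Icc 0 T),
      IntegrableOn (fun t => max (f t) 0 * x t) (Icc 0 T) := by
    intro f hf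
    refine Integrable.mul_bdd (c := C) hf.pos_part hxm.aestronglyMeasurable ?_
    filter_upwards [ae_restrict_mem measurableSet_Icc] with t ht using hC t ht
  rw [VectorMeasure.integral_sub_vectorMeasure, VectorMeasure.integral_toSignedMeasure,
    VectorMeasure.integral_toSignedMeasure, hval g hg, hval (fun t => - g t) hg.neg,
    ← integral_sub (hI g hg) (hI (fun t => - g t) hg.neg)]
  · refine integral_congr_ae (Eventually.of_forall fun t => ?_)
    simp only
    rcases le_total (g t) 0 with h | h
    · rw [max_eq_right h, max_eq_left (by linarith)]; ring
    · rw [max_eq_left h, max_eq_right (by linarith)]; ring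
  · rw [VectorMeasure.Integrable, Measure.variation_toSignedMeasure]
    exact hint g hg
  · rw [VectorMeasure.Integrable, Measure.variation_toSignedMeasure]
    exact hint _ hg.neg

lemma pairing_withDensity {x g : ℝ → ℝ} {T : ℝ} (hT : 0 < T) (hx : x ∈ Vr T)
    (hg : IntegrableOn g (Icc 0 T)) :
    pairing x ((volume.restrict (Icc 0 T)).withDensityᵥ g) = ∫ t in Icc 0 T, x t * g t := by
  obtain ⟨C, hC⟩ := BoundedVariationOn.exists_bound hT hx.2
  exact pairing_withDensity_of_bound (BoundedVariationOn.aemeasurable_restrict volume hx.2) hC hg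

lemma mem_Vr_of_continuousOn {x : ℝ → ℝ} {T : ℝ} (hx : ContinuousOn x (Icc 0 T))
    (hb : BoundedVariationOn x (Icc 0 T)) : x ∈ Vr T := by
  refine ⟨⟨fun t ht => ?_, fun t ht => ⟨x t, ?_⟩⟩, hb⟩
  · refine ((hx t ⟨ht.1, ht.2.le⟩).mono_of_mem_nhdsWithin ?_)
    exact mem_of_superset (Ioo_mem_nhdsGT ht.2) fun s hs => ⟨ht.1.trans hs.1.le, hs.2.le⟩
  · refine ((hx t ⟨ht.1.le, ht.2⟩).mono_of_mem_nhdsWithin ?_).tendsto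
    exact mem_of_superset (Ioo_mem_nhdsLT ht.1) fun s hs => ⟨hs.1.le, hs.2.le.trans ht.2⟩

lemma LipschitzOnWith.mem_Vr {x : ℝ → ℝ} {C : NNReal} {T : ℝ} (hT : 0 < T)
    (hx : LipschitzOnWith C x (Icc 0 T)) : x ∈ Vr T := by
  refine mem_Vr_of_continuousOn hx.continuousOn ?_
  have := hx.locallyBoundedVariationOn 0 T (left_mem_Icc.2 hT.le) (right_mem_Icc.2 hT.le)
  rwa [inter_self] at this

/-- Integration by parts against a finite measure. -/
lemma integral_primitive_eq {v : ℝ → ℝ} {T : ℝ} (hT : 0 < T)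
    (hv : IntervalIntegrable v volume 0 T) (ρ : Measure ℝ) [IsFiniteMeasure ρ] :
    ∫ t in Icc 0 T, (∫ s in (0 : ℝ)..t, v s) ∂ρ
      = ∫ s in (0 : ℝ)..T, v s * ρ.real (Icc s T) := by
  have hv' : Integrable v (volume.restrict (Ioc 0 T)) :=
    (intervalIntegrable_iff_integrableOn_Ioc_of_le hT.le).1 hv
  have hS : MeasurableSet {q : ℝ × ℝ | q.2 ≤ q.1} :=
    measurableSet_le measurable_snd measurable_fst
  have hint : Integrable (Function.uncurry fun t s : ℝ =>
      {q : ℝ × ℝ | q.2 ≤ q.1}.indicator (fun q => v q.2) (t, s))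
      ((ρ.restrict (Icc 0 T)).prod (volume.restrict (Ioc 0 T))) :=
    (hv'.comp_snd (ρ.restrict (Icc 0 T))).indicator hS
  have hswap := integral_integral_swap hint
  rw [intervalIntegral.integral_of_le hT.le]
  calc _ = ∫ t in Icc 0 T, (∫ s in Ioc 0 T,
        {q : ℝ × ℝ | q.2 ≤ q.1}.indicator (fun q => v q.2) (t, s)) ∂ρ := by
        refine setIntegral_congr_fun measurableSet_Icc fun t ht => ?_
        rw [intervalIntegral.integral_of_le ht.1]
        have : (fun s => {q : ℝ × ℝ | q.2 ≤ q.1}.indicator (fun q => v q.2) (t, s))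
            = (Iic t).indicator v := by
          ext s; simp [indicator]
        rw [this, setIntegral_indicator measurableSet_Iic, Ioc_inter_Iic, min_eq_right ht.2]
    _ = ∫ s in Ioc 0 T, (∫ t in Icc 0 T,
        {q : ℝ × ℝ | q.2 ≤ q.1}.indicator (fun q => v q.2) (t, s) ∂ρ) := hswap
    _ = _ := by
        refine setIntegral_congr_fun measurableSet_Ioc fun s hs => ?_
        have : (fun t => {q : ℝ × ℝ | q.2 ≤ q.1}.indicator (fun q => v q.2) (t, s))
            = (Ici s).indicator fun _ => v s := by
          ext t; simp [indicator]
        rw [this, setIntegral_indicator measurableSet_Ici, setIntegral_const, smul_eq_mul, mul_comm]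
        congr 2
        ext t
        simp only [mem_inter_iff, mem_Icc, mem_Ici]
        exact ⟨fun h => ⟨h.2, h.1.2⟩, fun h => ⟨⟨hs.1.le.trans h.1, h.2⟩, h.1⟩⟩

lemma restrict_posPart {T : ℝ} {θ : SignedMeasure ℝ} (hθ : θ ∈ M T) :
    θ.toJordanDecomposition.posPart.restrict (Icc 0 T) = θ.toJordanDecomposition.posPart :=
  Measure.restrict_eq_self_of_ae_mem
    ((posPart_le_variation θ).absolutelyContinuous.ae_le (ae_variation_mem hθ))

lemma restrict_negPart {T : ℝ} {θ : SignedMeasure ℝ} (hθ : θ ∈ M T) :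
    θ.toJordanDecomposition.negPart.restrict (Icc 0 T) = θ.toJordanDecomposition.negPart :=
  Measure.restrict_eq_self_of_ae_mem
    ((negPart_le_variation θ).absolutelyContinuous.ae_le (ae_variation_mem hθ))

lemma antitoneOn_measureReal_Icc (ρ : Measure ℝ) [IsFiniteMeasure ρ] (T : ℝ) :
    Antitone fun s => ρ.real (Icc s T) :=
  fun _ _ hst => measureReal_mono (Icc_subset_Icc_left hst)

lemma measurable_apply_Icc (θ : SignedMeasure ℝ) (T : ℝ) : Measurable fun s => θ (Icc s T) := by
  simp_rw [apply_eq_sub θ measurableSet_Icc]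
  exact (antitoneOn_measureReal_Icc _ T).measurable.sub (antitoneOn_measureReal_Icc _ T).measurable

lemma abs_apply_le (θ : SignedMeasure ℝ) (s : Set ℝ) : |θ s| ≤ θ.variation.real univ := by
  have h := θ.norm_le_totalVariation s
  rw [SignedMeasure.totalVariation_eq_variation, Real.norm_eq_abs] at h
  exact h.trans (measureReal_mono (subset_univ s))

lemma intervalIntegrable_mul_apply {v : ℝ → ℝ} {T : ℝ}
    (hv : IntervalIntegrable v volume 0 T) (θ : SignedMeasure ℝ) :
    IntervalIntegrable (fun s => v s * θ (Icc s T)) volume 0 T := by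
  rw [intervalIntegrable_iff] at hv ⊢
  exact Integrable.mul_bdd (c := θ.variation.real univ) hv
    (measurable_apply_Icc θ T).aestronglyMeasurable
    (Eventually.of_forall fun s => abs_apply_le θ _)

/-- Fubini on each Jordan part. In this form the pairing and `cumG` depend on the measure only
through `θ (Icc s T)`, so the rate can be bounded pointwise in `s`. The path starts at `0`, hence an
atom of `θ` at `0` contributes nothing. -/
lemma pairing_primitive {v x : ℝ → ℝ} {T : ℝ} (hT : 0 < T)
    (hv : IntervalIntegrable v volume 0 T) (hxv : ∀ t ∈ Icc 0 T, x t = ∫ s in (0 : ℝ)..t, v s)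
    (hx : x ∈ Vr T) {θ : SignedMeasure ℝ} (hθ : θ ∈ M T) :
    pairing x θ = ∫ s in (0 : ℝ)..T, v s * θ (Icc s T) := by
  rw [pairing_eq_sub (Vr.integrable_variation hT hx hθ)]
  have hI : ∀ ρ : Measure ℝ, IsFiniteMeasure ρ →
      IntervalIntegrable (fun s => v s * ρ.real (Icc s T)) volume 0 T := by
    intro ρ _
    rw [intervalIntegrable_iff] at hv ⊢
    refine Integrable.mul_bdd (c := ρ.real univ) hv
      (antitoneOn_measureReal_Icc ρ T).measurable.aestronglyMeasurable
      (Eventually.of_forall fun s => ?_)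
    rw [Real.norm_eq_abs, abs_of_nonneg measureReal_nonneg]
    exact measureReal_mono (subset_univ _)
  have hJ : ∀ ρ : Measure ℝ, IsFiniteMeasure ρ → ρ.restrict (Icc 0 T) = ρ →
      ∫ t, x t ∂ρ = ∫ s in (0 : ℝ)..T, v s * ρ.real (Icc s T) := by
    intro ρ _ hρ
    rw [← integral_primitive_eq hT hv]
    conv_lhs => rw [← hρ]
    exact setIntegral_congr_fun measurableSet_Icc hxv
  rw [hJ _ inferInstance (restrict_posPart hθ), hJ _ inferInstance (restrict_negPart hθ),
    ← intervalIntegral.integral_sub (hI _ inferInstance) (hI _ inferInstance)]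
  refine intervalIntegral.integral_congr fun s _ => ?_
  rw [apply_eq_sub θ measurableSet_Icc]
  ring

/-! ### Extended integrals -/

section extIntegral

variable {α : Type*} [MeasurableSpace α] {μ : Measure α}

lemma extIntegral_congr_ae {f g : α → EReal} (h : f =ᵐ[μ] g) :
    extIntegral μ f = extIntegral μ g := by
  have h1 := lintegral_congr_ae (h.fun_comp EReal.toENNReal)
  have h2 := lintegral_congr_ae (h.fun_comp fun r => (-r).toENNReal)
  simp only [Function.comp_def] at h1 h2
  rw [extIntegral, h1, h2, extIntegral]

lemma toENNReal_coe_real (r : ℝ) : ((r : ℝ) : EReal).toENNReal = ENNReal.ofReal r := by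
  simp

lemma extIntegral_coe {f : α → ℝ} (hf : Integrable f μ) :
    extIntegral μ (fun a => (f a : EReal)) = ((∫ a, f a ∂μ : ℝ) : EReal) := by
  rw [integral_eq_lintegral_pos_part_sub_lintegral_neg_part hf]
  have h1 : ∫⁻ a, ENNReal.ofReal (f a) ∂μ ≠ ⊤ := hf.lintegral_lt_top.ne
  have h2 : ∫⁻ a, ENNReal.ofReal (-f a) ∂μ ≠ ⊤ := hf.neg.lintegral_lt_top.ne
  unfold extIntegral
  simp only [← EReal.coe_neg, toENNReal_coe_real]
  rw [EReal.coe_sub, EReal.coe_ennreal_toReal h1, EReal.coe_ennreal_toReal h2]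

lemma integrable_of_lintegral_ofReal_ne_top {f : α → ℝ} (hm : AEMeasurable f μ)
    (hp : ∫⁻ a, ENNReal.ofReal (f a) ∂μ ≠ ⊤) (hn : ∫⁻ a, ENNReal.ofReal (-f a) ∂μ ≠ ⊤) :
    Integrable f μ := by
  refine ⟨hm.aestronglyMeasurable, ?_⟩
  rw [hasFiniteIntegral_iff_enorm]
  have : ∀ a, ‖f a‖ₑ = ENNReal.ofReal (f a) + ENNReal.ofReal (-f a) := by
    intro a
    rw [Real.enorm_eq_ofReal_abs]
    rcases le_total (f a) 0 with h | h
    · rw [abs_of_nonpos h, ENNReal.ofReal_of_nonpos h, zero_add]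
    · rw [abs_of_nonneg h, ENNReal.ofReal_of_nonpos (neg_nonpos.2 h), add_zero]
  simp_rw [this]
  rw [lintegral_add_left' hm.ennreal_ofReal]
  exact ENNReal.add_lt_top.2 ⟨hp.lt_top, hn.lt_top⟩

lemma extIntegral_coe_eq_bot {f : α → ℝ} (hm : AEMeasurable f μ)
    (hp : ∫⁻ a, ENNReal.ofReal (f a) ∂μ ≠ ⊤) (hf : ¬ Integrable f μ) :
    extIntegral μ (fun a => (f a : EReal)) = ⊥ := by
  have hn : ∫⁻ a, ENNReal.ofReal (-f a) ∂μ = ⊤ := by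
    by_contra hn
    exact hf (integrable_of_lintegral_ofReal_ne_top hm hp hn)
  unfold extIntegral
  simp only [← EReal.coe_neg, toENNReal_coe_real, hn, EReal.coe_ennreal_top]
  exact EReal.sub_top _

lemma bot_lt_extIntegral {f : α → EReal} (hn : ∫⁻ a, (-f a).toENNReal ∂μ ≠ ⊤) :
    ⊥ < extIntegral μ f := by
  unfold extIntegral
  lift ∫⁻ a, (-f a).toENNReal ∂μ to NNReal using hn with b
  refine bot_lt_iff_ne_bot.2 fun h => ?_
  rw [sub_eq_add_neg, EReal.add_eq_bot_iff] at h
  rcases h with h | h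
  · exact EReal.coe_ennreal_ne_bot _ h
  · simp at h

lemma extIntegral_eq_of_lt_top {f : α → EReal} (hm : AEMeasurable f μ)
    (hn : ∫⁻ a, (-f a).toENNReal ∂μ ≠ ⊤) (hf : extIntegral μ f < ⊤) :
    (∀ᵐ a ∂μ, f a < ⊤) ∧ Integrable (fun a => (f a).toReal) μ ∧
      extIntegral μ f = ((∫ a, (f a).toReal ∂μ : ℝ) : EReal) := by
  have hp : ∫⁻ a, (f a).toENNReal ∂μ ≠ ⊤ := by
    intro h
    rw [extIntegral, h] at hf
    lift ∫⁻ a, (-f a).toENNReal ∂μ to NNReal using hn with b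
    rw [EReal.coe_ennreal_top] at hf
    exact hf.ne (EReal.top_sub_coe _)
  have hpm : AEMeasurable (fun a => (f a).toENNReal) μ := by fun_prop
  have hnm : AEMeasurable (fun a => (-f a).toENNReal) μ := by fun_prop
  have htop : ∀ᵐ a ∂μ, f a < ⊤ := by
    filter_upwards [ae_lt_top' hpm hp] with a ha
    refine lt_top_iff_ne_top.2 fun h => ?_
    simp [h] at ha
  have hbot : ∀ᵐ a ∂μ, ⊥ < f a := by
    filter_upwards [ae_lt_top' hnm hn] with a ha
    refine bot_lt_iff_ne_bot.2 fun h => ?_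
    simp [h] at ha
  have hcoe : f =ᵐ[μ] fun a => ((f a).toReal : EReal) := by
    filter_upwards [htop, hbot] with a h1 h2
    rw [EReal.coe_toReal h1.ne h2.ne']
  have hint : Integrable (fun a => (f a).toReal) μ := by
    refine integrable_of_lintegral_ofReal_ne_top hm.ereal_toReal ?_ ?_
    · have h1 := lintegral_congr_ae (hcoe.symm.fun_comp EReal.toENNReal)
      simp only [Function.comp_def, toENNReal_coe_real] at h1
      rwa [h1]
    · have h1 := lintegral_congr_ae (hcoe.symm.fun_comp fun r => (-r).toENNReal)
      simp only [Function.comp_def, ← EReal.coe_neg, toENNReal_coe_real] at h1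
      rwa [h1]
  exact ⟨htop, hint, (extIntegral_congr_ae hcoe).trans (extIntegral_coe hint)⟩

end extIntegral

/-! ### The log-payoff -/

lemma H_of_pos {K T : ℝ} {x : ℝ → ℝ}
    (h : 0 < K - 1 / T * ∫ t in (0 : ℝ)..T, Real.exp (x t)) :
    H K T x = ((Real.log (K - 1 / T * ∫ t in (0 : ℝ)..T, Real.exp (x t)) : ℝ) : EReal) := by
  rw [H, ENNReal.log_ofReal_of_pos h]

lemma H_of_nonpos {K T : ℝ} {x : ℝ → ℝ}
    (h : K - 1 / T * ∫ t in (0 : ℝ)..T, Real.exp (x t) ≤ 0) : H K T x = ⊥ := by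
  rw [H, ENNReal.ofReal_of_nonpos h, ENNReal.log_zero]

lemma log_le_tangent {a b : ℝ} (ha : 0 < a) (hb : 0 < b) :
    Real.log a ≤ Real.log b + (a / b - 1) := by
  have h := Real.log_le_sub_one_of_pos (div_pos ha hb)
  rw [Real.log_div ha.ne' hb.ne'] at h
  linarith

/-- Young's inequality for the pair `exp`, `b log b - b`. -/
lemma mul_le_exp_div {κ b x : ℝ} (hκ : 0 < κ) (hb : 0 ≤ b) :
    x * b ≤ Real.exp x / κ - b + b * Real.log (κ * b) := by
  rcases hb.eq_or_lt with rfl | hb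
  · simp; positivity
  · have h := Real.add_one_le_exp (x - Real.log (κ * b))
    rw [Real.exp_sub, Real.exp_log (by positivity)] at h
    have h2 := mul_le_mul_of_nonneg_left h hb.le
    have : b * (Real.exp x / (κ * b)) = Real.exp x / κ := by field_simp
    rw [this] at h2
    nlinarith

lemma mul_log_ge {κ b : ℝ} (hκ : 0 < κ) (hb : 0 ≤ b) : -(1 / κ) ≤ b * Real.log (κ * b) := by
  have := mul_le_exp_div (x := 0) hκ hb
  simp only [zero_mul, Real.exp_zero] at this
  linarith

/-- The upper bound for `H(x) - ∫ x dθ` when `θ` has density `-b`. -/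
lemma log_payoff_add_le {K T : ℝ} (hK : 0 < K) (hT : 0 < T) {x b : ℝ → ℝ} (hx : x ∈ Vr T)
    (hb : IntegrableOn b (Icc 0 T)) (hb0 : ∀ᵐ t ∂volume.restrict (Icc 0 T), 0 ≤ b t)
    (hpos : 0 < K - 1 / T * ∫ t in (0 : ℝ)..T, Real.exp (x t)) {A : ℝ}
    (hA : A = 1 + ∫ t in Icc 0 T, b t)
    (hL : IntegrableOn (fun t => b t * Real.log (K * T / A * b t)) (Icc 0 T)) :
    Real.log (K - 1 / T * ∫ t in (0 : ℝ)..T, Real.exp (x t)) + ∫ t in Icc 0 T, x t * b t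
      ≤ Real.log (K / A) + ∫ t in Icc 0 T, b t * Real.log (K * T / A * b t) := by
  have hA0 : 0 < A := by
    have : 0 ≤ ∫ t in Icc 0 T, b t := integral_nonneg_of_ae hb0
    linarith
  have hκ : 0 < K * T / A := by positivity
  obtain ⟨C, hC⟩ := BoundedVariationOn.exists_bound hT hx.2
  have hxb : IntegrableOn (fun t => x t * b t) (Icc 0 T) := by
    refine Integrable.bdd_mul (c := C) hb
      (BoundedVariationOn.aemeasurable_restrict volume hx.2).aestronglyMeasurable ?_
    filter_upwards [ae_restrict_mem measurableSet_Icc] with t ht using hC t ht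
  have hexp := Vr.integrable_exp hT hx
  have h1 : ∫ t in Icc 0 T, x t * b t ≤
      (∫ t in Icc 0 T, Real.exp (x t)) / (K * T / A) - (∫ t in Icc 0 T, b t)
        + ∫ t in Icc 0 T, b t * Real.log (K * T / A * b t) := by
    have hd : IntegrableOn (fun t => Real.exp (x t) / (K * T / A) - b t) (Icc 0 T) :=
      (hexp.div_const _).sub hb
    rw [← integral_div, ← integral_sub (hexp.div_const _) hb, ← integral_add hd hL]
    refine integral_mono_ae hxb (hd.add hL) ?_
    filter_upwards [hb0] with t ht
    exact mul_le_exp_div hκ ht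
  rw [intervalIntegral.integral_of_le hT.le, ← integral_Icc_eq_integral_Ioc] at hpos ⊢
  have h2 := log_le_tangent hpos (div_pos hK hA0)
  have h3 : (K - 1 / T * ∫ t in Icc 0 T, Real.exp (x t)) / (K / A)
      = A - (∫ t in Icc 0 T, Real.exp (x t)) / (K * T / A) := by
    field_simp
  rw [h3] at h2
  linarith

/-! ### The conjugate of the log-payoff -/

/-- The conjugate may be tested on bounded pointwise limits of paths, by dominated convergence.
There are two limits `v` and `w` because Lebesgue measure and `θ.variation` may be mutually
singular. -/
lemma le_Hhat_of_tendsto {K T C : ℝ} (hT : 0 < T) {θ : SignedMeasure ℝ} (hθ : θ ∈ M T)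
    {u : ℕ → ℝ → ℝ} {v w : ℝ → ℝ} (hu : ∀ k, u k ∈ Vr T)
    (hC : ∀ k, ∀ t ∈ Icc 0 T, |u k t| ≤ C)
    (hv : ∀ᵐ t ∂volume.restrict (Icc 0 T), Tendsto (fun k => u k t) atTop (𝓝 (v t)))
    (hw : ∀ᵐ t ∂θ.variation, Tendsto (fun k => u k t) atTop (𝓝 (w t)))
    (hpos : 0 < K - 1 / T * ∫ t in Icc 0 T, Real.exp (v t)) :
    ((Real.log (K - 1 / T * ∫ t in Icc 0 T, Real.exp (v t)) - pairing w θ : ℝ) : EReal)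
      ≤ Hhat K T θ := by
  have h1 : Tendsto (fun k => pairing (u k) θ) atTop (𝓝 (pairing w θ)) := by
    refine VectorMeasure.tendsto_integral_filter_of_norm_le_const
      (Eventually.of_forall fun k => (Vr.integrable_variation hT (hu k) hθ).1)
      ⟨C, Eventually.of_forall fun k => ?_⟩ hw
    filter_upwards [ae_variation_mem hθ] with t ht using hC k t ht
  have h2 : Tendsto (fun k => ∫ t in Icc 0 T, Real.exp (u k t)) atTop
      (𝓝 (∫ t in Icc 0 T, Real.exp (v t))) := by
    refine tendsto_integral_of_dominated_convergence (fun _ => Real.exp C)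
      (fun k => (Vr.integrable_exp hT (hu k)).1) (integrable_const _) (fun k => ?_) ?_
    · filter_upwards [ae_restrict_mem measurableSet_Icc] with t ht
      rw [Real.norm_eq_abs, Real.abs_exp]
      exact Real.exp_le_exp.2 (le_of_abs_le (hC k t ht))
    · filter_upwards [hv] with t ht using (Real.continuous_exp.tendsto _).comp ht
  have h3 : Tendsto (fun k => K - 1 / T * ∫ t in Icc 0 T, Real.exp (u k t)) atTop
      (𝓝 (K - 1 / T * ∫ t in Icc 0 T, Real.exp (v t))) := (h2.const_mul _).const_sub _
  have h4 := ((Real.continuousAt_log hpos.ne').tendsto.comp h3).sub h1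
  refine le_of_tendsto (((continuous_coe_real_ereal.tendsto _).comp h4)) ?_
  filter_upwards [h3.eventually (lt_mem_nhds hpos)] with k hk
  have : K - 1 / T * ∫ t in Icc 0 T, Real.exp (u k t)
      = K - 1 / T * ∫ t in (0 : ℝ)..T, Real.exp (u k t) := by
    rw [intervalIntegral.integral_of_le hT.le, ← integral_Icc_eq_integral_Ioc]
  simp only [Function.comp_apply]
  rw [this] at hk ⊢
  rw [EReal.coe_sub, ← H_of_pos hk]
  exact le_iSup₂ (f := fun x (_ : x ∈ Vr T) => H K T x - (pairing x θ : EReal)) (u k) (hu k)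

lemma pairing_const_add_indicator (θ : SignedMeasure ℝ) {F : Set ℝ} (hF : MeasurableSet F)
    (c m : ℝ) :
    pairing (fun t => c + m * F.indicator 1 t) θ = c * θ univ + m * θ F := by
  have hint : ∀ ρ : Measure ℝ, IsFiniteMeasure ρ →
      Integrable (fun t => m * F.indicator (1 : ℝ → ℝ) t) ρ := fun ρ _ =>
    ((integrable_const (1 : ℝ)).indicator hF).const_mul m
  have hval : ∀ ρ : Measure ℝ, IsFiniteMeasure ρ →
      ∫ t, c + m * F.indicator (1 : ℝ → ℝ) t ∂ρ = c * ρ.real univ + m * ρ.real F := by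
    intro ρ _
    rw [integral_add (integrable_const _) (hint ρ inferInstance), integral_const,
        integral_const_mul,
      integral_indicator_one hF, smul_eq_mul, mul_comm c]
  have hadd : Integrable (fun t => c + m * F.indicator (1 : ℝ → ℝ) t) θ.variation :=
    (integrable_const _).add (hint _ inferInstance)
  rw [pairing_eq_sub hadd, hval _ inferInstance,
    hval _ inferInstance, apply_eq_sub θ hF, apply_eq_sub θ MeasurableSet.univ]
  ring

/-- The test function is `c + m 1_F`. If `θ F > 0`, let `m → -∞`, which only lowers the exponential;
if `F` is Lebesgue null and `θ F < 0`, let `m → +∞`, which the exponential integral does not see.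
Closedness makes `1_F` a limit of Lipschitz thickened indicators. -/
lemma Hhat_eq_top_of_isClosed {K T : ℝ} (hK : 0 < K) (hT : 0 < T) {θ : SignedMeasure ℝ}
    (hθ : θ ∈ M T) {F : Set ℝ} (hF : IsClosed F)
    (h : 0 < θ F ∨ (θ F < 0 ∧ volume.restrict (Icc 0 T) F = 0)) : Hhat K T θ = ⊤ := by
  -- This level uses up half of `K`, so the payoff stays at least `K / 2` for every admissible `m`.
  set c : ℝ := Real.log (K / 2) with hc
  have hexpc : Real.exp c = K / 2 := Real.exp_log (by positivity)
  have key : ∀ m : ℝ, (m ≤ 0 ∨ volume.restrict (Icc 0 T) F = 0) →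
      ((Real.log (K / 2) - (c * θ univ + m * θ F) : ℝ) : EReal) ≤ Hhat K T θ := by
    intro m hm
    have hδ : ∀ k : ℕ, 0 < 1 / ((k : ℝ) + 1) := fun k => Nat.one_div_pos_of_nat
    let u : ℕ → ℝ → ℝ := fun k t => c + m * (thickenedIndicator (hδ k) F t : ℝ)
    have hlim : ∀ t, Tendsto (fun k => u k t) atTop (𝓝 (c + m * F.indicator 1 t)) := by
      intro t
      have h1 := thickenedIndicator_tendsto_indicator_closure hδ
        tendsto_one_div_add_atTop_nhds_zero_nat F
      have h2 := (NNReal.continuous_coe.tendsto _).comp (tendsto_pi_nhds.1 h1 t)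
      rw [hF.closure_eq] at h2
      refine ((h2.const_mul m).const_add c).congr' ?_ |>.trans ?_
      · exact Eventually.of_forall fun k => rfl
      · refine le_of_eq ?_
        congr 3
        by_cases ht : t ∈ F <;> simp [ht]
    have hb := le_Hhat_of_tendsto (K := K) (C := |c| + |m|) (u := u)
        (v := fun t => c + m * F.indicator 1 t)
      (w := fun t => c + m * F.indicator 1 t) hT hθ (fun k => ?_) (fun k t _ => ?_)
      (Eventually.of_forall hlim) (Eventually.of_forall hlim)
    · have hle : 1 / T * ∫ t in Icc 0 T, Real.exp (c + m * F.indicator 1 t) ≤ K / 2 := by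
        have h1 : ∫ t in Icc 0 T, Real.exp (c + m * F.indicator 1 t)
            ≤ ∫ t in Icc 0 T, Real.exp c := by
          refine integral_mono_of_nonneg (Eventually.of_forall fun t => (Real.exp_pos _).le)
            (integrable_const _) ?_
          rcases hm with hm | hm
          · refine Eventually.of_forall fun t => Real.exp_le_exp.2 ?_
            have : 0 ≤ F.indicator (1 : ℝ → ℝ) t := indicator_nonneg (fun _ _ => zero_le_one) t
            nlinarith
          · filter_upwards [measure_eq_zero_iff_ae_notMem.1 hm] with t ht
            simp [ht]
        rw [integral_const, hexpc, smul_eq_mul, measureReal_restrict_apply_univ,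
            Real.volume_real_Icc,
          sub_zero, max_eq_left hT.le] at h1
        calc _ ≤ 1 / T * (T * (K / 2)) := by gcongr
          _ = K / 2 := by field_simp
      refine le_trans ?_ (hb (by linarith))
      rw [pairing_const_add_indicator θ hF.measurableSet]
      refine EReal.coe_le_coe_iff.2 (sub_le_sub_right (Real.log_le_log (by positivity) ?_) _)
      linarith
    · have h1 : LipschitzWith (Real.toNNReal |m| * (Real.toNNReal (1 / ((k : ℝ) + 1)))⁻¹)
          (fun t => m * (thickenedIndicator (hδ k) F t : ℝ)) := by
        have h0 := lipschitzWith_thickenedIndicator (hδ k) F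
        refine LipschitzWith.of_dist_le_mul fun s t => ?_
        have := h0.dist_le_mul s t
        rw [NNReal.dist_eq] at this
        rw [Real.dist_eq, ← mul_sub, abs_mul, NNReal.coe_mul, Real.coe_toNNReal _ (abs_nonneg m),
          mul_assoc]
        exact mul_le_mul_of_nonneg_left this (abs_nonneg m)
      have h2 : LipschitzWith
          (Real.toNNReal |m| * (Real.toNNReal (1 / ((k : ℝ) + 1)))⁻¹) (u k) := by
        refine LipschitzWith.of_dist_le_mul fun s t => ?_
        have := h1.dist_le_mul s t
        rwa [← dist_add_left c] at this
      exact LipschitzOnWith.mem_Vr hT h2.lipschitzOnWith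
    · have h0 : (0 : ℝ) ≤ thickenedIndicator (hδ k) F t := NNReal.coe_nonneg _
      have h1 : (thickenedIndicator (hδ k) F t : ℝ) ≤ 1 := by
        exact_mod_cast thickenedIndicator_le_one (hδ k) F t
      refine (abs_add_le _ _).trans (add_le_add le_rfl ?_)
      rw [abs_mul, abs_of_nonneg h0]
      exact mul_le_of_le_one_right (abs_nonneg m) h1
  rw [EReal.eq_top_iff_forall_lt]
  intro r
  have hF0 : θ F ≠ 0 := by rcases h with h | h; exacts [h.ne', h.1.ne]
  set d : ℝ := Real.log (K / 2) - c * θ univ with hd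
  -- With this `m` the test value `d - m * θ F` equals `|r| + |d| + 1`, which exceeds `r`.
  have hle : (d - |r| - |d| - 1) / θ F ≤ 0 ∨ volume.restrict (Icc 0 T) F = 0 := by
    refine h.imp (fun hpos => div_nonpos_of_nonpos_of_nonneg ?_ hpos.le) fun hn => hn.2
    linarith [le_abs_self d, abs_nonneg r]
  refine lt_of_lt_of_le (EReal.coe_lt_coe_iff.2 ?_) (key _ hle)
  rw [div_mul_cancel₀ _ hF0]
  linarith [le_abs_self r, abs_nonneg d]

lemma hasNonposDensity_of_absolutelyContinuous {T : ℝ} {θ : SignedMeasure ℝ}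
    (hneg : ∀ B, MeasurableSet B → θ B ≤ 0)
    (hac : ∀ B, MeasurableSet B → volume.restrict (Icc 0 T) B = 0 → θ B = 0) :
    ∃ g, HasNonposDensity T θ g := by
  have hθ :
      (volume.restrict (Icc 0 T)).withDensityᵥ (θ.rnDeriv (volume.restrict (Icc 0 T))) = θ := by
    refine SignedMeasure.withDensityᵥ_rnDeriv_eq _ _ (VectorMeasure.AbsolutelyContinuous.mk ?_)
    intro B hB h
    rw [Measure.toENNRealVectorMeasure_apply_measurable hB] at h
    exact hac B hB h
  have hint := SignedMeasure.integrable_rnDeriv θ (volume.restrict (Icc 0 T))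
  refine ⟨θ.rnDeriv (volume.restrict (Icc 0 T)), hint, ?_, hθ.symm⟩
  have h1 := ae_nonneg_of_forall_setIntegral_nonneg hint.neg fun B hB _ => ?_
  · filter_upwards [h1] with t ht
    simpa using ht
  · have h2 :
        ∫ t in B, θ.rnDeriv (volume.restrict (Icc 0 T)) t ∂volume.restrict (Icc 0 T) = θ B := by
      conv_rhs => rw [← hθ]
      rw [withDensityᵥ_apply hint hB]
    simp only [Pi.neg_apply]
    rw [integral_neg, h2]
    linarith [hneg B hB]

lemma Hhat_eq_top {K T : ℝ} (hK : 0 < K) (hT : 0 < T) {θ : SignedMeasure ℝ}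
    (hθ : θ ∈ M T) (h : ¬ ∃ g, HasNonposDensity T θ g) : Hhat K T θ = ⊤ := by
  obtain ⟨S, hS, hpS, hnS⟩ := θ.toJordanDecomposition.mutuallySingular
  have hclosed : ∀ ρ : Measure ℝ, IsFiniteMeasure ρ → ∀ B, MeasurableSet B → ρ B ≠ 0 →
      ∃ F ⊆ B, IsClosed F ∧ 0 < ρ.real F := by
    intro ρ _ B hB h0
    obtain ⟨F, hFB, hF, hpos⟩ := hB.exists_lt_isClosed_of_ne_top (measure_ne_top ρ B)
      (pos_iff_ne_zero.2 h0)
    exact ⟨F, hFB, hF, ENNReal.toReal_pos hpos.ne' (measure_ne_top _ _)⟩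
  have hr0 : ∀ ρ : Measure ℝ, ∀ {F B : Set ℝ}, F ⊆ B → ρ B = 0 → ρ.real F = 0 := by
    intro ρ F B hFB hB
    rw [measureReal_def, measure_mono_null hFB hB, ENNReal.toReal_zero]
  -- The positive part lives on `Sᶜ`, the negative part on `S`. Either the positive part charges a
  -- closed subset of `Sᶜ`, or `θ` is nonpositive and the obstruction is a Lebesgue null set that it
  -- charges; inner regularity makes that set closed.
  by_cases hp : θ.toJordanDecomposition.posPart Sᶜ = 0
  · have hneg : ∀ B, MeasurableSet B → θ B = - θ.toJordanDecomposition.negPart.real B := by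
      intro B hB
      have h0 : θ.toJordanDecomposition.posPart univ = 0 := by
        rw [← union_compl_self S, measure_union_null_iff]
        exact ⟨hpS, hp⟩
      rw [apply_eq_sub θ hB, hr0 _ (subset_univ B) h0, zero_sub]
    have : ∃ B, MeasurableSet B ∧ volume.restrict (Icc 0 T) B = 0 ∧ θ B ≠ 0 := by
      by_contra! hcon
      refine h (hasNonposDensity_of_absolutelyContinuous (fun B hB => ?_) hcon)
      rw [hneg B hB]
      exact neg_nonpos.2 measureReal_nonneg
    obtain ⟨B, hB, hB0, hθB⟩ := this
    obtain ⟨F, hFB, hF, hpos⟩ := hclosed θ.toJordanDecomposition.negPart inferInstance B hB (by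
      intro h0
      rw [hneg B hB, hr0 _ subset_rfl h0, neg_zero] at hθB
      exact hθB rfl)
    refine Hhat_eq_top_of_isClosed hK hT hθ hF (Or.inr ⟨?_, measure_mono_null hFB hB0⟩)
    rw [hneg F hF.measurableSet]
    linarith
  · obtain ⟨F, hFB, hF, hpos⟩ := hclosed _ inferInstance Sᶜ hS.compl hp
    refine Hhat_eq_top_of_isClosed hK hT hθ hF (Or.inl ?_)
    rw [apply_eq_sub θ hF.measurableSet, hr0 θ.toJordanDecomposition.negPart hFB hnS, sub_zero]
    exact hpos

/-- When `θ` has a density, any bounded measurable `u` is admissible: its forward averages are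
Lipschitz, bounded by the same constant, and converge to `u` almost everywhere by Lebesgue
differentiation. -/
lemma le_Hhat_withDensity {K T C : ℝ} (hT : 0 < T) {u g : ℝ → ℝ}
    (hg : IntegrableOn g (Icc 0 T)) (hum : AEMeasurable u (volume.restrict (Icc 0 T)))
    (hC : ∀ t ∈ Icc 0 T, |u t| ≤ C) (hpos : 0 < K - 1 / T * ∫ t in Icc 0 T, Real.exp (u t)) :
    ((Real.log (K - 1 / T * ∫ t in Icc 0 T, Real.exp (u t)) - ∫ t in Icc 0 T, u t * g t : ℝ) :
        EReal)
      ≤ Hhat K T ((volume.restrict (Icc 0 T)).withDensityᵥ g) := by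
  have hC0 : 0 ≤ C := (abs_nonneg _).trans (hC 0 (left_mem_Icc.2 hT.le))
  -- Extension by zero keeps the forward averages meaningful near `T`.
  set w : ℝ → ℝ := (Icc 0 T).indicator u with hw
  have hwC : ∀ t, |w t| ≤ C := by
    intro t
    by_cases ht : t ∈ Icc 0 T
    · rw [hw, indicator_of_mem ht]; exact hC t ht
    · rw [hw, indicator_of_notMem ht, abs_zero]; exact hC0
  have hwi : Integrable w := by
    rw [hw, integrable_indicator_iff measurableSet_Icc]
    refine Integrable.of_bound hum.aestronglyMeasurable C ?_
    filter_upwards [ae_restrict_mem measurableSet_Icc] with t ht using hC t ht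
  have hδ : ∀ k : ℕ, 0 < 1 / ((k : ℝ) + 1) := fun k => Nat.one_div_pos_of_nat
  let U : ℝ → ℝ := fun t => ∫ s in (0 : ℝ)..t, w s
  have hU : ∀ s t, |U t - U s| ≤ C * |t - s| := by
    intro s t
    have : U t - U s = ∫ r in s..t, w r := by
      simp only [U]
      rw [intervalIntegral.integral_interval_sub_left hwi.intervalIntegrable hwi.intervalIntegrable]
    rw [this]
    exact intervalIntegral.norm_integral_le_of_norm_le_const (f := w) (C := C) fun r _ => hwC r
  let W : ℕ → ℝ → ℝ := fun k t => (1 / ((k : ℝ) + 1))⁻¹ * (U (t + 1 / ((k : ℝ) + 1)) - U t)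
  have hlim : ∀ᵐ t, Tendsto (fun k => W k t) atTop (𝓝 (w t)) := by
    filter_upwards [LocallyIntegrable.ae_hasDerivAt_integral hwi.locallyIntegrable] with t ht
    have h1 := hasDerivAt_iff_tendsto_slope_zero.1 (ht 0)
    refine h1.comp (tendsto_nhdsWithin_iff.2 ⟨tendsto_one_div_add_atTop_nhds_zero_nat,
      Eventually.of_forall fun k => (hδ k).ne'⟩)
  have hlim' : ∀ᵐ t ∂volume.restrict (Icc 0 T), Tendsto (fun k => W k t) atTop (𝓝 (u t)) := by
    filter_upwards [ae_restrict_of_ae hlim, ae_restrict_mem measurableSet_Icc] with t h1 ht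
    rwa [hw, indicator_of_mem ht] at h1
  have hb := le_Hhat_of_tendsto (K := K) (C := C) (u := W) (v := u) (w := u) hT
    (mem_M_withDensity T g) (fun k => ?_) (fun k t _ => ?_) hlim' ?_ hpos
  · rwa [pairing_withDensity_of_bound hum hC hg] at hb
  · refine LipschitzOnWith.mem_Vr (C := Real.toNNReal ((1 / ((k : ℝ) + 1))⁻¹ * (2 * C))) hT
      (LipschitzWith.of_dist_le_mul fun s t => ?_).lipschitzOnWith
    have hk := inv_pos.2 (hδ k)
    rw [Real.coe_toNNReal _ (by positivity), Real.dist_eq, Real.dist_eq, ← mul_sub, abs_mul,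
      abs_of_pos hk, mul_assoc]
    refine mul_le_mul_of_nonneg_left ?_ hk.le
    have h1 := hU (t + 1 / ((k : ℝ) + 1)) (s + 1 / ((k : ℝ) + 1))
    have h2 := hU t s
    rw [add_sub_add_right_eq_sub] at h1
    rw [abs_le] at h1 h2 ⊢
    constructor <;> linarith
  · have hk := inv_pos.2 (hδ k)
    have h1 := hU t (t + 1 / ((k : ℝ) + 1))
    rw [add_sub_cancel_left, abs_of_pos (hδ k)] at h1
    simp only [W]
    rw [abs_mul, abs_of_pos hk]
    calc _ ≤ (1 / ((k : ℝ) + 1))⁻¹ * (C * (1 / ((k : ℝ) + 1))) := by gcongr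
      _ = C := by field_simp
  · rw [Measure.variation_withDensityᵥ hg]
    exact (withDensity_absolutelyContinuous _ _).ae_le hlim'

/-- A lower bound independent of the truncation level `N`; it supplies the nonnegativity needed for
Fatou's lemma. -/
lemma mul_log_truncation_ge {κ b N : ℝ} (hκ : 0 < κ) (hb : 0 ≤ b) (hN : 1 / κ ≤ N) :
    -(1 / κ) ≤ b * Real.log (κ * max (1 / N) (min N b)) := by
  have hκ' : 0 < 1 / κ := by positivity
  have hN0 : 0 < N := hκ'.trans_le hN
  rcases le_total b N with h | h
  · rw [min_eq_right h]
    rcases hb.eq_or_lt with rfl | hb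
    · simp; positivity
    · refine (mul_log_ge hκ hb.le).trans (mul_le_mul_of_nonneg_left ?_ hb.le)
      exact Real.log_le_log (by positivity) (mul_le_mul_of_nonneg_left (le_max_right _ _) hκ.le)
  · rw [min_eq_left h]
    have h1 : 1 ≤ κ * max (1 / N) N := by
      calc 1 = κ * (1 / κ) := by field_simp
        _ ≤ κ * max (1 / N) N := by
          exact mul_le_mul_of_nonneg_left (hN.trans (le_max_right _ _)) hκ.le
    have := mul_nonneg hb (Real.log_nonneg h1)
    linarith

lemma truncation_eventuallyEq {b : ℝ} (hb : 0 < b) :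
    ∀ᶠ N : ℝ in atTop, max (1 / N) (min N b) = b := by
  filter_upwards [eventually_ge_atTop b, eventually_ge_atTop (1 / b)] with N h1 h2
  have hN : 0 < N := hb.trans_le h1
  rw [min_eq_right h1, max_eq_right]
  rw [div_le_iff₀ hb] at h2
  rw [div_le_iff₀ hN]
  linarith

/-- If the conjugate is finite, then the entropy of the density is. -/
lemma entropy_le_of_Hhat_le {K T R : ℝ} (hK : 0 < K) (hT : 0 < T) {b : ℝ → ℝ}
    (hb : IntegrableOn b (Icc 0 T)) (hb0 : ∀ᵐ t ∂volume.restrict (Icc 0 T), 0 ≤ b t) {A : ℝ}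
    (hA : A = 1 + ∫ t in Icc 0 T, b t)
    (hR : Hhat K T ((volume.restrict (Icc 0 T)).withDensityᵥ fun t => -b t) ≤ (R : EReal)) :
    IntegrableOn (fun t => b t * Real.log (K * T / A * b t)) (Icc 0 T) ∧
      Real.log (K / A) + ∫ t in Icc 0 T, b t * Real.log (K * T / A * b t) ≤ R := by
  have hA0 : 0 < A := by
    have : 0 ≤ ∫ t in Icc 0 T, b t := integral_nonneg_of_ae hb0
    linarith
  set κ : ℝ := K * T / A with hκd
  have hκ : 0 < κ := by positivity
  -- The shift gives both `N n ≥ 1 / κ`, for the uniform lower bound, and `N n ≥ 1`, so that `1 / N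
  -- n ≤ N n`.
  set N : ℕ → ℝ := fun n => (n : ℝ) + (1 / κ + 1) with hNd
  have hN1 : ∀ n, 1 / κ ≤ N n := fun n => by
    have : (0 : ℝ) ≤ n := n.cast_nonneg
    simp only [hNd]; linarith
  have hN2 : ∀ n, 1 ≤ N n := fun n => by
    have : (0 : ℝ) ≤ n := n.cast_nonneg
    have : 0 < 1 / κ := by positivity
    simp only [hNd]; linarith
  have hN0 : ∀ n, 0 < N n := fun n => zero_lt_one.trans_le (hN2 n)
  have hNlim : Tendsto N atTop atTop :=
    tendsto_atTop_add_const_right _ _ tendsto_natCast_atTop_atTop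
  set B : ℕ → ℝ → ℝ := fun n t => max (1 / N n) (min (N n) (b t)) with hBd
  have hBpos : ∀ n t, 0 < B n t := fun n t =>
    (one_div_pos.2 (hN0 n)).trans_le (le_max_left _ _)
  have hinv : ∀ n, 1 / N n ≤ N n := fun n =>
    ((div_le_one (hN0 n)).2 (hN2 n)).trans (hN2 n)
  have hBle : ∀ n t, B n t ≤ N n := fun n t => max_le (hinv n) (min_le_left _ _)
  have hBge : ∀ n t, 1 / N n ≤ B n t := fun n t => le_max_left _ _
  have hBlim : ∀ t, 0 ≤ b t → Tendsto (fun n => B n t) atTop (𝓝 (b t)) := by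
    intro t ht
    rcases ht.eq_or_lt with h | h
    · have h1 : ∀ n, B n t = 1 / N n := by
        intro n
        simp only [hBd]
        rw [← h, min_eq_right (hN0 n).le, max_eq_left (one_div_pos.2 (hN0 n)).le]
      simp only [h1, ← h]
      exact (tendsto_const_nhds (x := (1 : ℝ))).div_atTop hNlim
    · exact tendsto_const_nhds.congr' ((hNlim.eventually (truncation_eventuallyEq h)).mono
        fun n hn => hn.symm)
  have hBm : ∀ n, AEMeasurable (B n) (volume.restrict (Icc 0 T)) := fun n =>
    aemeasurable_const.max (aemeasurable_const.min hb.aemeasurable)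
  have hB1 : Tendsto (fun n => ∫ t in Icc 0 T, B n t) atTop (𝓝 (∫ t in Icc 0 T, b t)) := by
    refine tendsto_integral_of_dominated_convergence (fun t => b t + 1)
      (fun n => (hBm n).aestronglyMeasurable) (hb.add (integrable_const _)) (fun n => ?_) ?_
    · filter_upwards [hb0] with t ht
      rw [Real.norm_eq_abs, abs_of_pos (hBpos n t)]
      refine max_le ?_ ((min_le_right _ _).trans (by linarith))
      have := (div_le_one (hN0 n)).2 (hN2 n)
      linarith
    · filter_upwards [hb0] with t ht using hBlim t ht
  -- This is the equality case of Young's inequality for the truncated density, bounded because the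
  -- truncation is bounded away from `0` and `∞`.
  set u : ℕ → ℝ → ℝ := fun n t => Real.log (κ * B n t) with hud
  have hum : ∀ n, AEMeasurable (u n) (volume.restrict (Icc 0 T)) := fun n =>
    ((hBm n).const_mul κ).log
  have huC : ∀ n, ∃ C, ∀ t, |u n t| ≤ C := by
    intro n
    refine ⟨max |Real.log (κ * (1 / N n))| |Real.log (κ * N n)|, fun t => ?_⟩
    have h0 := one_div_pos.2 (hN0 n)
    refine abs_le_max_abs_abs ?_ ?_
    · exact Real.log_le_log (by positivity) (mul_le_mul_of_nonneg_left (hBge n t) hκ.le)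
    · exact Real.log_le_log (mul_pos hκ (hBpos n t)) (mul_le_mul_of_nonneg_left (hBle n t) hκ.le)
  have hexp : ∀ n, ∫ t in Icc 0 T, Real.exp (u n t) = κ * ∫ t in Icc 0 T, B n t := by
    intro n
    rw [← integral_const_mul]
    exact integral_congr_ae (Eventually.of_forall fun t => Real.exp_log (mul_pos hκ (hBpos n t)))
  have hlim :
      Tendsto (fun n => K - 1 / T * ∫ t in Icc 0 T, Real.exp (u n t)) atTop (𝓝 (K / A)) := by
    have h1 := ((hB1.const_mul κ).const_mul (1 / T)).const_sub K
    have h2 : K - 1 / T * (κ * ∫ t in Icc 0 T, b t) = K / A := by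
      have : ∫ t in Icc 0 T, b t = A - 1 := by linarith
      rw [this, hκd]
      field_simp
      ring
    rw [h2] at h1
    simpa only [hexp] using h1
  have hKA : 0 < K / A := by positivity
  have hub : ∀ n, IntegrableOn (fun t => u n t * b t) (Icc 0 T) := by
    intro n
    obtain ⟨C, hC⟩ := huC n
    exact Integrable.bdd_mul (c := C) hb (hum n).aestronglyMeasurable (Eventually.of_forall hC)
  have hlow : ∀ n, ∀ᵐ t ∂volume.restrict (Icc 0 T), 0 ≤ u n t * b t + 1 / κ := by
    intro n
    filter_upwards [hb0] with t ht
    have := mul_log_truncation_ge hκ ht (hN1 n)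
    simp only [hud, hBd]
    linarith
  have hbound : ∀ δ > 0, ∀ᶠ n in atTop,
      ∫ t in Icc 0 T, u n t * b t ≤ R - Real.log (K / A) + δ := by
    intro δ hδ
    have hlog := (Real.continuousAt_log hKA.ne').tendsto.comp hlim
    filter_upwards [hlim.eventually (lt_mem_nhds hKA),
      hlog.eventually (lt_mem_nhds (sub_lt_self _ hδ))] with n hn1 hn2
    obtain ⟨C, hC⟩ := huC n
    have h1 := (le_Hhat_withDensity hT hb.neg (hum n) (fun t _ => hC t) hn1).trans hR
    rw [EReal.coe_le_coe_iff] at h1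
    simp only [Pi.neg_apply, mul_neg, integral_neg] at h1
    simp only [Function.comp_apply] at hn2
    linarith
  have hΛm : AEMeasurable (fun t => b t * Real.log (κ * b t)) (volume.restrict (Icc 0 T)) :=
    hb.aemeasurable.mul (hb.aemeasurable.const_mul κ).log
  have hΛlow : ∀ᵐ t ∂volume.restrict (Icc 0 T), 0 ≤ b t * Real.log (κ * b t) + 1 / κ := by
    filter_upwards [hb0] with t ht
    linarith [mul_log_ge hκ ht]
  -- Adding `1 / κ` makes the integrands nonnegative, whence the term `T * (1 / κ)` on the right.
  have hFatou : ∀ δ > 0, ∫⁻ t in Icc 0 T, ENNReal.ofReal (b t * Real.log (κ * b t) + 1 / κ)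
      ≤ ENNReal.ofReal (R - Real.log (K / A) + δ + T * (1 / κ)) := by
    intro δ hδ
    calc _ = ∫⁻ t in Icc 0 T, liminf (fun n => ENNReal.ofReal (u n t * b t + 1 / κ)) atTop := by
          refine lintegral_congr_ae ?_
          filter_upwards [hb0] with t ht
          refine (Tendsto.liminf_eq ?_).symm
          refine tendsto_const_nhds.congr' ?_
          rcases ht.eq_or_lt with h | h
          · exact Eventually.of_forall fun n => by simp [← h]
          · filter_upwards [hNlim.eventually (truncation_eventuallyEq h)] with n hn
            simp only [hud, hBd]
            rw [hn, mul_comm]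
      _ ≤ liminf (fun n => ∫⁻ t in Icc 0 T, ENNReal.ofReal (u n t * b t + 1 / κ)) atTop :=
          lintegral_liminf_le' fun n =>
            (((hum n).mul hb.aemeasurable).add_const _).ennreal_ofReal
      _ ≤ _ := by
          refine liminf_le_of_frequently_le' (Eventually.frequently ?_)
          filter_upwards [hbound δ hδ] with n hn
          have hi : Integrable (fun t => u n t * b t + 1 / κ) (volume.restrict (Icc 0 T)) :=
            (hub n).add (integrable_const _)
          rw [← ofReal_integral_eq_lintegral_ofReal hi (hlow n),
            integral_add (hub n) (integrable_const _), integral_const,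
            measureReal_restrict_apply_univ, Real.volume_real_Icc, sub_zero, max_eq_left hT.le,
            smul_eq_mul]
          exact ENNReal.ofReal_le_ofReal (by linarith)
  have hnonneg : ∀ δ > 0, 0 ≤ R - Real.log (K / A) + δ + T * (1 / κ) := by
    intro δ hδ
    obtain ⟨n, hn⟩ := (hbound δ hδ).exists
    have h1 := integral_nonneg_of_ae (hlow n)
    rw [integral_add (hub n) (integrable_const _), integral_const,
            measureReal_restrict_apply_univ, Real.volume_real_Icc, sub_zero, max_eq_left hT.le,
            smul_eq_mul] at h1
    linarith
  have hΛi : IntegrableOn (fun t => b t * Real.log (κ * b t) + 1 / κ) (Icc 0 T) := by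
    refine ⟨(hΛm.add_const _).aestronglyMeasurable, ?_⟩
    rw [hasFiniteIntegral_iff_ofReal hΛlow]
    exact (hFatou 1 zero_lt_one).trans_lt ENNReal.ofReal_lt_top
  have hΛ : IntegrableOn (fun t => b t * Real.log (κ * b t)) (Icc 0 T) := by
    have h1 : IntegrableOn (fun t => b t * Real.log (κ * b t) + 1 / κ - 1 / κ) (Icc 0 T) :=
      Integrable.sub hΛi (integrable_const (1 / κ))
    simpa using h1
  refine ⟨hΛ, le_of_forall_pos_le_add fun δ hδ => ?_⟩
  have h1 := hFatou δ hδ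
  rw [← ofReal_integral_eq_lintegral_ofReal hΛi hΛlow, ENNReal.ofReal_le_ofReal_iff (hnonneg δ hδ),
    integral_add hΛ (integrable_const _), integral_const,
            measureReal_restrict_apply_univ, Real.volume_real_Icc, sub_zero, max_eq_left hT.le,
            smul_eq_mul] at h1
  linarith

theorem Hhat_eq_of_hasNonposDensity {K T : ℝ} (hK : 0 < K) (hT : 0 < T) {θ : SignedMeasure ℝ}
    {g : ℝ → ℝ} (hg : HasNonposDensity T θ g) :
    Hhat K T θ = ((Real.log (K / (1 - ∫ t in (0 : ℝ)..T, g t)) : ℝ) : EReal) -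
      extIntegral (volume.restrict (Icc 0 T)) (fun t =>
        ((g t * Real.log (-(K * T * g t) / (1 - ∫ s in (0 : ℝ)..T, g s)) : ℝ) : EReal)) := by
  obtain ⟨hgi, hg0, rfl⟩ := hg
  set b : ℝ → ℝ := fun t => -g t with hbd
  have hb : IntegrableOn b (Icc 0 T) := hgi.neg
  have hb0 : ∀ᵐ t ∂volume.restrict (Icc 0 T), 0 ≤ b t :=
    hg0.mono fun t ht => neg_nonneg.2 ht
  have hgb : g = fun t => -b t := by ext t; simp [hbd]
  set A : ℝ := 1 - ∫ t in (0 : ℝ)..T, g t with hAd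
  have hA : A = 1 + ∫ t in Icc 0 T, b t := by
    rw [hAd, intervalIntegral.integral_of_le hT.le, ← integral_Icc_eq_integral_Ioc, hbd,
      integral_neg]
    ring
  have hE : (fun t => ((g t * Real.log (-(K * T * g t) / A) : ℝ) : EReal))
      = fun t => ((-(b t * Real.log (K * T / A * b t)) : ℝ) : EReal) := by
    ext t
    congr 1
    have : -(K * T * g t) / A = K * T / A * b t := by simp only [hbd]; ring
    rw [this, hbd]; ring
  rw [hE]
  have hfin : ∀ R : ℝ, Hhat K T ((volume.restrict (Icc 0 T)).withDensityᵥ g) ≤ (R : EReal) →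
      IntegrableOn (fun t => b t * Real.log (K * T / A * b t)) (Icc 0 T) ∧
      Real.log (K / A) + ∫ t in Icc 0 T, b t * Real.log (K * T / A * b t) ≤ R := by
    intro R hR
    rw [hgb] at hR
    exact entropy_le_of_Hhat_le hK hT hb hb0 hA hR
  have hA0 : 0 < A := by
    have : 0 ≤ ∫ t in Icc 0 T, b t := integral_nonneg_of_ae hb0
    linarith
  have hκ : 0 < K * T / A := by positivity
  by_cases hΛ : IntegrableOn (fun t => b t * Real.log (K * T / A * b t)) (Icc 0 T)
  · have hΛn : IntegrableOn (fun t => -(b t * Real.log (K * T / A * b t))) (Icc 0 T) := hΛ.neg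
    rw [extIntegral_coe hΛn, integral_neg, ← EReal.coe_sub, sub_neg_eq_add]
    refine le_antisymm (iSup₂_le fun x hx => ?_) ?_
    · rcases lt_or_ge 0 (K - 1 / T * ∫ t in (0 : ℝ)..T, Real.exp (x t)) with h | h
      · rw [H_of_pos h, pairing_withDensity hT hx hgi, ← EReal.coe_sub, EReal.coe_le_coe_iff]
        have h1 := log_payoff_add_le hK hT hx hb hb0 h hA hΛ
        have h2 : ∫ t in Icc 0 T, x t * g t = - ∫ t in Icc 0 T, x t * b t := by
          rw [← integral_neg]
          simp [hbd]
        rw [h2]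
        linarith
      · rw [H_of_nonpos h]
        simp
    -- Every real number above the conjugate also bounds the right-hand side, by `hfin`.
    · refine EReal.le_of_forall_lt_iff_le.1 fun r hr => ?_
      exact EReal.coe_le_coe_iff.2 (hfin r hr.le).2
  -- The integrand is at most `1 / κ`, so non-integrability means that its integral is `-∞`. A
  -- finite bound on the conjugate would force integrability, hence the conjugate is `+∞` too.
  · have hbot : extIntegral (volume.restrict (Icc 0 T))
        (fun t => ((-(b t * Real.log (K * T / A * b t)) : ℝ) : EReal)) = ⊥ := by
      refine extIntegral_coe_eq_bot ?_ ?_ fun h => hΛ ?_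
      · exact (hb.aemeasurable.mul (hb.aemeasurable.const_mul _).log).neg
      · refine ne_top_of_le_ne_top (b := ∫⁻ t in Icc 0 T, ENNReal.ofReal (1 / (K * T / A))) ?_ ?_
        · simp [ENNReal.mul_eq_top]
        · refine lintegral_mono_ae ?_
          filter_upwards [hb0] with t ht
          exact ENNReal.ofReal_le_ofReal (by linarith [mul_log_ge hκ ht])
      · simpa [IntegrableOn] using h.neg
    rw [hbot, EReal.coe_sub_bot, EReal.eq_top_iff_forall_lt]
    intro r
    by_contra hcon
    exact hΛ (hfin r (not_lt.1 hcon)).1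

/-! ### The log-Laplace exponent -/

noncomputable section

/-- The integrand of the log-Laplace exponent. -/
def levyKernel (l x : ℝ) : ℝ := Real.exp (l * x) - 1 - l * x * indicator {y : ℝ | |y| ≤ 1} 1 x

/-- The log-Laplace exponent as a real function, meaningful on its effective domain. -/
def Gr (γ : ℝ) (ν : Measure ℝ) (l : ℝ) : ℝ := (G γ ν l).toReal

lemma levyKernel_of_le {l x : ℝ} (hx : |x| ≤ 1) :
    levyKernel l x = Real.exp (l * x) - 1 - l * x := by
  simp [levyKernel, hx]

lemma levyKernel_of_lt {l x : ℝ} (hx : 1 < |x|) : levyKernel l x = Real.exp (l * x) - 1 := by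
  simp [levyKernel, hx.not_ge]

lemma measurableSet_abs_le_one : MeasurableSet {y : ℝ | |y| ≤ 1} :=
  measurableSet_le measurable_norm measurable_const

lemma measurable_levyKernel (l : ℝ) : Measurable (levyKernel l) := by
  have : Measurable (indicator {y : ℝ | |y| ≤ 1} (1 : ℝ → ℝ)) :=
    measurable_one.indicator measurableSet_abs_le_one
  unfold levyKernel
  fun_prop

/-- The negative part is at most `1` and is carried by the large jumps, on which a Lévy measure is
finite. Hence `G` never takes the value `-∞`. -/
lemma levyKernel_ge (l x : ℝ) : - indicator {y : ℝ | 1 < |y|} 1 x ≤ levyKernel l x := by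
  rcases le_or_gt |x| 1 with h | h
  · rw [levyKernel_of_le h, indicator_of_notMem (by simpa using h)]
    linarith [Real.add_one_le_exp (l * x)]
  · rw [levyKernel_of_lt h, indicator_of_mem (by simpa using h), Pi.one_apply]
    linarith [Real.exp_pos (l * x)]

lemma abs_exp_sub_one_le (u : ℝ) : |Real.exp u - 1| ≤ |u| * Real.exp |u| := by
  have h1 := Real.add_one_le_exp u
  have h2 := Real.add_one_le_exp (-u)
  have h3 : Real.exp u * Real.exp (-u) = 1 := by rw [← Real.exp_add]; simp
  have h4 := Real.exp_pos u
  rcases le_total 0 u with h | h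
  · rw [abs_of_nonneg h, abs_of_nonneg (by linarith)]
    nlinarith
  · rw [abs_of_nonpos h, abs_of_nonpos (by linarith [Real.exp_le_one_iff.2 h])]
    have : 1 ≤ Real.exp (-u) := Real.one_le_exp (by linarith)
    nlinarith

lemma abs_levyKernel_le {l x : ℝ} (hl : |l| ≤ 1) (hx : |x| ≤ 1) : |levyKernel l x| ≤ x ^ 2 := by
  rw [levyKernel_of_le hx]
  have h1 : |l * x| ≤ |x| := by
    rw [abs_mul]; exact mul_le_of_le_one_left (abs_nonneg x) hl
  refine (Real.abs_exp_sub_one_sub_id_le (h1.trans hx)).trans ?_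
  exact sq_le_sq.2 h1

variable {γ : ℝ} {ν : Measure ℝ}

lemma IsLevyMeasure.measure_gt_one (hν : IsLevyMeasure ν) : ν {y : ℝ | 1 < |y|} ≠ ⊤ := by
  refine ne_top_of_le_ne_top hν.2.ne ?_
  have hS : MeasurableSet {y : ℝ | 1 < |y|} := measurableSet_lt measurable_const measurable_norm
  rw [← lintegral_indicator_one hS]
  refine lintegral_mono fun x => ?_
  by_cases h : 1 < |x|
  · rw [indicator_of_mem (by simpa using h), min_eq_right]
    · simp
    · rw [← sq_abs]; nlinarith
  · rw [indicator_of_notMem (by simpa using h)]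
    exact zero_le

lemma IsLevyMeasure.integrable_indicator (hν : IsLevyMeasure ν) :
    Integrable (indicator {y : ℝ | 1 < |y|} (1 : ℝ → ℝ)) ν :=
  (integrable_indicator_iff (measurableSet_lt measurable_const measurable_norm)).2
    (integrableOn_const hν.measure_gt_one)

lemma IsLevyMeasure.integrable_sq (hν : IsLevyMeasure ν) :
    Integrable (indicator {y : ℝ | |y| ≤ 1} (fun x : ℝ => x ^ 2)) ν := by
  have h : Integrable (fun x : ℝ => min (x ^ 2) 1) ν := by
    refine ⟨by fun_prop, ?_⟩
    rw [hasFiniteIntegral_iff_ofReal (Eventually.of_forall fun x => by positivity)]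
    exact hν.2
  refine h.mono' (Measurable.aestronglyMeasurable
    ((by fun_prop : Measurable fun x : ℝ => x ^ 2).indicator measurableSet_abs_le_one))
    (Eventually.of_forall fun x => ?_)
  by_cases hx : |x| ≤ 1
  · rw [indicator_of_mem (by simpa using hx), Real.norm_eq_abs, abs_of_nonneg (sq_nonneg x)]
    exact le_min le_rfl (by rw [← sq_abs]; nlinarith [abs_nonneg x])
  · rw [indicator_of_notMem (by simpa using hx)]
    simp; positivity

lemma IsLevyMeasure.lintegral_neg_levyKernel (hν : IsLevyMeasure ν) (l : ℝ) :
    ∫⁻ x, ENNReal.ofReal (-levyKernel l x) ∂ν ≠ ⊤ := by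
  refine ne_top_of_le_ne_top hν.integrable_indicator.lintegral_lt_top.ne
    (lintegral_mono fun x => ENNReal.ofReal_le_ofReal ?_)
  linarith [levyKernel_ge l x]

lemma G_eq (γ : ℝ) (ν : Measure ℝ) (l : ℝ) :
    G γ ν l = ((l * γ : ℝ) : EReal) + extIntegral ν fun x => (levyKernel l x : EReal) := rfl

lemma G_of_integrable {l : ℝ} (h : Integrable (levyKernel l) ν) :
    G γ ν l = ((l * γ + ∫ x, levyKernel l x ∂ν : ℝ) : EReal) := by
  rw [G_eq, extIntegral_coe h, EReal.coe_add]

lemma bot_lt_G (hν : IsLevyMeasure ν) (l : ℝ) : ⊥ < G γ ν l := by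
  rw [G_eq]
  refine EReal.bot_lt_add_iff.2 ⟨EReal.bot_lt_coe _, bot_lt_extIntegral ?_⟩
  simp only [← EReal.coe_neg, toENNReal_coe_real]
  exact hν.lintegral_neg_levyKernel l

lemma mem_effDom_iff (hν : IsLevyMeasure ν) {l : ℝ} :
    l ∈ effDom γ ν ↔ Integrable (levyKernel l) ν := by
  constructor
  · intro h
    have h1 : extIntegral ν (fun x => (levyKernel l x : EReal)) < ⊤ := by
      refine lt_top_iff_ne_top.2 fun htop => ?_
      rw [effDom, mem_ofPred_eq, G_eq, htop, EReal.coe_add_top] at h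
      exact lt_irrefl _ h
    have := (extIntegral_eq_of_lt_top (measurable_levyKernel l).coe_real_ereal.aemeasurable (by
      simp only [← EReal.coe_neg, toENNReal_coe_real]
      exact hν.lintegral_neg_levyKernel l) h1).2.1
    simpa using this
  · intro h
    rw [effDom, mem_ofPred_eq, G_of_integrable h]
    exact EReal.coe_lt_top _

lemma coe_Gr (hν : IsLevyMeasure ν) {l : ℝ} (hl : l ∈ effDom γ ν) :
    ((Gr γ ν l : ℝ) : EReal) = G γ ν l :=
  EReal.coe_toReal (ne_of_lt hl) (bot_lt_G hν l).ne'

lemma Gr_eq (hν : IsLevyMeasure ν) {l : ℝ} (hl : l ∈ effDom γ ν) :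
    Gr γ ν l = l * γ + ∫ x, levyKernel l x ∂ν := by
  rw [Gr, G_of_integrable ((mem_effDom_iff hν).1 hl), EReal.toReal_coe]

lemma levyKernel_zero : levyKernel 0 = 0 := by
  ext x; simp [levyKernel]

lemma zero_mem_effDom (hν : IsLevyMeasure ν) : 0 ∈ effDom γ ν := by
  rw [mem_effDom_iff hν, levyKernel_zero]
  exact integrable_zero _ _ _

lemma Gr_zero (hν : IsLevyMeasure ν) : Gr γ ν 0 = 0 := by
  rw [Gr_eq hν (zero_mem_effDom hν), levyKernel_zero]
  simp

lemma zero_mem_interior_effDom (hν : IsLevyMeasure ν) (h1 : AssumptionA1 ν) :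
    0 ∈ interior (effDom γ ν) := by
  obtain ⟨l₀, hl₀, hfin⟩ := h1
  rw [mem_interior_iff_mem_nhds, Metric.mem_nhds_iff]
  refine ⟨min l₀ 1, by positivity, fun l hl => ?_⟩
  rw [mem_ball_zero_iff, Real.norm_eq_abs] at hl
  have hl1 : |l| ≤ l₀ := (hl.le).trans (min_le_left _ _)
  have hl2 : |l| ≤ 1 := (hl.le).trans (min_le_right _ _)
  rw [mem_effDom_iff hν]
  have hS : MeasurableSet {x : ℝ | 1 < |x|} := measurableSet_lt measurable_const measurable_norm
  have hexp : Integrable (indicator {x : ℝ | 1 < |x|} fun x => Real.exp (l₀ * |x|)) ν := by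
    rw [integrable_indicator_iff hS]
    refine ⟨by fun_prop, ?_⟩
    rw [hasFiniteIntegral_iff_ofReal (Eventually.of_forall fun x => (Real.exp_pos _).le)]
    exact hfin
  refine ((hν.integrable_sq.add hexp).add hν.integrable_indicator).mono'
    (measurable_levyKernel l).aestronglyMeasurable (Eventually.of_forall fun x => ?_)
  simp only [Pi.add_apply, Real.norm_eq_abs]
  rcases le_or_gt |x| 1 with h | h
  · rw [indicator_of_mem (by simpa using h), indicator_of_notMem (by simpa using h),
      indicator_of_notMem (by simpa using h), add_zero, add_zero]
    exact abs_levyKernel_le hl2 h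
  · rw [indicator_of_notMem (by simpa using h), indicator_of_mem (by simpa using h),
      indicator_of_mem (by simpa using h), zero_add, levyKernel_of_lt h, Pi.one_apply]
    have h2 : Real.exp (l * x) ≤ Real.exp (l₀ * |x|) := by
      refine Real.exp_le_exp.2 ((le_abs_self _).trans ?_)
      rw [abs_mul]
      exact mul_le_mul_of_nonneg_right hl1 (abs_nonneg x)
    rw [abs_le]
    constructor <;> linarith [Real.exp_pos (l * x)]

lemma levyKernel_convex {a b : ℝ} (ha : 0 ≤ a) (hb : 0 ≤ b) (hab : a + b = 1) (l m x : ℝ) :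
    levyKernel (a * l + b * m) x ≤ a * levyKernel l x + b * levyKernel m x := by
  have h := convexOn_exp.2 (mem_univ (l * x)) (mem_univ (m * x)) ha hb hab
  simp only [smul_eq_mul] at h
  have e : (a * l + b * m) * x = a * (l * x) + b * (m * x) := by ring
  unfold levyKernel
  rw [e]
  have : b = 1 - a := by linarith
  subst this
  nlinarith

lemma convexOn_Gr (hν : IsLevyMeasure ν) : ConvexOn ℝ (effDom γ ν) (Gr γ ν) := by
  have hconv : Convex ℝ (effDom γ ν) := by
    intro l hl m hm a b ha hb hab
    rw [mem_effDom_iff hν] at hl hm ⊢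
    simp only [smul_eq_mul]
    have hi := (hl.const_mul a).add (hm.const_mul b)
    refine integrable_of_lintegral_ofReal_ne_top (measurable_levyKernel _).aemeasurable
      (ne_top_of_le_ne_top hi.lintegral_lt_top.ne (lintegral_mono fun x =>
        ENNReal.ofReal_le_ofReal (levyKernel_convex ha hb hab l m x)))
      (hν.lintegral_neg_levyKernel _)
  refine ⟨hconv, fun l hl m hm a b ha hb hab => ?_⟩
  have hlm := hconv hl hm ha hb hab
  rw [Gr_eq hν hlm, Gr_eq hν hl, Gr_eq hν hm]
  simp only [smul_eq_mul] at hlm ⊢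
  rw [mem_effDom_iff hν] at hl hm hlm
  have h1 : ∫ x, levyKernel (a * l + b * m) x ∂ν
      ≤ ∫ x, (a * levyKernel l x + b * levyKernel m x) ∂ν :=
    integral_mono hlm ((hl.const_mul a).add (hm.const_mul b)) (levyKernel_convex ha hb hab l m)
  rw [integral_add (hl.const_mul a) (hm.const_mul b), integral_const_mul, integral_const_mul] at h1
  linarith

/-- For `ν = 0` the exponent is linear and finite everywhere. Boundedness of the domain is thus what
makes `G` strictly convex. -/
lemma measure_ne_zero_of_isBounded (h2 : Bornology.IsBounded (effDom γ ν)) : ν ≠ 0 := by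
  rintro rfl
  refine NormedSpace.unbounded_univ ℝ ℝ (h2.subset fun l _ => ?_)
  rw [effDom, mem_ofPred_eq, G_of_integrable (integrable_zero_measure)]
  exact EReal.coe_lt_top _

lemma strictConvexOn_Gr (hν : IsLevyMeasure ν) (h2 : Bornology.IsBounded (effDom γ ν)) :
    StrictConvexOn ℝ (effDom γ ν) (Gr γ ν) := by
  refine ⟨(convexOn_Gr hν).1, fun l hl m hm hne a b ha hb hab => ?_⟩
  have hlm := (convexOn_Gr hν).1 hl hm ha.le hb.le hab
  rw [Gr_eq hν hlm, Gr_eq hν hl, Gr_eq hν hm]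
  simp only [smul_eq_mul] at hlm ⊢
  rw [mem_effDom_iff hν] at hl hm hlm
  have hi := (hl.const_mul a).add (hm.const_mul b)
  have h1 : ∫ x, levyKernel (a * l + b * m) x ∂ν
      < ∫ x, (a * levyKernel l x + b * levyKernel m x) ∂ν := by
    -- Equality of the integrals would give equality of the integrands `ν`-almost everywhere, but
    -- `exp` makes the inequality strict at each `x ≠ 0`. Then `ν` would vanish off `0`, and it has
    -- no mass at `0`.
    refine lt_of_le_of_ne (integral_mono hlm hi (levyKernel_convex ha.le hb.le hab l m)) fun heq =>
        ?_
    have h0 := (integral_eq_iff_of_ae_le hlm hi (Eventually.of_forall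
      (levyKernel_convex ha.le hb.le hab l m))).1 heq
    refine measure_ne_zero_of_isBounded h2 (Measure.measure_univ_eq_zero.1 ?_)
    rw [← union_compl_self {(0 : ℝ)}, measure_union_null_iff]
    refine ⟨hν.1, measure_mono_null (fun x hx => ?_) (ae_iff.1 h0)⟩
    have hx0 : x ≠ 0 := hx
    have hne' : l * x ≠ m * x := fun h => hne (mul_right_cancel₀ hx0 h)
    have h := strictConvexOn_exp.2 (mem_univ (l * x)) (mem_univ (m * x)) hne' ha hb hab
    simp only [smul_eq_mul] at h
    have e : (a * l + b * m) * x = a * (l * x) + b * (m * x) := by ring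
    refine ne_of_lt ?_
    simp only [Pi.add_apply]
    unfold levyKernel
    rw [e]
    have : b = 1 - a := by linarith
    subst this
    nlinarith
  rw [integral_add (hl.const_mul a) (hm.const_mul b), integral_const_mul, integral_const_mul] at h1
  linarith

/-- Differentiation under the integral. Small jumps are dominated by a multiple of `x ^ 2`. For
large ones `|x| ≤ e^{ε|x|} / ε`, and the extra exponential is absorbed by the kernels at `l ± 2 ε`,
both inside the domain. -/
lemma differentiableAt_Gr (hν : IsLevyMeasure ν) {l : ℝ} (hl : l ∈ interior (effDom γ ν)) :
    DifferentiableAt ℝ (Gr γ ν) l := by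
  obtain ⟨r, hr, hball⟩ := Metric.mem_nhds_iff.1 (mem_interior_iff_mem_nhds.1 hl)
  set ε : ℝ := r / 4 with hε
  have hε0 : 0 < ε := by positivity
  have hmem : ∀ m, |m - l| < r → m ∈ effDom γ ν := fun m hm => hball (by
    rwa [Metric.mem_ball, Real.dist_eq])
  have hp := (mem_effDom_iff hν).1 (hmem (l + 2 * ε) (by
    rw [add_sub_cancel_left, abs_of_pos (by positivity)]; linarith))
  have hm := (mem_effDom_iff hν).1 (hmem (l - 2 * ε) (by
    rw [sub_sub_cancel_left, abs_neg, abs_of_pos (by positivity)]; linarith))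
  set S : Set ℝ := {x : ℝ | 1 < |x|} with hSd
  have hS : MeasurableSet S := measurableSet_lt measurable_const measurable_norm
  set R : ℝ := |l| + ε with hR
  -- The last indicator, with factor `2`, restores the `-1` present in each of the two kernels on
  -- large jumps.
  let bound : ℝ → ℝ := fun x => R * Real.exp R * indicator {y : ℝ | |y| ≤ 1} (fun x => x ^ 2) x
    + (1 / ε) * (S.indicator (levyKernel (l + 2 * ε)) x + S.indicator (levyKernel (l - 2 * ε)) x
      + 2 * S.indicator 1 x)
  have hbound : Integrable bound ν :=
    (hν.integrable_sq.const_mul _).add ((((hp.indicator hS).add (hm.indicator hS)).add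
      (hν.integrable_indicator.const_mul 2)).const_mul _)
  have hder := hasDerivAt_integral_of_dominated_loc_of_deriv_le (μ := ν) (F := levyKernel)
    (F' := fun m x => Real.exp (m * x) * x - x * indicator {y : ℝ | |y| ≤ 1} 1 x)
    (x₀ := l) (s := Metric.ball l ε) (bound := bound) (Metric.ball_mem_nhds l hε0)
    (Eventually.of_forall fun m => (measurable_levyKernel m).aestronglyMeasurable)
    ((mem_effDom_iff hν).1 (interior_subset hl)) ?_ (Eventually.of_forall fun x m hmb => ?_) hbound
    (Eventually.of_forall fun x m _ => ?_)
  · have h1 : HasDerivAt (fun m => m * γ + ∫ x, levyKernel m x ∂ν) _ l :=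
      ((hasDerivAt_id l).mul_const γ).add hder.2
    refine (h1.congr_of_eventuallyEq ?_).differentiableAt
    filter_upwards [mem_interior_iff_mem_nhds.1 hl] with m hm using Gr_eq hν hm
  · have : Measurable (indicator {y : ℝ | |y| ≤ 1} (1 : ℝ → ℝ)) :=
      measurable_one.indicator measurableSet_abs_le_one
    exact Measurable.aestronglyMeasurable (by fun_prop)
  · rw [Metric.mem_ball, Real.dist_eq] at hmb
    have hmb' := abs_lt.1 hmb
    simp only [bound, Real.norm_eq_abs]
    rcases le_or_gt |x| 1 with h | h
    · have hxS : x ∉ S := by simpa [hSd] using h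
      rw [indicator_of_mem (by simpa using h), indicator_of_mem (by simpa using h),
        indicator_of_notMem hxS, indicator_of_notMem hxS, indicator_of_notMem hxS, Pi.one_apply]
      have e : Real.exp (m * x) * x - x * 1 = (Real.exp (m * x) - 1) * x := by ring
      have hmR : |m| ≤ R := by
        have := abs_sub_abs_le_abs_sub m l
        linarith
      have hmx : |m * x| ≤ R * |x| := by rw [abs_mul]; gcongr
      have hmx1 : |m * x| ≤ R := hmx.trans (mul_le_of_le_one_right (by positivity) h)
      rw [e, abs_mul]
      calc _ ≤ (|m * x| * Real.exp |m * x|) * |x| := by gcongr; exact abs_exp_sub_one_le _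
        _ ≤ (R * |x| * Real.exp R) * |x| := by gcongr
        _ = R * Real.exp R * |x| ^ 2 := by ring
        _ = _ := by rw [sq_abs]; ring
    · have hxS : x ∈ S := h
      rw [indicator_of_notMem (by simpa using h), indicator_of_notMem (by simpa using h),
        indicator_of_mem hxS, indicator_of_mem hxS, indicator_of_mem hxS, Pi.one_apply,
        levyKernel_of_lt h, levyKernel_of_lt h]
      have h1 : |x| ≤ 1 / ε * Real.exp (ε * |x|) := by
        have := Real.add_one_le_exp (ε * |x|)
        rw [div_mul_eq_mul_div, one_mul, le_div_iff₀ hε0]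
        linarith
      have h2 : Real.exp (m * x) * Real.exp (ε * |x|)
          ≤ Real.exp ((l + 2 * ε) * x) + Real.exp ((l - 2 * ε) * x) := by
        rw [← Real.exp_add]
        rcases le_total 0 x with h0 | h0
        · rw [abs_of_nonneg h0]
          have : Real.exp (m * x + ε * x) ≤ Real.exp ((l + 2 * ε) * x) :=
            Real.exp_le_exp.2 (by nlinarith)
          linarith [Real.exp_pos ((l - 2 * ε) * x)]
        · rw [abs_of_nonpos h0]
          have : Real.exp (m * x + ε * -x) ≤ Real.exp ((l - 2 * ε) * x) :=
            Real.exp_le_exp.2 (by nlinarith)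
          linarith [Real.exp_pos ((l + 2 * ε) * x)]
      rw [mul_zero, sub_zero, mul_zero, zero_add, abs_mul, abs_of_pos (Real.exp_pos _)]
      calc _ ≤ Real.exp (m * x) * (1 / ε * Real.exp (ε * |x|)) := by gcongr
        _ = 1 / ε * (Real.exp (m * x) * Real.exp (ε * |x|)) := by ring
        _ ≤ 1 / ε * (Real.exp ((l + 2 * ε) * x) + Real.exp ((l - 2 * ε) * x)) := by gcongr
        _ = _ := by ring
  · have h1 : HasDerivAt (fun m => m * x) x m := by simpa using (hasDerivAt_id m).mul_const x
    have h2 := ((h1.exp).sub_const 1).sub (h1.mul_const (indicator {y : ℝ | |y| ≤ 1} 1 x))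
    exact h2

lemma ConvexOn.add_mul_sub_le {S : Set ℝ} {f : ℝ → ℝ} (hf : ConvexOn ℝ S f) {x y f' : ℝ}
    (hx : x ∈ S) (hy : y ∈ S) (hd : HasDerivAt f f' x) : f x + f' * (y - x) ≤ f y := by
  rcases lt_trichotomy x y with h | rfl | h
  · have := hf.le_slope_of_hasDerivAt hx hy h hd
    rw [slope_def_field, le_div_iff₀ (by linarith)] at this
    linarith
  · simp
  · have := hf.slope_le_of_hasDerivAt hy hx h hd
    rw [slope_def_field, div_le_iff₀ (by linarith)] at this
    linarith

lemma Gr_tangent_le (hν : IsLevyMeasure ν) {h l : ℝ} (hh : h ∈ interior (effDom γ ν))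
    (hl : l ∈ effDom γ ν) : Gr γ ν h + deriv (Gr γ ν) h * (l - h) ≤ Gr γ ν l :=
  ConvexOn.add_mul_sub_le (convexOn_Gr hν) (interior_subset hh) hl
    (differentiableAt_Gr hν hh).hasDerivAt

lemma exists_abs_le_of_mem_effDom (h2 : Bornology.IsBounded (effDom γ ν)) :
    ∃ R, 0 < R ∧ ∀ l ∈ effDom γ ν, |l| ≤ R := by
  obtain ⟨R, hR⟩ := h2.exists_norm_le
  exact ⟨max R 1, by positivity, fun l hl => (hR l hl).trans (le_max_left _ _)⟩

lemma exists_le_Gr (hν : IsLevyMeasure ν) (h1 : AssumptionA1 ν)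
    (h2 : Bornology.IsBounded (effDom γ ν)) : ∃ C, 0 ≤ C ∧ ∀ l ∈ effDom γ ν, -C ≤ Gr γ ν l := by
  obtain ⟨R, hR, hb⟩ := exists_abs_le_of_mem_effDom h2
  refine ⟨|deriv (Gr γ ν) 0| * R, by positivity, fun l hl => ?_⟩
  have h := Gr_tangent_le hν (zero_mem_interior_effDom hν h1) hl
  rw [Gr_zero hν, sub_zero, zero_add] at h
  have h3 : |deriv (Gr γ ν) 0 * l| ≤ |deriv (Gr γ ν) 0| * R := by
    rw [abs_mul]; gcongr; exact hb l hl
  linarith [neg_abs_le (deriv (Gr γ ν) 0 * l)]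

lemma continuousOn_Gr_interior (hν : IsLevyMeasure ν) :
    ContinuousOn (Gr γ ν) (interior (effDom γ ν)) := fun _ hl =>
  (differentiableAt_Gr hν hl).continuousAt.continuousWithinAt

lemma monotoneOn_deriv_Gr (hν : IsLevyMeasure ν) :
    MonotoneOn (deriv (Gr γ ν)) (interior (effDom γ ν)) :=
  ((convexOn_Gr hν).subset interior_subset (convexOn_Gr hν).1.interior).monotoneOn_deriv
    fun _ hl => differentiableAt_Gr hν hl

/-- Lower semicontinuity and convexity give continuity along segments from `0`. -/
lemma continuousWithinAt_Gr_neg (hν : IsLevyMeasure ν)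
    (hlsc : LowerSemicontinuous (G γ ν)) {a : ℝ} (ha : 0 < a) (had : -a ∈ effDom γ ν) :
    ContinuousWithinAt (fun y => Gr γ ν (-y)) (Icc 0 a) a := by
  have hconv := convexOn_Gr (γ := γ) hν
  have hmem : ∀ y ∈ Icc 0 a, -y ∈ effDom γ ν := by
    intro y hy
    have := hconv.1.segment_subset had (zero_mem_effDom hν)
    rw [segment_eq_Icc (by linarith)] at this
    exact this ⟨by linarith [hy.2], by linarith [hy.1]⟩
  have hupper : ∀ y ∈ Icc 0 a, Gr γ ν (-y) ≤ y / a * Gr γ ν (-a) := by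
    intro y hy
    have h0 : 0 ≤ 1 - y / a := by linarith [(div_le_one ha).2 hy.2]
    have h := hconv.2 had (zero_mem_effDom hν) (div_nonneg hy.1 ha.le) h0 (by ring)
    simp only [smul_eq_mul, Gr_zero hν, mul_zero, add_zero] at h
    have e : y / a * -a = -y := by field_simp
    rwa [e] at h
  have hlim : Tendsto (fun y => y / a * Gr γ ν (-a)) (𝓝[Icc 0 a] a) (𝓝 (Gr γ ν (-a))) := by
    have : Tendsto (fun y => y / a * Gr γ ν (-a)) (𝓝[Icc 0 a] a) (𝓝 (a / a * Gr γ ν (-a))) :=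
      (Continuous.tendsto (by fun_prop) a).mono_left nhdsWithin_le_nhds
    rwa [div_self ha.ne', one_mul] at this
  -- The lower estimate is semicontinuity; the upper one is the chord from `0` to `-a`, with `G 0 =
  -- 0`.
  refine tendsto_order.2 ⟨fun c hc => ?_, fun c hc => ?_⟩
  · have h1 : ((c : ℝ) : EReal) < G γ ν (-a) := by
      rw [← coe_Gr hν had]; exact EReal.coe_lt_coe_iff.2 hc
    have h2 := (continuous_neg.tendsto a).eventually (hlsc (-a) _ h1)
    filter_upwards [h2.filter_mono nhdsWithin_le_nhds, self_mem_nhdsWithin] with y hy hya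
    rw [← coe_Gr hν (hmem y hya)] at hy
    exact EReal.coe_lt_coe_iff.1 hy
  · filter_upwards [hlim.eventually (gt_mem_nhds hc), self_mem_nhdsWithin] with y hy hya
    exact (hupper y hya).trans_lt hy

/-- If the left end point of the effective domain does not belong to it, `G` blows up there. -/
lemma exists_Gr_neg_gt (hν : IsLevyMeasure ν)
    (hlsc : LowerSemicontinuous (G γ ν)) {a : ℝ} (ha : 0 < a) (had : -a ∉ effDom γ ν)
    (hmem : ∀ y ∈ Ico 0 a, -y ∈ effDom γ ν) (c : ℝ) : ∃ y ∈ Ioo 0 a, c < Gr γ ν (-y) := by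
  have h1 : ((c : ℝ) : EReal) < G γ ν (-a) := by
    have : G γ ν (-a) = ⊤ := by
      by_contra h
      exact had (lt_top_iff_ne_top.2 h)
    rw [this]; exact EReal.coe_lt_top c
  have h2 := ((continuous_neg.tendsto a).eventually (hlsc (-a) _ h1)).filter_mono
    (nhdsWithin_le_nhds (s := Iio a))
  obtain ⟨y, hy, hya⟩ := (h2.and (Ioo_mem_nhdsLT ha)).exists
  refine ⟨y, hya, ?_⟩
  rw [← coe_Gr hν (hmem y ⟨hya.1.le, hya.2⟩)] at hy
  exact EReal.coe_lt_coe_iff.1 hy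

end

/-! ### A one-dimensional boundary value problem -/

/-- The integral is `log ((C L + ε) / ε) / C`, so the equation can be solved for `ε`. Its divergence
as `ε → 0` is the model for convex functions near a minimum. -/
lemma exists_integral_inv_affine_eq {C L T : ℝ} (hC : 0 < C) (hL : 0 < L) (hT : 0 < T) :
    ∃ ε, 0 < ε ∧ ∫ u in (0 : ℝ)..L, (C * u + ε)⁻¹ = T := by
  have hE : 0 < Real.exp (C * T) - 1 := by
    linarith [Real.add_one_lt_exp (mul_pos hC hT).ne', mul_pos hC hT]
  set ε : ℝ := C * L / (Real.exp (C * T) - 1) with hεd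
  have hε : 0 < ε := by positivity
  refine ⟨ε, hε, ?_⟩
  have hpos : ∀ u ∈ uIcc 0 L, 0 < C * u + ε := by
    intro u hu
    rw [uIcc_of_le hL.le] at hu
    have := mul_nonneg hC.le hu.1
    linarith
  have hd : ∀ u ∈ uIcc 0 L, HasDerivAt (fun u => Real.log (C * u + ε) / C) (C * u + ε)⁻¹ u := by
    intro u hu
    have h1 : HasDerivAt (fun u => C * u + ε) C u := by
      simpa using ((hasDerivAt_id u).const_mul C).add_const ε
    have h2 := (h1.log (hpos u hu).ne').div_const C
    refine h2.congr_deriv ?_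
    rw [div_right_comm, div_self hC.ne', one_div]
  rw [intervalIntegral.integral_eq_sub_of_hasDerivAt hd]
  · rw [mul_zero, zero_add, ← sub_div, ← Real.log_div (hpos L right_mem_uIcc).ne' hε.ne']
    have : (C * L + ε) / ε = Real.exp (C * T) := by
      rw [add_div, div_self hε.ne', hεd]
      field_simp
      ring
    rw [this, Real.log_exp]
    field_simp
  · refine ContinuousOn.intervalIntegrable ?_
    exact ContinuousOn.inv₀ (by fun_prop) fun u hu => (hpos u hu).ne'

section

variable {F : ℝ → ℝ} {T b : ℝ}

/-- Positivity on a compact interval persists, uniformly, on slightly longer ones; this allows `F +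
c` to be truncated below when the upper limit of the integral varies. -/
lemma exists_pos_le_near (hF : Continuous F) {Y c : ℝ} (hY : 0 ≤ Y)
    (hpos : ∀ y ∈ Icc 0 Y, 0 < F y + c) :
    ∃ δ, 0 < δ ∧ ∀ᶠ Z in 𝓝 Y, ∀ y ∈ Icc 0 Z, δ ≤ F y + c := by
  obtain ⟨y₀, hy₀, hmin⟩ := isCompact_Icc.exists_isMinOn (nonempty_Icc.2 hY)
    (hF.add continuous_const : Continuous fun y => F y + c).continuousOn
  have h0 := hpos y₀ hy₀
  refine ⟨(F y₀ + c) / 2, by positivity, ?_⟩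
  have hYpos : (F y₀ + c) / 2 < F Y + c := by
    have : F y₀ + c ≤ F Y + c := hmin (right_mem_Icc.2 hY)
    linarith
  have hev : ∀ᶠ y in 𝓝 Y, (F y₀ + c) / 2 < F y + c :=
    ((hF.add continuous_const : Continuous fun y => F y + c).tendsto Y).eventually
      (lt_mem_nhds hYpos)
  obtain ⟨r, hr, hball⟩ := Metric.eventually_nhds_iff.1 hev
  filter_upwards [gt_mem_nhds (lt_add_of_pos_right Y hr)] with Z hZ y hy
  rcases le_or_gt y Y with h | h
  · have : F y₀ + c ≤ F y + c := hmin ⟨hy.1, h⟩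
    linarith
  · refine (hball ?_).le
    rw [Real.dist_eq, abs_of_pos (by linarith)]
    linarith [hy.2]

lemma continuousAt_integral_inv (hF : Continuous F) {Y c : ℝ} (hY : 0 < Y)
    (hpos : ∀ y ∈ Icc 0 Y, 0 < F y + c) :
    ContinuousAt (fun Z => ∫ y in (0 : ℝ)..Z, (F y + c)⁻¹) Y := by
  obtain ⟨δ, hδ, hev⟩ := exists_pos_le_near hF hY.le hpos
  have hk : Continuous fun y => (max (F y + c) δ)⁻¹ :=
    Continuous.inv₀ (by fun_prop) fun y => (hδ.trans_le (le_max_right _ _)).ne'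
  have h1 : Continuous fun Z => ∫ y in (0 : ℝ)..Z, (max (F y + c) δ)⁻¹ :=
    intervalIntegral.continuous_primitive (fun a b => hk.intervalIntegrable a b) 0
  refine h1.continuousAt.congr ?_
  filter_upwards [hev, lt_mem_nhds hY] with Z hZ hZ0
  refine intervalIntegral.integral_congr fun y hy => ?_
  rw [uIcc_of_le hZ0.le] at hy
  rw [max_eq_left (hZ y hy)]

lemma continuousOn_inv (hF : Continuous F) {Y c : ℝ}
    (hpos : ∀ y ∈ Icc 0 Y, 0 < F y + c) : ContinuousOn (fun y => (F y + c)⁻¹) (Icc 0 Y) :=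
  ContinuousOn.inv₀ (by fun_prop) fun y hy => (hpos y hy).ne'

lemma integral_inv_anti (hF : Continuous F) {Y c d : ℝ} (hY : 0 < Y) (hcd : c ≤ d)
    (hpos : ∀ y ∈ Icc 0 Y, 0 < F y + c) :
    ∫ y in (0 : ℝ)..Y, (F y + d)⁻¹ ≤ ∫ y in (0 : ℝ)..Y, (F y + c)⁻¹ := by
  have hpos' : ∀ y ∈ Icc 0 Y, 0 < F y + d := fun y hy => by linarith [hpos y hy]
  refine intervalIntegral.integral_mono_on hY.le
    ((continuousOn_inv hF hpos').intervalIntegrable_of_Icc hY.le)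
    ((continuousOn_inv hF hpos).intervalIntegrable_of_Icc hY.le) fun y hy => ?_
  exact inv_anti₀ (hpos y hy) (by linarith)

lemma integral_inv_strictAnti (hF : Continuous F) {Y c d : ℝ} (hY : 0 < Y) (hcd : c < d)
    (hpos : ∀ y ∈ Icc 0 Y, 0 < F y + c) :
    ∫ y in (0 : ℝ)..Y, (F y + d)⁻¹ < ∫ y in (0 : ℝ)..Y, (F y + c)⁻¹ := by
  have hpos' : ∀ y ∈ Icc 0 Y, 0 < F y + d := fun y hy => by linarith [hpos y hy]
  refine intervalIntegral.integral_lt_integral_of_continuousOn_of_le_of_exists_lt hY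
    (continuousOn_inv hF hpos') (continuousOn_inv hF hpos)
    (fun y hy => inv_anti₀ (hpos y (Ioc_subset_Icc_self hy)) (by linarith))
    ⟨0, left_mem_Icc.2 hY.le, ?_⟩
  exact inv_strictAnti₀ (hpos 0 (left_mem_Icc.2 hY.le)) (by linarith)

/-- A convex function leaves its minimum at most linearly along a chord, so the travel time diverges
logarithmically as the level decreases to `-F y₀`. The chord goes to `Y` when the minimum is at `0`,
and back to `0` otherwise. -/
lemma exists_integral_inv_ge (hF : Continuous F) {Y : ℝ} (hY : 0 < Y)
    (hconv : ConvexOn ℝ (Icc 0 Y) F) (h0 : F 0 = 0) (hT : 0 < T) {y₀ : ℝ} (hy₀ : y₀ ∈ Icc 0 Y)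
    (hmin : ∀ y ∈ Icc 0 Y, F y₀ ≤ F y) :
    ∃ ε, 0 < ε ∧ T ≤ ∫ y in (0 : ℝ)..Y, (F y + (-F y₀ + ε))⁻¹ := by
  have h0m : F y₀ ≤ 0 := h0 ▸ hmin 0 (left_mem_Icc.2 hY.le)
  have hpos : ∀ ε > 0, ∀ y ∈ Icc 0 Y, 0 < F y + (-F y₀ + ε) := fun ε hε y hy => by
    linarith [hmin y hy]
  have hint : ∀ ε > 0, IntervalIntegrable (fun y => (F y + (-F y₀ + ε))⁻¹) volume 0 Y :=
    fun ε hε => (continuousOn_inv hF (hpos ε hε)).intervalIntegrable_of_Icc hY.le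
  have hcont : ∀ C > 0, ∀ ε > 0, ∀ L, ContinuousOn (fun u : ℝ => (C * u + ε)⁻¹) (Icc 0 L) :=
    fun C hC ε hε L => ContinuousOn.inv₀ (by fun_prop) fun u hu => by
      have := mul_nonneg hC.le hu.1; linarith
  rcases hy₀.1.eq_or_lt with rfl | hy₀0
  · have hC : 0 < F Y / Y + 1 := by
      have : 0 ≤ F Y := h0 ▸ hmin Y (right_mem_Icc.2 hY.le)
      positivity
    obtain ⟨ε, hε, hεT⟩ := exists_integral_inv_affine_eq hC hY hT
    refine ⟨ε, hε, ?_⟩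
    rw [← hεT]
    refine intervalIntegral.integral_mono_on hY.le
      ((hcont _ hC ε hε Y).intervalIntegrable_of_Icc hY.le) (hint ε hε) fun y hy => ?_
    refine inv_anti₀ (hpos ε hε y hy) ?_
    have h1 : 0 ≤ 1 - y / Y := by linarith [(div_le_one hY).2 hy.2]
    have h := hconv.2 (left_mem_Icc.2 hY.le) (right_mem_Icc.2 hY.le) h1
      (div_nonneg hy.1 hY.le) (by ring)
    simp only [smul_eq_mul, h0, mul_zero, zero_add] at h
    rw [div_mul_cancel₀ _ hY.ne'] at h
    have e : y / Y * F Y = F Y / Y * y := by ring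
    rw [h0]
    linarith [hy.1]
  · have hC : 0 < -F y₀ / y₀ + 1 := by
      have : 0 ≤ -F y₀ := by linarith
      positivity
    obtain ⟨ε, hε, hεT⟩ := exists_integral_inv_affine_eq hC hy₀0 hT
    refine ⟨ε, hε, ?_⟩
    rw [← intervalIntegral.integral_comp_sub_left (fun u => ((-F y₀ / y₀ + 1) * u + ε)⁻¹) y₀
      |>.trans (by rw [sub_self, sub_zero, hεT] :
        ∫ u in (y₀ - y₀)..(y₀ - 0), ((-F y₀ / y₀ + 1) * u + ε)⁻¹ = T)]
    have hsub : uIcc 0 y₀ ⊆ uIcc 0 Y := by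
      rw [uIcc_of_le hy₀0.le, uIcc_of_le hY.le]
      exact Icc_subset_Icc_right hy₀.2
    calc _ ≤ ∫ y in (0 : ℝ)..y₀, (F y + (-F y₀ + ε))⁻¹ := by
          refine intervalIntegral.integral_mono_on hy₀0.le ?_ ((hint ε hε).mono_set hsub)
            fun y hy => ?_
          · refine ContinuousOn.intervalIntegrable_of_Icc hy₀0.le
              ((hcont _ hC ε hε y₀).comp (by fun_prop) fun y hy => ?_)
            exact ⟨by linarith [hy.2], by linarith [hy.1]⟩
          · refine inv_anti₀ (hpos ε hε y ⟨hy.1, hy.2.trans hy₀.2⟩) ?_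
            have h1 : 0 ≤ 1 - y / y₀ := by linarith [(div_le_one hy₀0).2 hy.2]
            have h := hconv.2 (left_mem_Icc.2 hY.le) hy₀ h1 (div_nonneg hy.1 hy₀0.le) (by ring)
            simp only [smul_eq_mul, h0, mul_zero, zero_add] at h
            rw [div_mul_cancel₀ _ hy₀0.ne'] at h
            have e : (-F y₀ / y₀ + 1) * (y₀ - y) = -F y₀ + y / y₀ * F y₀ + (y₀ - y) := by
              field_simp; ring
            rw [e]
            linarith [hy.2]
      _ ≤ _ := by
          refine intervalIntegral.integral_mono_interval le_rfl hy₀0.le hy₀.2 ?_ (hint ε hε)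
          filter_upwards [ae_restrict_mem measurableSet_Ioc] with y hy
          exact (inv_pos.2 (hpos ε hε y (Ioc_subset_Icc_self hy))).le

/-- The level is found between `-F y₀ + ε`, where the travel time is at least `T`, and `-F y₀ + Y /
T`, where it is at most `T`. The last conclusion controls the level as `Y → 0`. -/
lemma exists_integral_inv_eq (hF : Continuous F) {Y : ℝ} (hY : 0 < Y)
    (hconv : ConvexOn ℝ (Icc 0 Y) F) (h0 : F 0 = 0) (hT : 0 < T) :
    ∃ c, (∀ y ∈ Icc 0 Y, 0 < F y + c) ∧ ∫ y in (0 : ℝ)..Y, (F y + c)⁻¹ = T ∧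
      ∃ y ∈ Icc 0 Y, F y + c ≤ Y / T := by
  obtain ⟨y₀, hy₀, hmin⟩ := isCompact_Icc.exists_isMinOn (nonempty_Icc.2 hY.le) hF.continuousOn
  have hmin' : ∀ y ∈ Icc 0 Y, F y₀ ≤ F y := fun y hy => hmin hy
  obtain ⟨ε, hε, hge⟩ := exists_integral_inv_ge hF hY hconv h0 hT hy₀ hmin'
  have hYT : 0 < Y / T := by positivity
  set d : ℝ := -F y₀ + Y / T with hd
  have hle : ∫ y in (0 : ℝ)..Y, (F y + d)⁻¹ ≤ T := by
    have hpos : ∀ y ∈ Icc 0 Y, 0 < F y + d := fun y hy => by linarith [hmin' y hy]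
    calc _ ≤ ∫ y in (0 : ℝ)..Y, (Y / T)⁻¹ := by
          refine intervalIntegral.integral_mono_on hY.le
            ((continuousOn_inv hF hpos).intervalIntegrable_of_Icc hY.le) (by simp) fun y hy => ?_
          exact inv_anti₀ hYT (by linarith [hmin' y hy])
      _ = T := by
          rw [intervalIntegral.integral_const, smul_eq_mul]
          field_simp
          ring
  have hposε : ∀ y ∈ Icc 0 Y, 0 < F y + (-F y₀ + ε) := fun y hy => by linarith [hmin' y hy]
  rcases le_or_gt (-F y₀ + ε) d with hcd | hcd
  · have hk : Continuous fun p : ℝ × ℝ => (max (F p.2 + p.1) ε)⁻¹ :=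
      Continuous.inv₀ (by fun_prop) fun y => (hε.trans_le (le_max_right _ _)).ne'
    have hcont : ContinuousOn (fun c => ∫ y in (0 : ℝ)..Y, (F y + c)⁻¹) (Icc (-F y₀ + ε) d) := by
      refine (intervalIntegral.continuous_parametric_intervalIntegral_of_continuous'
        (f := fun c y => (max (F y + c) ε)⁻¹) (μ := volume) hk 0 Y).continuousOn.congr fun c hc =>
            ?_
      refine intervalIntegral.integral_congr fun y hy => ?_
      rw [uIcc_of_le hY.le] at hy
      rw [max_eq_left]
      linarith [hmin' y hy, hc.1]
    obtain ⟨c, hc, hcT⟩ := intermediate_value_Icc' hcd hcont ⟨hle, hge⟩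
    exact ⟨c, fun y hy => by linarith [hposε y hy, hc.1], hcT, y₀, hy₀, by linarith [hc.2]⟩
  -- If the two bounds come in the wrong order, monotonicity makes both travel times equal to `T`.
  · have h1 := integral_inv_anti hF (c := d) hY hcd.le fun y hy => by linarith [hmin' y hy]
    refine ⟨d, fun y hy => by linarith [hmin' y hy], by linarith, y₀, hy₀, by linarith⟩

/-- The level is an implicit function of `Y`: the travel time is strictly decreasing in the level
and continuous in `Y`, so a perturbed level keeps its strict inequality with `T` for nearby end
points. -/
lemma continuousOn_level (hF : Continuous F) {c : ℝ → ℝ}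
    (hpos : ∀ Y ∈ Ioc 0 b, ∀ y ∈ Icc 0 Y, 0 < F y + c Y)
    (hc : ∀ Y ∈ Ioc 0 b, ∫ y in (0 : ℝ)..Y, (F y + c Y)⁻¹ = T) : ContinuousOn c (Ioc 0 b) := by
  intro Y hY
  have hupper : ∀ d > c Y, ∀ᶠ Z in 𝓝[Ioc 0 b] Y, c Z < d := by
    intro d hd
    have hp : ∀ y ∈ Icc 0 Y, 0 < F y + d := fun y hy => by linarith [hpos Y hY y hy]
    obtain ⟨δ, hδ, hev⟩ := exists_pos_le_near hF hY.1.le hp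
    have hlt : ∫ y in (0 : ℝ)..Y, (F y + d)⁻¹ < T :=
      hc Y hY ▸ integral_inv_strictAnti hF hY.1 hd (hpos Y hY)
    have h1 := (continuousAt_integral_inv hF hY.1 hp).eventually (gt_mem_nhds hlt)
    filter_upwards [h1.filter_mono nhdsWithin_le_nhds, hev.filter_mono nhdsWithin_le_nhds,
      self_mem_nhdsWithin] with Z hZ1 hZ2 hZ
    by_contra! hcon
    have := integral_inv_anti hF hZ.1 hcon fun y hy => hδ.trans_le (hZ2 y hy)
    rw [hc Z hZ] at this
    linarith
  have hlower : ∀ d < c Y, ∀ᶠ Z in 𝓝[Ioc 0 b] Y, d < c Z := by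
    intro d hd
    obtain ⟨δ, hδ, hev⟩ := exists_pos_le_near hF hY.1.le (hpos Y hY)
    -- Lowering the level by at most `δ / 2` keeps the integrand positive on `[0, Y]`.
    set e : ℝ := max d (c Y - δ / 2) with hed
    have he : e < c Y := max_lt hd (by linarith)
    have hp : ∀ y ∈ Icc 0 Y, 0 < F y + e := fun y hy => by
      linarith [hev.self_of_nhds y hy, le_max_right d (c Y - δ / 2)]
    have hlt : T < ∫ y in (0 : ℝ)..Y, (F y + e)⁻¹ :=
      hc Y hY ▸ integral_inv_strictAnti hF hY.1 he hp
    have h1 := (continuousAt_integral_inv hF hY.1 hp).eventually (lt_mem_nhds hlt)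
    filter_upwards [h1.filter_mono nhdsWithin_le_nhds, self_mem_nhdsWithin] with Z hZ1 hZ
    by_contra! hcon
    have := integral_inv_anti hF hZ.1 (hcon.trans (le_max_left _ _) : c Z ≤ e) (hpos Z hZ)
    rw [hc Z hZ] at this
    linarith
  exact tendsto_order.2 ⟨hlower, hupper⟩

/-- Shooting in the end point `Y`. The residual `K T (F Y + c) - (1 + Y)` has the sign of the
initial value of the path of the saddle point. It is negative for small `Y`, so it vanishes
somewhere or is still nonpositive at `b`. -/
lemma exists_level_of_continuous {K : ℝ} (hK : 0 < K) (hT : 0 < T) (hb : 0 < b) (hF : Continuous F)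
    (hconv : ConvexOn ℝ (Icc 0 b) F) (h0 : F 0 = 0) :
    ∃ Y ∈ Ioc 0 b, ∃ c, (∀ y ∈ Icc 0 Y, 0 < F y + c) ∧ ∫ y in (0 : ℝ)..Y, (F y + c)⁻¹ = T ∧
      (K * T * (F Y + c) = 1 + Y ∨ (Y = b ∧ K * T * (F b + c) ≤ 1 + b)) := by
  have hex : ∀ Y ∈ Ioc 0 b, ∃ c, (∀ y ∈ Icc 0 Y, 0 < F y + c) ∧
      ∫ y in (0 : ℝ)..Y, (F y + c)⁻¹ = T ∧ ∃ y ∈ Icc 0 Y, F y + c ≤ Y / T := fun Y hY =>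
    exists_integral_inv_eq hF hY.1 (hconv.subset (Icc_subset_Icc_right hY.2) (convex_Icc 0 Y)) h0 hT
  choose! c hpos hint hsmall using hex
  have hbm : b ∈ Ioc 0 b := right_mem_Ioc.2 hb
  rcases le_or_gt (K * T * (F b + c b)) (1 + b) with hR | hR
  · exact ⟨b, hbm, c b, hpos b hbm, hint b hbm, Or.inr ⟨rfl, hR⟩⟩
  · have hKT : 0 < K * T := by positivity
    obtain ⟨r, hr, hball⟩ := Metric.continuousAt_iff.1 (hF.continuousAt (x := 0))
      (1 / (4 * (K * T))) (by positivity)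
    -- On `[0, Z]` one has `|F| < 1 / (4 K T)`, and `Z / T` is at most `1 / (4 K T)`. Hence `K T (F
    -- Z + c Z)` is at most `3 / 4`, below `1 + Z`.
    set Z : ℝ := min (min (r / 2) b) (1 / (4 * K)) with hZd
    have hZ0 : 0 < Z := by positivity
    have hZb : Z ≤ b := (min_le_left _ _).trans (min_le_right _ _)
    have hZr : Z < r := ((min_le_left _ _).trans (min_le_left _ _)).trans_lt (by linarith)
    have hZK : Z ≤ 1 / (4 * K) := min_le_right _ _
    have hZm : Z ∈ Ioc 0 b := ⟨hZ0, hZb⟩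
    obtain ⟨y, hy, hyc⟩ := hsmall Z hZm
    have hsm : ∀ y ∈ Icc 0 Z, |F y| < 1 / (4 * (K * T)) := by
      intro y hy
      have := hball (x := y) (by
        rw [Real.dist_eq, sub_zero, abs_of_nonneg hy.1]; exact hy.2.trans_lt hZr)
      rwa [Real.dist_eq, h0, sub_zero] at this
    have h1 := abs_lt.1 (hsm y hy)
    have h2 := abs_lt.1 (hsm Z (right_mem_Icc.2 hZ0.le))
    have hRZ : K * T * (F Z + c Z) ≤ 1 + Z := by
      have h3 : F Z + c Z ≤ 2 * (1 / (4 * (K * T))) + 1 / (4 * K) / T := by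
        have : Z / T ≤ 1 / (4 * K) / T := by gcongr
        linarith
      calc _ ≤ K * T * (2 * (1 / (4 * (K * T))) + 1 / (4 * K) / T) := by gcongr
        _ = 3 / 4 := by field_simp; norm_num
        _ ≤ _ := by linarith
    have hcont : ContinuousOn (fun Y => K * T * (F Y + c Y) - (1 + Y)) (Icc Z b) := by
      have hc : ContinuousOn c (Icc Z b) := (continuousOn_level hF hpos hint).mono
        fun Y hY => ⟨hZ0.trans_le hY.1, hY.2⟩
      fun_prop
    obtain ⟨Y, hY, hY0⟩ := intermediate_value_Icc hZb hcont
      (show (0 : ℝ) ∈ Icc _ _ from ⟨by linarith, by linarith⟩)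
    have hYm : Y ∈ Ioc 0 b := ⟨hZ0.trans_le hY.1, hY.2⟩
    exact ⟨Y, hYm, c Y, hpos Y hYm, hint Y hYm, Or.inl (by simp only at hY0; linarith)⟩

end

/-- Solution of the autonomous equation `y' = f(y) + c`. -/
lemma exists_autonomous_solution {F : ℝ → ℝ} {Y T c : ℝ} (hF : Continuous F) (hY : 0 < Y)
    (hpos : ∀ y ∈ Icc 0 Y, 0 < F y + c) (hint : ∫ y in (0 : ℝ)..Y, (F y + c)⁻¹ = T) :
    ∃ y : ℝ → ℝ, y 0 = 0 ∧ y T = Y ∧ StrictMono y ∧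
      ∀ t ∈ Icc 0 T, HasDerivAt y (F (y t) + c) t := by
  have hYn : 0 ≤ Y := hY.le
  -- Freezing the speed outside `[0, Y]` keeps it positive and bounded, so the travel time `τ` is a
  -- bijection of `ℝ`; its inverse is the solution.
  set P : ℝ → ℝ := fun y => F (projIcc 0 Y hYn y) + c with hPd
  have hPc : Continuous P := (hF.comp (continuous_subtype_val.comp continuous_projIcc)).add
    continuous_const
  have hPpos : ∀ y, 0 < P y := fun y => hpos _ (projIcc 0 Y hYn y).2
  have hPeq : ∀ y ∈ Icc 0 Y, P y = F y + c := fun y hy => by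
    simp only [hPd, projIcc_of_mem hYn hy]
  have hinvc : Continuous fun y => (P y)⁻¹ := hPc.inv₀ fun y => (hPpos y).ne'
  set τ : ℝ → ℝ := fun y => ∫ u in (0 : ℝ)..y, (P u)⁻¹ with hτ
  have hτd : ∀ y, HasDerivAt τ (P y)⁻¹ y := fun y =>
    intervalIntegral.integral_hasDerivAt_right (hinvc.intervalIntegrable _ _)
      (hinvc.stronglyMeasurableAtFilter _ _) hinvc.continuousAt
  have hτc : Continuous τ := continuous_iff_continuousAt.2 fun y => (hτd y).continuousAt
  have hτm : StrictMono τ := strictMono_of_hasDerivAt_pos hτd fun y => inv_pos.2 (hPpos y)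
  obtain ⟨B, hB⟩ := isCompact_Icc.exists_bound_of_continuousOn
    (hF.add continuous_const : Continuous fun y => F y + c).continuousOn (s := Icc 0 Y)
  have hPB : ∀ y, P y ≤ B := fun y => (le_abs_self _).trans (hB _ (projIcc 0 Y hYn y).2)
  have hB0 : 0 < B := (hPpos 0).trans_le (hPB 0)
  have hsub : Monotone fun y => τ y - B⁻¹ * y := by
    refine monotone_of_hasDerivAt_nonneg (f' := fun y => (P y)⁻¹ - B⁻¹ * 1)
      (fun y => (hτd y).sub ((hasDerivAt_id y).const_mul _)) fun y => ?_
    have := inv_anti₀ (hPpos y) (hPB y)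
    simp only [Pi.zero_apply, mul_one]
    linarith
  have hτ0 : τ 0 = 0 := intervalIntegral.integral_same
  have htop : Tendsto τ atTop atTop := by
    refine tendsto_atTop_mono' _ ?_ (tendsto_id.const_mul_atTop (inv_pos.2 hB0))
    filter_upwards [eventually_ge_atTop 0] with y hy
    have := hsub hy
    simp only [hτ0, mul_zero, sub_zero] at this
    simp only [id]; linarith
  have hbot : Tendsto τ atBot atBot := by
    refine tendsto_atBot_mono' _ ?_ (tendsto_id.const_mul_atBot (inv_pos.2 hB0))
    filter_upwards [eventually_le_atBot 0] with y hy
    have := hsub hy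
    simp only [hτ0, mul_zero, sub_zero] at this
    simp only [id]; linarith
  let e : ℝ ≃o ℝ := hτm.orderIsoOfSurjective τ (hτc.surjective htop hbot)
  have he : ∀ y, e y = τ y := fun y => rfl
  have hτY : τ Y = T := by
    rw [← hint]
    refine intervalIntegral.integral_congr fun y hy => ?_
    rw [uIcc_of_le hYn] at hy
    simp only [hPeq y hy]
  have h0 : e.symm 0 = 0 := by rw [OrderIso.symm_apply_eq, he, hτ0]
  have hT : e.symm T = Y := by rw [OrderIso.symm_apply_eq, he, hτY]
  refine ⟨e.symm, h0, hT, e.symm.strictMono, fun t ht => ?_⟩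
  have h1 := HasDerivAt.of_local_left_inverse (f := τ) (g := e.symm) (a := t)
    e.symm.continuous.continuousAt (hτd (e.symm t)) (inv_ne_zero (hPpos _).ne')
    (Eventually.of_forall fun s => e.apply_symm_apply s)
  rw [inv_inv, hPeq] at h1
  · exact h1
  · rw [← h0, ← hT]
    exact ⟨e.symm.monotone ht.1, e.symm.monotone ht.2⟩

/-! ### The dual functional and the rate function -/

section

variable {γ : ℝ} {ν : Measure ℝ} {T : ℝ}

lemma lintegral_neg_G_ne_top (hν : IsLevyMeasure ν) (h1 : AssumptionA1 ν)
    (h2 : Bornology.IsBounded (effDom γ ν)) (θ : SignedMeasure ℝ) :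
    ∫⁻ t in Icc 0 T, (-G γ ν (θ (Icc t T))).toENNReal ≠ ⊤ := by
  obtain ⟨C, hC, hle⟩ := exists_le_Gr hν h1 h2
  refine ne_top_of_le_ne_top (b := ∫⁻ t in Icc 0 T, ENNReal.ofReal C) ?_
      (lintegral_mono fun t => ?_)
  · simp [ENNReal.mul_eq_top]
  · by_cases hl : θ (Icc t T) ∈ effDom γ ν
    · rw [← coe_Gr hν hl, ← EReal.coe_neg, toENNReal_coe_real]
      exact ENNReal.ofReal_le_ofReal (by linarith [hle _ hl])
    · have : G γ ν (θ (Icc t T)) = ⊤ := by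
        by_contra h
        exact hl (lt_top_iff_ne_top.2 h)
      simp [this]

lemma cumG_of_lt_top (hν : IsLevyMeasure ν) (h1 : AssumptionA1 ν) (h2 : AssumptionA2 γ ν)
    {θ : SignedMeasure ℝ} (h : cumG γ ν T θ < ⊤) :
    (∀ᵐ t ∂volume.restrict (Icc 0 T), θ (Icc t T) ∈ effDom γ ν) ∧
      IntegrableOn (fun t => Gr γ ν (θ (Icc t T))) (Icc 0 T) ∧
      cumG γ ν T θ = ((∫ t in Icc 0 T, Gr γ ν (θ (Icc t T)) : ℝ) : EReal) :=
  extIntegral_eq_of_lt_top (h2.1.measurable.comp (measurable_apply_Icc θ T)).aemeasurable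
    (lintegral_neg_G_ne_top hν h1 h2.2 θ) h

lemma cumG_of_ae_eq (hν : IsLevyMeasure ν) {θ : SignedMeasure ℝ} {h : ℝ → ℝ}
    (heq : ∀ᵐ t ∂volume.restrict (Icc 0 T), θ (Icc t T) = h t ∧ h t ∈ effDom γ ν)
    (hint : IntegrableOn (fun t => Gr γ ν (h t)) (Icc 0 T)) :
    cumG γ ν T θ = ((∫ t in Icc 0 T, Gr γ ν (h t) : ℝ) : EReal) := by
  rw [← extIntegral_coe hint]
  refine extIntegral_congr_ae ?_
  filter_upwards [heq] with t ht
  rw [ht.1, coe_Gr hν ht.2]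

lemma le_rate {x : ℝ → ℝ} {μ : SignedMeasure ℝ} (hμ : μ ∈ M T) :
    (pairing x μ : EReal) - cumG γ ν T μ ≤ rate γ ν T x :=
  le_iSup₂ (f := fun μ (_ : μ ∈ M T) => (pairing x μ : EReal) - cumG γ ν T μ) μ hμ

/-- Integrated Fenchel inequality: for a primitive, the supremum over measures is dominated by the
supremum over `l` taken separately at each time. -/
lemma rate_le_integral (hν : IsLevyMeasure ν) (h1 : AssumptionA1 ν) (h2 : AssumptionA2 γ ν)
    (hT : 0 < T) {v x ℓ : ℝ → ℝ} (hv : IntervalIntegrable v volume 0 T)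
    (hℓ : IntervalIntegrable ℓ volume 0 T) (hxv : ∀ t ∈ Icc 0 T, x t = ∫ s in (0 : ℝ)..t, v s)
    (hx : x ∈ Vr T) (hle : ∀ s ∈ Icc 0 T, ∀ l ∈ effDom γ ν, v s * l - Gr γ ν l ≤ ℓ s) :
    rate γ ν T x ≤ ((∫ s in (0 : ℝ)..T, ℓ s : ℝ) : EReal) := by
  refine iSup₂_le fun μ hμ => ?_
  rcases eq_top_or_lt_top (cumG γ ν T μ) with htop | hlt
  · rw [htop, EReal.sub_top]
    exact bot_le
  · obtain ⟨hmem, hint, heq⟩ := cumG_of_lt_top hν h1 h2 hlt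
    rw [heq, pairing_primitive hT hv hxv hx hμ, ← EReal.coe_sub, EReal.coe_le_coe_iff,
      integral_Icc_eq_integral_Ioc, ← intervalIntegral.integral_of_le hT.le]
    have hint' : IntervalIntegrable (fun t => Gr γ ν (μ (Icc t T))) volume 0 T :=
      (intervalIntegrable_iff_integrableOn_Icc_of_le hT.le).2 hint
    have hvμ := intervalIntegrable_mul_apply hv μ
    rw [← intervalIntegral.integral_sub hvμ hint']
    refine intervalIntegral.integral_mono_ae_restrict hT.le (hvμ.sub hint') hℓ ?_
    filter_upwards [hmem, ae_restrict_mem measurableSet_Icc] with s hs hsT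
    exact hle s hsT _ hs

end

/-! ### Saddle points -/

/-- A path `X`, possibly with a jump at `0`, and a dual variable `h_s = θ([s,T])` which satisfy the
first order conditions of the maximization of `H - J̄`. -/
structure Saddle (γ : ℝ) (ν : Measure ℝ) (K T : ℝ) (X h : ℝ → ℝ) : Prop where
  continuousOn : ContinuousOn X (Icc 0 T)
  final : h T = 0
  nonpos : h 0 ≤ 0
  deriv_h : ∀ s ∈ Icc 0 T,
    HasDerivWithinAt h (Real.exp (X s) * (1 - h 0) / (K * T)) (Icc 0 T) s
  deriv_X : ∀ s ∈ Icc 0 T, h s ∈ interior (effDom γ ν) →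
    HasDerivWithinAt X (deriv (Gr γ ν) (h s)) (Icc 0 T) s
  mem_interior : ∀ s ∈ Ioc 0 T, h s ∈ interior (effDom γ ν)
  mem_zero : h 0 ∈ effDom γ ν
  normal : ∀ l ∈ effDom γ ν, X 0 * (l - h 0) ≤ 0

namespace Saddle

variable {γ : ℝ} {ν : Measure ℝ} {K T : ℝ} {X h : ℝ → ℝ}

/-- The density of the measure `-θ`. -/
noncomputable def density (K T : ℝ) (X h : ℝ → ℝ) (s : ℝ) : ℝ :=
  Real.exp (X s) * (1 - h 0) / (K * T)

/-- The dual measure. -/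
noncomputable def dual (K T : ℝ) (X h : ℝ → ℝ) : SignedMeasure ℝ :=
  (volume.restrict (Icc 0 T)).withDensityᵥ fun s => -density K T X h s

/-- The common value of the primal and the dual problem. -/
noncomputable def value (γ : ℝ) (ν : Measure ℝ) (K T : ℝ) (X h : ℝ → ℝ) : ℝ :=
  Real.log (K / (1 - h 0)) + (∫ s in Icc 0 T, density K T X h s * X s)
    + ∫ s in Icc 0 T, Gr γ ν (h s)

lemma continuousOn_h (S : Saddle γ ν K T X h) : ContinuousOn h (Icc 0 T) :=
  fun s hs => (S.deriv_h s hs).continuousWithinAt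

lemma continuousOn_density (S : Saddle γ ν K T X h) : ContinuousOn (density K T X h) (Icc 0 T) :=
  ((Real.continuous_exp.comp_continuousOn S.continuousOn).mul_const _).div_const _

lemma density_pos (S : Saddle γ ν K T X h) (hK : 0 < K) (hT : 0 < T) (s : ℝ) :
    0 < density K T X h s := by
  have := S.nonpos
  have : 0 < 1 - h 0 := by linarith
  unfold density
  positivity

lemma integrable_density (S : Saddle γ ν K T X h) : IntegrableOn (density K T X h) (Icc 0 T) :=
  S.continuousOn_density.integrableOn_Icc

lemma integrable_neg_density (S : Saddle γ ν K T X h) :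
    IntegrableOn (fun s => -density K T X h s) (Icc 0 T) := S.integrable_density.neg

lemma hasDerivAt_h (S : Saddle γ ν K T X h) {s : ℝ} (hs : s ∈ Ioo 0 T) :
    HasDerivAt h (density K T X h s) s :=
  (S.deriv_h s (Ioo_subset_Icc_self hs)).hasDerivAt (Icc_mem_nhds hs.1 hs.2)

lemma hasDerivAt_X (S : Saddle γ ν K T X h) {s : ℝ} (hs : s ∈ Ioo 0 T) :
    HasDerivAt X (deriv (Gr γ ν) (h s)) s :=
  (S.deriv_X s (Ioo_subset_Icc_self hs) (S.mem_interior s (Ioo_subset_Ioc_self hs))).hasDerivAt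
    (Icc_mem_nhds hs.1 hs.2)

lemma integral_density (S : Saddle γ ν K T X h) {s : ℝ} (hs : s ∈ Icc 0 T) :
    ∫ t in Icc s T, density K T X h t = -h s := by
  rw [integral_Icc_eq_integral_Ioc, ← intervalIntegral.integral_of_le hs.2,
    intervalIntegral.integral_eq_sub_of_hasDerivAt_of_le hs.2
      (S.continuousOn_h.mono (Icc_subset_Icc_left hs.1))
      (fun t ht => S.hasDerivAt_h ⟨hs.1.trans_lt ht.1, ht.2⟩), S.final, zero_sub]
  exact (S.continuousOn_density.mono (Icc_subset_Icc_left hs.1)).intervalIntegrable_of_Icc hs.2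

lemma monotoneOn_h (S : Saddle γ ν K T X h) (hK : 0 < K) (hT : 0 < T) :
    MonotoneOn h (Icc 0 T) := by
  refine monotoneOn_of_deriv_nonneg (convex_Icc 0 T) S.continuousOn_h ?_ ?_
  · intro s hs
    rw [interior_Icc] at hs
    exact (S.hasDerivAt_h hs).differentiableAt.differentiableWithinAt
  · intro s hs
    rw [interior_Icc] at hs
    rw [(S.hasDerivAt_h hs).deriv]
    exact (S.density_pos hK hT s).le

lemma mem_effDom (S : Saddle γ ν K T X h) {s : ℝ} (hs : s ∈ Icc 0 T) : h s ∈ effDom γ ν := by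
  rcases hs.1.eq_or_lt with rfl | h0
  · exact S.mem_zero
  · exact interior_subset (S.mem_interior s ⟨h0, hs.2⟩)

lemma dual_mem : dual K T X h ∈ M T := mem_M_withDensity T _

lemma dual_apply_Icc (S : Saddle γ ν K T X h) {s : ℝ} (hs : s ∈ Icc 0 T) :
    dual K T X h (Icc s T) = h s := by
  rw [dual, withDensityᵥ_apply S.integrable_neg_density measurableSet_Icc,
    Measure.restrict_restrict measurableSet_Icc,
    inter_eq_self_of_subset_left (Icc_subset_Icc_left hs.1), integral_neg, S.integral_density hs,
    neg_neg]

/-- Since `h 0` may be a boundary point of the domain, continuity is available only on `(0, T]`.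
Monotonicity of `h` puts its values between `h 0` and `0`, and convexity bounds `Gr` there by its
end values. -/
lemma integrable_Gr (S : Saddle γ ν K T X h) (hν : IsLevyMeasure ν) (h1 : AssumptionA1 ν)
    (h2 : Bornology.IsBounded (effDom γ ν)) (hK : 0 < K) (hT : 0 < T) :
    IntegrableOn (fun s => Gr γ ν (h s)) (Icc 0 T) := by
  obtain ⟨C, hC, hle⟩ := exists_le_Gr hν h1 h2
  have hcont : ContinuousOn (fun s => Gr γ ν (h s)) (Ioc 0 T) :=
    (continuousOn_Gr_interior hν).comp (S.continuousOn_h.mono Ioc_subset_Icc_self) S.mem_interior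
  rw [integrableOn_Icc_iff_integrableOn_Ioc]
  refine Integrable.of_bound (hcont.aestronglyMeasurable measurableSet_Ioc)
    (max C (max (Gr γ ν (h 0)) (Gr γ ν 0))) ?_
  filter_upwards [ae_restrict_mem measurableSet_Ioc] with s hs
  have hs' := Ioc_subset_Icc_self hs
  rw [Real.norm_eq_abs, abs_le]
  constructor
  · linarith [hle _ (S.mem_effDom hs'), le_max_left C (max (Gr γ ν (h 0)) (Gr γ ν 0))]
  · refine le_trans ?_ (le_max_right _ _)
    refine (convexOn_Gr hν).le_max_of_mem_Icc S.mem_zero (zero_mem_effDom hν) ⟨?_, ?_⟩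
    · exact S.monotoneOn_h hK hT (left_mem_Icc.2 hT.le) hs' hs.1.le
    · rw [← S.final]
      exact S.monotoneOn_h hK hT hs' (right_mem_Icc.2 hT.le) hs.2

lemma cumG_dual (S : Saddle γ ν K T X h) (hν : IsLevyMeasure ν) (h1 : AssumptionA1 ν)
    (h2 : Bornology.IsBounded (effDom γ ν)) (hK : 0 < K) (hT : 0 < T) :
    cumG γ ν T (dual K T X h) = ((∫ s in Icc 0 T, Gr γ ν (h s) : ℝ) : EReal) := by
  refine cumG_of_ae_eq hν ?_ (S.integrable_Gr hν h1 h2 hK hT)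
  filter_upwards [ae_restrict_mem measurableSet_Icc] with s hs
  exact ⟨S.dual_apply_Icc hs, S.mem_effDom hs⟩

lemma one_sub_eq (S : Saddle γ ν K T X h) (hT : 0 < T) :
    1 - h 0 = 1 + ∫ t in Icc 0 T, density K T X h t := by
  rw [S.integral_density (left_mem_Icc.2 hT.le)]; ring

/-- Thus `X` realizes equality in Young's inequality against its own dual measure. -/
lemma log_density (S : Saddle γ ν K T X h) (hK : 0 < K) (hT : 0 < T) (s : ℝ) :
    Real.log (K * T / (1 - h 0) * density K T X h s) = X s := by
  have := S.nonpos
  have : 0 < 1 - h 0 := by linarith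
  have : K * T / (1 - h 0) * density K T X h s = Real.exp (X s) := by
    unfold density; field_simp
  rw [this, Real.log_exp]

/-- The dual measure bounds the primal problem. -/
lemma le_value (S : Saddle γ ν K T X h) (hK : 0 < K) (hT : 0 < T) {x : ℝ → ℝ} (hx : x ∈ Vr T)
    {a : ℝ} (ha : H K T x = a) :
    a - pairing x (dual K T X h) + ∫ s in Icc 0 T, Gr γ ν (h s) ≤ value γ ν K T X h := by
  have hpos : 0 < K - 1 / T * ∫ t in (0 : ℝ)..T, Real.exp (x t) := by
    by_contra! hneg
    rw [H_of_nonpos hneg] at ha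
    exact EReal.bot_ne_coe _ ha
  rw [H_of_pos hpos, EReal.coe_eq_coe_iff] at ha
  have hlog : (fun t => density K T X h t * Real.log (K * T / (1 - h 0) * density K T X h t))
      = fun t => density K T X h t * X t := by
    ext t; rw [S.log_density hK hT]
  have h3 := log_payoff_add_le hK hT hx S.integrable_density
    (Eventually.of_forall fun t => (S.density_pos hK hT t).le) hpos (S.one_sub_eq hT) (by
      rw [hlog]
      exact (S.continuousOn_density.mul S.continuousOn).integrableOn_Icc)
  rw [hlog, ha] at h3
  have h4 : pairing x (dual K T X h) = -∫ t in Icc 0 T, x t * density K T X h t := by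
    rw [dual, pairing_withDensity hT hx S.integrable_neg_density, ← integral_neg]
    simp
  rw [h4, value]
  linarith

end Saddle

/-! ### Ramped paths, the duality gap and identification of the optimal measure. -/

namespace Saddle

variable {γ : ℝ} {ν : Measure ℝ} {K T : ℝ} {X h : ℝ → ℝ}

/-- The path `X` with its jump at `0` replaced by a linear ramp on `[0, e]`. -/
noncomputable def ramp (X : ℝ → ℝ) (e t : ℝ) : ℝ := if t ≤ e then t / e * X e else X t

/-- The derivative of the ramped path. -/
noncomputable def rampDeriv (γ : ℝ) (ν : Measure ℝ) (X h : ℝ → ℝ) (e s : ℝ) : ℝ :=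
  if s ≤ e then X e / e else deriv (Gr γ ν) (h s)

lemma intervalIntegrable_deriv (S : Saddle γ ν K T X h) (hν : IsLevyMeasure ν) (hK : 0 < K)
    (hT : 0 < T) {e t : ℝ} (he : 0 < e) (het : e ≤ t) (htT : t ≤ T) :
    IntervalIntegrable (fun s => deriv (Gr γ ν) (h s)) volume e t := by
  refine MonotoneOn.intervalIntegrable fun s hs r hr hsr => ?_
  rw [uIcc_of_le het] at hs hr
  exact monotoneOn_deriv_Gr hν (S.mem_interior s ⟨he.trans_le hs.1, hs.2.trans htT⟩)
    (S.mem_interior r ⟨he.trans_le hr.1, hr.2.trans htT⟩)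
    (S.monotoneOn_h hK hT ⟨he.le.trans hs.1, hs.2.trans htT⟩ ⟨he.le.trans hr.1, hr.2.trans htT⟩ hsr)

lemma intervalIntegrable_ite {f g : ℝ → ℝ} {e t : ℝ} (he : 0 ≤ e) (het : e ≤ t)
    (hf : IntervalIntegrable f volume 0 e) (hg : IntervalIntegrable g volume e t) :
    IntervalIntegrable (fun s => if s ≤ e then f s else g s) volume 0 t := by
  refine IntervalIntegrable.trans (b := e) (hf.congr fun s hs => ?_) (hg.congr fun s hs => ?_)
  · rw [uIoc_of_le he] at hs
    simp [hs.2]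
  · rw [uIoc_of_le het] at hs
    simp [not_le.2 hs.1]

lemma integral_ite {f g : ℝ → ℝ} {e t : ℝ} (he : 0 ≤ e) (het : e ≤ t)
    (hf : IntervalIntegrable f volume 0 e) (hg : IntervalIntegrable g volume e t) :
    ∫ s in (0 : ℝ)..t, (if s ≤ e then f s else g s) =
      (∫ s in (0 : ℝ)..e, f s) + ∫ s in e..t, g s := by
  have hi := intervalIntegrable_ite he het hf hg
  rw [← intervalIntegral.integral_add_adjacent_intervals (b := e)
    (hi.mono_set (by rw [uIcc_of_le he, uIcc_of_le (he.trans het)]; exact Icc_subset_Icc_right het))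
    (hi.mono_set (by rw [uIcc_of_le het, uIcc_of_le (he.trans het)]; exact Icc_subset_Icc_left he))]
  congr 1
  · refine intervalIntegral.integral_congr fun s hs => ?_
    rw [uIcc_of_le he] at hs
    simp [hs.2]
  · refine intervalIntegral.integral_congr_ae (Eventually.of_forall fun s hs => ?_)
    rw [uIoc_of_le het] at hs
    simp [not_le.2 hs.1]

lemma intervalIntegrable_rampDeriv (S : Saddle γ ν K T X h) (hν : IsLevyMeasure ν) (hK : 0 < K)
    (hT : 0 < T) {e : ℝ} (he : 0 < e) (heT : e ≤ T) :
    IntervalIntegrable (rampDeriv γ ν X h e) volume 0 T :=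
  intervalIntegrable_ite he.le heT (by simp) (S.intervalIntegrable_deriv hν hK hT he heT le_rfl)

lemma ramp_eq_integral (S : Saddle γ ν K T X h) (hν : IsLevyMeasure ν) (hK : 0 < K)
    (hT : 0 < T) {e : ℝ} (he : 0 < e) {t : ℝ} (ht : t ∈ Icc 0 T) :
    ramp X e t = ∫ s in (0 : ℝ)..t, rampDeriv γ ν X h e s := by
  rcases le_or_gt t e with hte | hte
  · have : ∫ s in (0 : ℝ)..t, rampDeriv γ ν X h e s = ∫ s in (0 : ℝ)..t, X e / e := by
      refine intervalIntegral.integral_congr fun s hs => ?_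
      rw [uIcc_of_le ht.1] at hs
      simp [rampDeriv, hs.2.trans hte]
    rw [this, ramp, if_pos hte, intervalIntegral.integral_const, smul_eq_mul]
    ring
  · have hi := S.intervalIntegrable_deriv hν hK hT he hte.le ht.2
    have h1 := integral_ite (f := fun _ => X e / e) he.le hte.le (by simp) hi
    have h2 := intervalIntegral.integral_eq_sub_of_hasDerivAt_of_le hte.le
      (S.continuousOn.mono (Icc_subset_Icc he.le ht.2))
      (fun s hs => S.hasDerivAt_X ⟨he.trans hs.1, hs.2.trans_le ht.2⟩) hi
    unfold rampDeriv
    rw [h1, h2, ramp, if_neg (not_le.2 hte), intervalIntegral.integral_const, smul_eq_mul]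
    field_simp
    ring

lemma ramp_mem_Vr (S : Saddle γ ν K T X h) (hν : IsLevyMeasure ν) (hK : 0 < K)
    (hT : 0 < T) {e : ℝ} (he : 0 < e) (heT : e ≤ T) : ramp X e ∈ Vr T := by
  have hTm : T ∈ Icc 0 T := right_mem_Icc.2 hT.le
  have hem : e ∈ Icc 0 T := ⟨he.le, heT⟩
  set C : ℝ := max |X e / e| (max |deriv (Gr γ ν) (h e)| |deriv (Gr γ ν) (h T)|) with hC
  have hbound : ∀ s ∈ Icc 0 T, |rampDeriv γ ν X h e s| ≤ C := by
    intro s hs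
    unfold rampDeriv
    split_ifs with hse
    · exact le_max_left _ _
    · push Not at hse
      refine le_trans (abs_le_max_abs_abs ?_ ?_) (le_max_right _ _)
      · exact monotoneOn_deriv_Gr hν (S.mem_interior e ⟨he, heT⟩)
          (S.mem_interior s ⟨he.trans hse, hs.2⟩) (S.monotoneOn_h hK hT hem hs hse.le)
      · exact monotoneOn_deriv_Gr hν (S.mem_interior s ⟨he.trans hse, hs.2⟩)
          (S.mem_interior T ⟨hT, le_rfl⟩) (S.monotoneOn_h hK hT hs hTm hs.2)
  have hC0 : 0 ≤ C := (abs_nonneg _).trans (le_max_left _ _)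
  have hi := S.intervalIntegrable_rampDeriv hν hK hT he heT
  have hsub : ∀ s ∈ Icc 0 T, IntervalIntegrable (rampDeriv γ ν X h e) volume 0 s := fun s hs =>
    hi.mono_set (by rw [uIcc_of_le hs.1, uIcc_of_le hT.le]; exact Icc_subset_Icc_right hs.2)
  refine LipschitzOnWith.mem_Vr (C := C.toNNReal) hT
      (LipschitzOnWith.of_dist_le_mul fun s hs t ht => ?_)
  rw [Real.dist_eq, S.ramp_eq_integral hν hK hT he hs, S.ramp_eq_integral hν hK hT he ht,
    intervalIntegral.integral_interval_sub_left (hsub s hs) (hsub t ht), Real.coe_toNNReal _ hC0,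
    Real.dist_eq]
  refine intervalIntegral.norm_integral_le_of_norm_le_const (f := rampDeriv γ ν X h e) fun r hr =>
      ?_
  exact hbound r ((convex_Icc 0 T).ordConnected.uIcc_subset ht hs (uIoc_subset_uIcc hr))

/-- On `[0, e]` the steep slope costs, in the limit, the support function of the domain at `X 0`,
attained at `h 0` by the normal cone condition; `R` and `C` measure the error. After `e`, the
tangent inequality at `h s` gives the exact conjugate, and an integration by parts rewrites it. -/
lemma rate_ramp_le (S : Saddle γ ν K T X h) (hν : IsLevyMeasure ν) (h1 : AssumptionA1 ν)
    (h2 : AssumptionA2 γ ν) (hK : 0 < K) (hT : 0 < T) {R C : ℝ}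
    (hR : ∀ l ∈ effDom γ ν, |l - h 0| ≤ R) (hC : ∀ l ∈ effDom γ ν, -C ≤ Gr γ ν l)
    {e : ℝ} (he : 0 < e) (heT : e ≤ T) :
    rate γ ν T (ramp X e) ≤ ((X e * h 0 + R * |X e - X 0| + C * e - X e * h e
      - (∫ s in e..T, density K T X h s * X s) - ∫ s in e..T, Gr γ ν (h s) : ℝ) : EReal) := by
  have hi := S.intervalIntegrable_deriv hν hK hT he heT le_rfl
  have hsub : Icc e T ⊆ Icc 0 T := Icc_subset_Icc_left he.le
  have hhc : ContinuousOn h (Icc e T) := S.continuousOn_h.mono hsub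
  have hXc : ContinuousOn X (Icc e T) := S.continuousOn.mono hsub
  have hih : IntervalIntegrable (fun s => deriv (Gr γ ν) (h s) * h s) volume e T :=
    hi.mul_continuousOn (by rwa [uIcc_of_le heT])
  have hiG : IntervalIntegrable (fun s => Gr γ ν (h s)) volume e T := by
    refine ContinuousOn.intervalIntegrable_of_Icc heT ((continuousOn_Gr_interior hν).comp hhc ?_)
    exact fun s hs => S.mem_interior s ⟨he.trans_le hs.1, hs.2⟩
  have hidX : IntervalIntegrable (fun s => density K T X h s * X s) volume e T :=
    ((S.continuousOn_density.mono hsub).mul hXc).intervalIntegrable_of_Icc heT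
  -- There is no boundary term at `T` because `h T = 0`.
  have hparts : ∫ s in e..T, deriv (Gr γ ν) (h s) * h s
      = -(X e * h e) - ∫ s in e..T, density K T X h s * X s := by
    have h3 := intervalIntegral.integral_eq_sub_of_hasDerivAt_of_le heT (hXc.mul hhc)
      (fun s hs => (S.hasDerivAt_X ⟨he.trans hs.1, hs.2⟩).mul
        (S.hasDerivAt_h ⟨he.trans hs.1, hs.2⟩)) (hih.add (hidX.congr fun s _ => mul_comm _ _))
    simp only [Pi.mul_apply, S.final, mul_zero, zero_sub] at h3
    rw [intervalIntegral.integral_add hih (hidX.congr fun s _ => mul_comm _ _)] at h3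
    simp_rw [mul_comm (density K T X h _)]
    linarith
  refine (rate_le_integral hν h1 h2 hT (S.intervalIntegrable_rampDeriv hν hK hT he heT)
    (intervalIntegrable_ite (f := fun _ => (X e * h 0 + R * |X e - X 0|) / e + C) he.le heT
        (by simp)
      (hih.sub hiG))
    (fun t ht => S.ramp_eq_integral hν hK hT he ht) (S.ramp_mem_Vr hν hK hT he heT) ?_).trans
    (le_of_eq ?_)
  · intro s hs l hl
    unfold rampDeriv
    split_ifs with hse
    · have h3 : X e * l ≤ X e * h 0 + R * |X e - X 0| := by
        have h4 := S.normal l hl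
        have h5 : (X e - X 0) * (l - h 0) ≤ R * |X e - X 0| := by
          refine (le_abs_self _).trans ?_
          rw [abs_mul, mul_comm]
          exact mul_le_mul_of_nonneg_right (hR l hl) (abs_nonneg _)
        linarith
      have h6 : X e / e * l ≤ (X e * h 0 + R * |X e - X 0|) / e := by
        rw [div_mul_eq_mul_div]
        exact div_le_div_of_nonneg_right h3 he.le
      linarith [hC l hl]
    · push Not at hse
      have := Gr_tangent_le hν (S.mem_interior s ⟨he.trans hse, hs.2⟩) hl
      linarith
  · rw [EReal.coe_eq_coe_iff, integral_ite he.le heT (by simp) (hih.sub hiG),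
      intervalIntegral.integral_sub hih hiG, hparts, intervalIntegral.integral_const, smul_eq_mul]
    field_simp
    ring

/-- Integrating the equation of `h` shows that `X` itself leaves the payoff `K / (1 - h 0)`. The
ramp adds at most `e * exp B` to the exponential integral. -/
lemma exists_H_ramp_ge (S : Saddle γ ν K T X h) (hK : 0 < K) (hT : 0 < T)
    {B : ℝ} (hB : ∀ t ∈ Icc 0 T, |X t| ≤ B) {e : ℝ} (he : 0 < e) (heT : e ≤ T)
    (hpos : 0 < K / (1 - h 0) - 1 / T * (e * Real.exp B)) :
    ∃ a : ℝ, H K T (ramp X e) = a ∧ Real.log (K / (1 - h 0) - 1 / T * (e * Real.exp B)) ≤ a := by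
  have hA : 0 < 1 - h 0 := by linarith [S.nonpos]
  have hXi : IntervalIntegrable (fun s => Real.exp (X s)) volume 0 T :=
    (Real.continuous_exp.comp_continuousOn S.continuousOn).intervalIntegrable_of_Icc hT.le
  have hXi' : IntervalIntegrable (fun s => Real.exp (X s)) volume e T :=
    (Real.continuous_exp.comp_continuousOn (S.continuousOn.mono
      (Icc_subset_Icc_left he.le))).intervalIntegrable_of_Icc heT
  have hri : IntervalIntegrable (fun t => Real.exp (t / e * X e)) volume 0 e :=
    Continuous.intervalIntegrable (by fun_prop) _ _
  have hexp : ∫ t in (0 : ℝ)..T, Real.exp (ramp X e t)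
      = (∫ t in (0 : ℝ)..e, Real.exp (t / e * X e)) + ∫ t in e..T, Real.exp (X t) := by
    rw [← integral_ite he.le heT hri hXi']
    congr 1 with t
    unfold ramp
    split_ifs <;> rfl
  have h3 : ∫ t in (0 : ℝ)..e, Real.exp (t / e * X e) ≤ e * Real.exp B := by
    have : ∫ t in (0 : ℝ)..e, Real.exp (t / e * X e) ≤ ∫ t in (0 : ℝ)..e, Real.exp B := by
      refine intervalIntegral.integral_mono_on he.le hri (by simp) fun t ht => Real.exp_le_exp.2 ?_
      have h4 : t / e ≤ 1 := (div_le_one he).2 ht.2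
      have h5 : 0 ≤ t / e := div_nonneg ht.1 he.le
      refine (le_abs_self _).trans ?_
      rw [abs_mul, abs_of_nonneg h5]
      exact (mul_le_of_le_one_left (abs_nonneg _) h4).trans (hB e ⟨he.le, heT⟩)
    simpa using this
  have h4 : ∫ t in e..T, Real.exp (X t) ≤ ∫ t in (0 : ℝ)..T, Real.exp (X t) :=
    intervalIntegral.integral_mono_interval he.le heT le_rfl
      (Eventually.of_forall fun t => (Real.exp_pos _).le) hXi
  have h5 : K - 1 / T * ∫ t in (0 : ℝ)..T, Real.exp (X t) = K / (1 - h 0) := by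
    have h6 := S.one_sub_eq hT
    rw [integral_Icc_eq_integral_Ioc, ← intervalIntegral.integral_of_le hT.le] at h6
    unfold density at h6
    rw [intervalIntegral.integral_div, intervalIntegral.integral_mul_const] at h6
    have h7 : ∫ t in (0 : ℝ)..T, Real.exp (X t) = -h 0 * (K * T) / (1 - h 0) := by
      field_simp at h6 ⊢
      linarith
    rw [h7]
    field_simp
    ring
  have h6 : K / (1 - h 0) - 1 / T * (e * Real.exp B)
      ≤ K - 1 / T * ∫ t in (0 : ℝ)..T, Real.exp (ramp X e t) := by
    rw [hexp, ← h5]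
    have : 1 / T * ((∫ t in (0 : ℝ)..e, Real.exp (t / e * X e)) + ∫ t in e..T, Real.exp (X t))
        ≤ 1 / T * (e * Real.exp B + ∫ t in (0 : ℝ)..T, Real.exp (X t)) := by gcongr
    linarith
  exact ⟨_, H_of_pos (hpos.trans_le h6), Real.log_le_log hpos h6⟩

/-- The value of the dual problem is approached by paths of bounded variation. -/
lemma exists_near_value (S : Saddle γ ν K T X h) (hν : IsLevyMeasure ν) (h1 : AssumptionA1 ν)
    (h2 : AssumptionA2 γ ν) (hK : 0 < K) (hT : 0 < T) {ε : ℝ} (hε : 0 < ε) :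
    ∃ x ∈ Vr T, ∃ a r : ℝ, H K T x = a ∧ rate γ ν T x ≤ r ∧ value γ ν K T X h - ε < a - r := by
  obtain ⟨R, hR0, hR⟩ := exists_abs_le_of_mem_effDom h2.2
  obtain ⟨C, hC0, hC⟩ := exists_le_Gr hν h1 h2.2
  obtain ⟨B, hB⟩ := isCompact_Icc.exists_bound_of_continuousOn S.continuousOn
  have hR' : ∀ l ∈ effDom γ ν, |l - h 0| ≤ R + R := fun l hl =>
    (abs_sub _ _).trans (add_le_add (hR l hl) (hR _ S.mem_zero))
  have hA : 0 < 1 - h 0 := by linarith [S.nonpos]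
  have hKA : 0 < K / (1 - h 0) := by positivity
  have h0m : (0 : ℝ) ∈ Icc 0 T := left_mem_Icc.2 hT.le
  have hle : 𝓝[>] (0 : ℝ) ≤ 𝓝[Icc 0 T] 0 := by
    refine nhdsWithin_le_iff.2 (mem_of_superset (Ioo_mem_nhdsGT hT) Ioo_subset_Icc_self)
  have hXl : Tendsto X (𝓝[>] 0) (𝓝 (X 0)) := (S.continuousOn 0 h0m).mono_left hle
  have hhl : Tendsto h (𝓝[>] 0) (𝓝 (h 0)) := (S.continuousOn_h 0 h0m).mono_left hle
  have hel : Tendsto (fun e : ℝ => e) (𝓝[>] 0) (𝓝 0) := tendsto_id.mono_left nhdsWithin_le_nhds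
  have hint : ∀ f : ℝ → ℝ, IntegrableOn f (Icc 0 T) →
      Tendsto (fun e => ∫ s in e..T, f s) (𝓝[>] 0) (𝓝 (∫ s in Icc 0 T, f s)) := by
    intro f hf
    have h3 := intervalIntegral.continuousOn_primitive_interval_left
      (by rwa [uIcc_of_le hT.le] : IntegrableOn f (uIcc 0 T) volume)
    rw [uIcc_of_le hT.le] at h3
    have h4 : Tendsto _ _ (𝓝 (∫ s in (0 : ℝ)..T, f s)) := (h3 0 h0m).mono_left hle
    rwa [intervalIntegral.integral_of_le hT.le, ← integral_Icc_eq_integral_Ioc] at h4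
  have hd := hint _ (S.continuousOn_density.mul S.continuousOn).integrableOn_Icc
  have hG := hint _ (S.integrable_Gr hν h1 h2.2 hK hT)
  have harg : Tendsto (fun e : ℝ => K / (1 - h 0) - 1 / T * (e * Real.exp B)) (𝓝[>] 0)
      (𝓝 (K / (1 - h 0))) := by
    have := ((hel.mul_const (Real.exp B)).const_mul (1 / T)).const_sub (K / (1 - h 0))
    simpa using this
  have hlog := (Real.continuousAt_log hKA.ne').tendsto.comp harg
  have habs : Tendsto (fun e => |X e - X 0|) (𝓝[>] 0) (𝓝 0) := by
    simpa using (hXl.sub_const (X 0)).abs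
  have hlim := hlog.sub ((((((hXl.mul_const (h 0)).add (habs.const_mul (R + R))).add
    (hel.const_mul C)).sub (hXl.mul hhl)).sub hd).sub hG)
  have hV : Real.log (K / (1 - h 0)) - (X 0 * h 0 + (R + R) * 0 + C * 0 - X 0 * h 0
      - (∫ s in Icc 0 T, (density K T X h * X) s) - ∫ s in Icc 0 T, Gr γ ν (h s))
      = value γ ν K T X h := by
    simp only [value, Pi.mul_apply]
    ring
  have hlt : value γ ν K T X h - ε < Real.log (K / (1 - h 0)) - (X 0 * h 0 + (R + R) * 0 + C * 0
      - X 0 * h 0 - (∫ s in Icc 0 T, (density K T X h * X) s) - ∫ s in Icc 0 T, Gr γ ν (h s)) := by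
    rw [hV]; linarith
  obtain ⟨e, he1, he2, he3⟩ := ((hlim.eventually (lt_mem_nhds hlt)).and
    ((harg.eventually (lt_mem_nhds hKA)).and (Ioo_mem_nhdsGT hT))).exists
  obtain ⟨a, ha, hale⟩ := S.exists_H_ramp_ge hK hT hB he3.1 he3.2.le he2
  refine ⟨ramp X e, S.ramp_mem_Vr hν hK hT he3.1 he3.2.le, a, _, ha,
    S.rate_ramp_le hν h1 h2 hK hT hR' hC he3.1 he3.2.le, he1.trans_le ?_⟩
  simp only [Function.comp_apply, Pi.mul_apply] at hale ⊢
  linarith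

/-- Testing `J̄` with the dual measure itself bounds the proxy term by twice `H(x) - ∫ x dθ + ∫ G`,
and `le_value` bounds that expression by the value. -/
lemma term_dual_le (S : Saddle γ ν K T X h) (hν : IsLevyMeasure ν) (h1 : AssumptionA1 ν)
    (h2 : AssumptionA2 γ ν) (hK : 0 < K) (hT : 0 < T) :
    varProxy γ ν K T (dual K T X h) ≤ ((2 * value γ ν K T X h : ℝ) : EReal) := by
  refine iSup₂_le fun x hx => ?_
  have hrate := le_rate (γ := γ) (ν := ν) (x := x) (dual_mem (K := K) (T := T) (X := X) (h := h))
  rw [S.cumG_dual hν h1 h2.2 hK hT] at hrate ⊢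
  rcases lt_or_ge 0 (K - 1 / T * ∫ t in (0 : ℝ)..T, Real.exp (x t)) with hp | hp
  · have hle := S.le_value hK hT hx (H_of_pos hp)
    rw [H_of_pos hp]
    generalize rate γ ν T x = ρ at hrate ⊢
    induction ρ with
    | bot => exact absurd (le_bot_iff.1 hrate) (by rw [← EReal.coe_sub]; exact EReal.coe_ne_bot _)
    | top => rw [EReal.sub_top]; exact bot_le
    | coe ρ =>
      rw [← EReal.coe_sub, EReal.coe_le_coe_iff] at hrate
      have e2 : (2 : EReal) = ((2 : ℝ) : EReal) := rfl
      rw [e2, ← EReal.coe_mul, ← EReal.coe_sub, ← EReal.coe_add, ← EReal.coe_sub,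
        EReal.coe_le_coe_iff]
      linarith
  · rw [H_of_nonpos hp, EReal.mul_bot_of_pos (by norm_num)]
    simp

/-- An asymptotically optimal measure coincides with the dual measure of a saddle point. -/
theorem apply_Icc_eq_of_isAsymptoticallyOptimal (S : Saddle γ ν K T X h) (hν : IsLevyMeasure ν)
    (h1 : AssumptionA1 ν) (h2 : AssumptionA2 γ ν) (hK : 0 < K) (hT : 0 < T) {θ : SignedMeasure ℝ}
    (hθ : IsAsymptoticallyOptimal γ ν K T θ) :
    ∀ᵐ s ∂volume.restrict (Icc 0 T), θ (Icc s T) = h s := by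
  set V := value γ ν K T X h with hV
  have hvar : varProxy γ ν K T θ ≤ ((2 * V : ℝ) : EReal) :=
    (hθ.2 _ dual_mem).trans (S.term_dual_le hν h1 h2 hK hT)
  have e2 : (2 : EReal) = ((2 : ℝ) : EReal) := rfl
  have hterm : ∀ x ∈ Vr T, 2 * H K T x - (pairing x θ : EReal) + cumG γ ν T θ - rate γ ν T x
      ≤ ((2 * V : ℝ) : EReal) := fun x hx =>
    (le_iSup₂ (f := fun x (_ : x ∈ Vr T) =>
      2 * H K T x - (pairing x θ : EReal) + cumG γ ν T θ - rate γ ν T x) x hx).trans hvar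
  have hnear : ∀ ε > 0, ∃ x ∈ Vr T, ∃ a ρ : ℝ, H K T x = a ∧ rate γ ν T x = ρ ∧ V - ε < a - ρ := by
    intro ε hε
    obtain ⟨x, hx, a, r, ha, hr, hlt⟩ := S.exists_near_value hν h1 h2 hK hT hε
    have hrate := le_rate (γ := γ) (ν := ν) (x := x) (dual_mem (K := K) (T := T) (X := X) (h := h))
    rw [S.cumG_dual hν h1 h2.2 hK hT, ← EReal.coe_sub] at hrate
    have hρ : ((rate γ ν T x).toReal : EReal) = rate γ ν T x :=
      EReal.coe_toReal (ne_top_of_le_ne_top (EReal.coe_ne_top _) hr)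
        (ne_bot_of_le_ne_bot (EReal.coe_ne_bot _) hrate)
    refine ⟨x, hx, a, _, ha, hρ.symm, ?_⟩
    rw [← hρ, EReal.coe_le_coe_iff] at hr
    linarith
  -- At a path where both `H` and the rate are finite, an infinite `cumG` would make the proxy
  -- infinite.
  have hfin : cumG γ ν T θ < ⊤ := by
    refine lt_top_iff_ne_top.2 fun htop => ?_
    obtain ⟨x, hx, a, ρ, ha, hρ, -⟩ := hnear 1 one_pos
    have := hterm x hx
    rw [ha, hρ, htop, e2, ← EReal.coe_mul, ← EReal.coe_sub, EReal.coe_add_top,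
      EReal.top_sub_coe, top_le_iff] at this
    exact EReal.coe_ne_top _ this
  obtain ⟨hmem, hint, hc⟩ := cumG_of_lt_top hν h1 h2 hfin
  have hGi := S.integrable_Gr hν h1 h2.2 hK hT
  -- The midpoint serves as a test measure in the rate; convexity makes its `cumG` finite.
  set η : SignedMeasure ℝ := (1 / 2 : ℝ) • (θ + dual K T X h) with hη
  have hηM : η ∈ M T := by
    intro B hB hd
    simp [hη, hθ.1 B hB hd, (dual_mem (K := K) (T := T) (X := X) (h := h)) B hB hd]
  have hηs : ∀ s ∈ Icc 0 T, η (Icc s T) = (1 / 2 : ℝ) * θ (Icc s T) + (1 / 2 : ℝ) * h s := by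
    intro s hs
    simp [hη, S.dual_apply_Icc hs]
  have hconv := convexOn_Gr (γ := γ) hν
  have hmid : ∀ᵐ s ∂volume.restrict (Icc 0 T), η (Icc s T) ∈ effDom γ ν ∧
      Gr γ ν (η (Icc s T)) ≤ 1 / 2 * Gr γ ν (θ (Icc s T)) + 1 / 2 * Gr γ ν (h s) := by
    filter_upwards [hmem, ae_restrict_mem measurableSet_Icc] with s hs hsT
    rw [hηs s hsT]
    exact ⟨hconv.1 hs (S.mem_effDom hsT) (by norm_num) (by norm_num) (by norm_num),
      hconv.2 hs (S.mem_effDom hsT) (by norm_num) (by norm_num) (by norm_num)⟩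
  have hηi : IntegrableOn (fun s => Gr γ ν (η (Icc s T))) (Icc 0 T) := by
    obtain ⟨C, hC0, hC⟩ := exists_le_Gr hν h1 h2.2
    have hm : Measurable fun s => Gr γ ν (η (Icc s T)) :=
      (h2.1.measurable.comp (measurable_apply_Icc η T)).ereal_toReal
    refine integrable_of_le_of_le hm.aestronglyMeasurable (hmid.mono fun s hs => hC _ hs.1)
      (hmid.mono fun s hs => hs.2) (integrable_const _)
      ((hint.const_mul (1 / 2)).add (hGi.const_mul (1 / 2)))
  have hηc := cumG_of_ae_eq (T := T) (θ := η) hν (hmid.mono fun s hs => ⟨rfl, hs.1⟩) hηi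
  have hkey : 1 / 2 * (∫ s in Icc 0 T, Gr γ ν (θ (Icc s T))) + 1 / 2 *
      (∫ s in Icc 0 T, Gr γ ν (h s))
      ≤ ∫ s in Icc 0 T, Gr γ ν (η (Icc s T)) := by
    -- Take a nearly optimal path, add half of `ht1` and half of `ht2`, and bound the pairing with
    -- `η` by `ρ + cumG η`. The defect is `3 / 2 * (V - (a - ρ))`, less than `ε`.
    refine le_of_forall_pos_le_add fun ε hε => ?_
    obtain ⟨x, hx, a, ρ, ha, hρ, hlt⟩ := hnear (ε / 2) (by positivity)
    have ht1 := hterm x hx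
    have ht2 := S.le_value hK hT hx ha
    have hr0 := le_rate (γ := γ) (ν := ν) (x := x) (dual_mem (K := K) (T := T) (X := X) (h := h))
    have hr1 := le_rate (γ := γ) (ν := ν) (x := x) hηM
    rw [S.cumG_dual hν h1 h2.2 hK hT, hρ, ← EReal.coe_sub, EReal.coe_le_coe_iff] at hr0
    rw [hηc, hρ, ← EReal.coe_sub, EReal.coe_le_coe_iff] at hr1
    rw [ha, hρ, hc, e2, ← EReal.coe_mul, ← EReal.coe_sub, ← EReal.coe_add, ← EReal.coe_sub,
      EReal.coe_le_coe_iff] at ht1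
    have hp : pairing x η = 1 / 2 * (pairing x θ + pairing x (dual K T X h)) := by
      rw [pairing, hη, VectorMeasure.integral_smul_vectorMeasure,
        VectorMeasure.integral_add_vectorMeasure (Vr.integrable_variation hT hx hθ.1)
          (Vr.integrable_variation hT hx dual_mem), smul_eq_mul, pairing, pairing]
    rw [hp] at hr1
    linarith
  have hint2 : IntegrableOn
      (fun s => 1 / 2 * Gr γ ν (θ (Icc s T)) + 1 / 2 * Gr γ ν (h s)) (Icc 0 T) :=
    (hint.const_mul (1 / 2)).add (hGi.const_mul (1 / 2))
  -- Convexity gives the reverse of `hkey`, so the midpoint inequality is an equality almost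
  -- everywhere; strict convexity then identifies the two arguments.
  have hzero := (integral_eq_iff_of_ae_le hηi hint2 (hmid.mono fun s hs => hs.2)).1 (by
    refine le_antisymm (integral_mono_ae hηi hint2 (hmid.mono fun s hs => hs.2)) ?_
    rw [integral_add (hint.const_mul (1 / 2)) (hGi.const_mul (1 / 2)), integral_const_mul,
      integral_const_mul]
    exact hkey)
  filter_upwards [hzero, hmem, ae_restrict_mem measurableSet_Icc] with s hs hsD hsT
  by_contra hne
  have hhalf : (0 : ℝ) < 1 / 2 := by norm_num
  have := (strictConvexOn_Gr hν h2.2).2 hsD (S.mem_effDom hsT) hne hhalf hhalf (by norm_num)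
  rw [hηs s hsT] at hs
  simp only [smul_eq_mul] at this
  linarith

end Saddle

/-! ### Existence of a saddle point -/

variable {γ : ℝ} {ν : Measure ℝ} {K T : ℝ}

/-- Only the left end of the domain matters, because the dual variable of a saddle point is
nonpositive. -/
lemma exists_left_endpoint (hν : IsLevyMeasure ν) (h1 : AssumptionA1 ν)
    (h2 : Bornology.IsBounded (effDom γ ν)) :
    ∃ a, 0 < a ∧ (∀ y ∈ Ico 0 a, -y ∈ interior (effDom γ ν)) ∧ ∀ l ∈ effDom γ ν, -a ≤ l := by
  have h0 := zero_mem_interior_effDom (γ := γ) hν h1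
  have hbdd := h2.bddBelow
  have hlow : ∀ l ∈ effDom γ ν, sInf (effDom γ ν) ≤ l := fun l hl => csInf_le hbdd hl
  have hneg : sInf (effDom γ ν) < 0 := by
    obtain ⟨r, hr, hball⟩ := Metric.mem_nhds_iff.1 (mem_interior_iff_mem_nhds.1 h0)
    have := hlow (-(r / 2)) (hball (by
      rw [mem_ball_zero_iff, norm_neg, Real.norm_eq_abs, abs_of_pos (by positivity)]
      linarith))
    linarith
  refine ⟨-sInf (effDom γ ν), by linarith, fun y hy => ?_, fun l hl => by simpa using hlow l hl⟩
  obtain ⟨l, hl, hly⟩ := exists_lt_of_csInf_lt ⟨0, zero_mem_effDom hν⟩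
    (show sInf (effDom γ ν) < -y by linarith [hy.2])
  have hseg := (convexOn_Gr (γ := γ) hν).1.openSegment_self_interior_subset_interior hl h0
  rcases hy.1.eq_or_lt with rfl | hy0
  · simpa using h0
  · refine hseg ?_
    rw [openSegment_eq_Ioo (by linarith)]
    exact ⟨hly, by linarith⟩

/-- Reversed time. Since `h' = F(-h) + c`, the equation for `h'` forces `e^X = K T / (1 + Y) *
(F(-h) + c)`. Differentiating the logarithm cancels the factor `h'` and leaves `X' = G'(h)`. -/
lemma exists_saddle_of_level (hν : IsLevyMeasure ν) (hK : 0 < K) (hT : 0 < T) {Y c : ℝ}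
    (hY : 0 < Y) {F : ℝ → ℝ} (hF : Continuous F) (hFG : ∀ y ∈ Icc 0 Y, F y = Gr γ ν (-y))
    (hpos : ∀ y ∈ Icc 0 Y, 0 < F y + c) (hint : ∫ y in (0 : ℝ)..Y, (F y + c)⁻¹ = T)
    (hmem : ∀ y ∈ Ico 0 Y, -y ∈ interior (effDom γ ν)) (hYm : -Y ∈ effDom γ ν)
    (hend : K * T * (F Y + c) = 1 + Y ∨
      (K * T * (F Y + c) ≤ 1 + Y ∧ ∀ l ∈ effDom γ ν, -Y ≤ l)) :
    ∃ X h, Saddle γ ν K T X h := by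
  obtain ⟨y, y0, yT, ymono, yd⟩ := exists_autonomous_solution hF hY hpos hint
  set h : ℝ → ℝ := fun s => -y (T - s) with hh
  set X : ℝ → ℝ := fun s => Real.log (K * T / (1 + Y) * (F (y (T - s)) + c)) with hX
  have hrev : ∀ s ∈ Icc 0 T, T - s ∈ Icc 0 T := fun s hs =>
    ⟨by linarith [hs.2], by linarith [hs.1]⟩
  have hyI : ∀ s ∈ Icc 0 T, y (T - s) ∈ Icc 0 Y := fun s hs =>
    ⟨y0 ▸ ymono.monotone (hrev s hs).1, yT ▸ ymono.monotone (hrev s hs).2⟩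
  have hα : 0 < K * T / (1 + Y) := by positivity
  have hdh : ∀ s ∈ Icc 0 T, HasDerivAt h (F (y (T - s)) + c) s := by
    intro s hs
    have := ((yd (T - s) (hrev s hs)).comp_const_sub T s).neg
    rwa [neg_neg] at this
  have hXpos : ∀ s ∈ Icc 0 T, 0 < K * T / (1 + Y) * (F (y (T - s)) + c) := fun s hs =>
    mul_pos hα (hpos _ (hyI s hs))
  have h0 : h 0 = -Y := by simp [hh, yT]
  have hX0 : X 0 = Real.log (K * T / (1 + Y) * (F Y + c)) := by simp [hX, yT]
  have hFY := hpos Y (right_mem_Icc.2 hY.le)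
  refine ⟨X, h, ⟨?_, by simp [hh, y0], by rw [h0]; linarith, ?_, ?_, ?_, by rwa [h0], ?_⟩⟩
  · refine ContinuousOn.log ?_ fun s hs => (hXpos s hs).ne'
    have : ContinuousOn (fun s => y (T - s)) (Icc 0 T) := fun s hs =>
      ((yd (T - s) (hrev s hs)).comp_const_sub T s).continuousAt.continuousWithinAt
    exact ((hF.comp_continuousOn this).add continuousOn_const).const_smul (K * T / (1 + Y))
  · intro s hs
    refine (hdh s hs).hasDerivWithinAt.congr_deriv ?_
    rw [hX, Real.exp_log (hXpos s hs), h0]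
    field_simp
    ring
  · intro s hs hsi
    have hG := ((differentiableAt_Gr hν hsi).hasDerivAt.comp s (hdh s hs)).add_const c
    have hval : Gr γ ν (h s) = F (y (T - s)) := (hFG _ (hyI s hs)).symm
    have hl := (hG.const_mul (K * T / (1 + Y))).log (by
      simp only [Function.comp_apply, hval]; exact (hXpos s hs).ne')
    refine (hl.hasDerivWithinAt (s := Icc 0 T)).congr_of_mem (fun t ht => ?_) hs |>.congr_deriv ?_
    · simp only [hX, Function.comp_apply, hh, hFG _ (hyI t ht)]
    · have := hpos _ (hyI s hs)
      simp only [Function.comp_apply, hval]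
      field_simp
  · intro s hs
    have hs' := hyI s (Ioc_subset_Icc_self hs)
    refine hmem _ ⟨hs'.1, ?_⟩
    rw [← yT]
    exact ymono (by linarith [hs.1])
  · intro l hl
    rw [h0, hX0]
    -- Either `X 0 = 0`, or `X 0 ≤ 0` and `-Y` is the left end of the domain, where nonpositive
    -- numbers are normal.
    rcases hend with he | ⟨he, hle⟩
    · have : K * T / (1 + Y) * (F Y + c) = 1 := by
        rw [div_mul_eq_mul_div, he, div_self (by positivity)]
      rw [this, Real.log_one, zero_mul]
    · refine mul_nonpos_of_nonpos_of_nonneg (Real.log_nonpos (by positivity) ?_)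
        (by linarith [hle l hl])
      rw [div_mul_eq_mul_div]
      exact div_le_one_of_le₀ he (by positivity)

lemma exists_saddle (hν : IsLevyMeasure ν) (h1 : AssumptionA1 ν) (h2 : AssumptionA2 γ ν)
    (hK : 0 < K) (hT : 0 < T) : ∃ X h, Saddle γ ν K T X h := by
  obtain ⟨a, ha, hmem, hlow⟩ := exists_left_endpoint (γ := γ) hν h1 h2.2
  have hcont : ContinuousOn (fun y => Gr γ ν (-y)) (Ico 0 a) :=
    (continuousOn_Gr_interior hν).comp continuous_neg.continuousOn hmem
  -- If the left end is in the domain, `b = a`. Otherwise `G` blows up there, and `b` is taken where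
  -- `G` is so large that the boundary alternative of the shooting argument cannot occur.
  obtain ⟨b, hb, hba, hbm, hbc, hbend⟩ : ∃ b, 0 < b ∧ b ≤ a ∧ -b ∈ effDom γ ν ∧
      ContinuousOn (fun y => Gr γ ν (-y)) (Icc 0 b) ∧
      (b = a ∨ 1 + b < K * T * Gr γ ν (-b)) := by
    by_cases had : -a ∈ effDom γ ν
    · refine ⟨a, ha, le_rfl, had, fun y hy => ?_, Or.inl rfl⟩
      rcases hy.2.eq_or_lt with rfl | hya
      · exact continuousWithinAt_Gr_neg hν h2.1 ha had
      · have hd := (differentiableAt_Gr hν (hmem y ⟨hy.1, hya⟩)).continuousAt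
        exact (ContinuousAt.comp hd continuous_neg.continuousAt).continuousWithinAt
    · obtain ⟨b, hb, hlt⟩ := exists_Gr_neg_gt hν h2.1 ha had
        (fun y hy => interior_subset (hmem y hy)) ((1 + a) / (K * T))
      refine ⟨b, hb.1, hb.2.le, interior_subset (hmem b ⟨hb.1.le, hb.2⟩),
        hcont.mono fun y hy => ⟨hy.1, hy.2.trans_lt hb.2⟩, Or.inr ?_⟩
      rw [div_lt_iff₀ (by positivity)] at hlt
      linarith [hb.2]
  set F : ℝ → ℝ := IccExtend hb.le fun y : Icc 0 b => Gr γ ν (-(y : ℝ)) with hFd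
  have hF : Continuous F := continuous_IccExtend_iff.2
      (continuousOn_iff_continuous_domRestrict.1 hbc)
  have hFG : ∀ y ∈ Icc 0 b, F y = Gr γ ν (-y) := fun y hy => IccExtend_of_mem hb.le _ hy
  have hconv : ConvexOn ℝ (Icc 0 b) F := by
    have hG := convexOn_Gr (γ := γ) hν
    have hsub : ∀ y ∈ Icc 0 b, -y ∈ effDom γ ν := fun y hy => by
      rcases hy.2.eq_or_lt with rfl | hyb
      · exact hbm
      · exact interior_subset (hmem y ⟨hy.1, hyb.trans_le hba⟩)
    refine ⟨convex_Icc 0 b, fun y hy z hz u v hu hv huv => ?_⟩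
    rw [hFG _ hy, hFG _ hz, hFG _ (convex_Icc 0 b hy hz hu hv huv)]
    convert hG.2 (hsub y hy) (hsub z hz) hu hv huv using 2
    simp only [smul_eq_mul]; ring
  have hF0 : F 0 = 0 := by
    rw [hFG 0 (left_mem_Icc.2 hb.le), neg_zero, Gr_zero hν]
  obtain ⟨Y, hY, c, hpos, hint, hend⟩ := exists_level_of_continuous hK hT hb hF hconv hF0
  have hc : 0 < c := by simpa [hF0] using hpos 0 (left_mem_Icc.2 hY.1.le)
  refine exists_saddle_of_level hν hK hT hY.1 hF
    (fun y hy => hFG y ⟨hy.1, hy.2.trans hY.2⟩) hpos hint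
    (fun y hy => hmem y ⟨hy.1, hy.2.trans_le (hY.2.trans hba)⟩) ?_ ?_
  · rcases hY.2.eq_or_lt with rfl | hlt
    · exact hbm
    · exact interior_subset (hmem Y ⟨hY.1.le, hlt.trans_le hba⟩)
  · refine hend.imp_right ?_
    rintro ⟨rfl, hle⟩
    refine ⟨hle, ?_⟩
    rcases hbend with rfl | hlt
    · exact hlow
    -- Here `1 + b < K T G(-b)` and `c > 0` contradict the boundary alternative.
    · rw [hFG Y (right_mem_Icc.2 hb.le)] at hle
      have : 0 < K * T * c := by positivity
      linarith

/-! ### From the distribution function to the measure -/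

/-- The map `s ↦ θ([s,T])` is left-continuous, so almost everywhere equality passes to every `s`
that can be approached from the left within `[0, T]`. The point `0` is excluded, and `θ` may have an
atom there. -/
lemma apply_Icc_eq_of_ae_eq {θ : SignedMeasure ℝ} {h : ℝ → ℝ} {T : ℝ}
    (hh : ContinuousOn h (Icc 0 T))
    (hae : ∀ᵐ s ∂volume.restrict (Icc 0 T), θ (Icc s T) = h s) {s : ℝ} (hs : s ∈ Ioc 0 T) :
    θ (Icc s T) = h s := by
  have hdense : Dense {s : ℝ | s ∈ Icc 0 T → θ (Icc s T) = h s} :=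
    Measure.dense_of_ae ((ae_restrict_iff' measurableSet_Icc).1 hae)
  obtain ⟨u, humono, hu, hut⟩ := hdense.exists_seq_strictMono_tendsto_of_lt hs.1
  have huI : ∀ n, u n ∈ Icc 0 T := fun n => ⟨(hu n).1.1.le, ((hu n).1.2.le).trans hs.2⟩
  have hlim : Tendsto (fun n => θ (Icc (u n) T)) atTop (𝓝 (θ (⋂ n, Icc (u n) T))) :=
    VectorMeasure.tendsto_vectorMeasure_iInter_atTop_nat
      (fun _ _ hij => Icc_subset_Icc_left (humono.monotone hij)) fun _ => measurableSet_Icc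
  have hinter : ⋂ n, Icc (u n) T = Icc s T := by
    ext t
    simp only [mem_iInter, mem_Icc]
    exact ⟨fun ht => ⟨le_of_tendsto' hut fun n => (ht n).1, (ht 0).2⟩,
      fun ht n => ⟨(hu n).1.2.le.trans ht.1, ht.2⟩⟩
  rw [hinter] at hlim
  refine tendsto_nhds_unique hlim ?_
  have hcont := (hh s (Ioc_subset_Icc_self hs)).tendsto.comp
    (tendsto_nhdsWithin_iff.2 ⟨hut, Eventually.of_forall huI⟩)
  exact hcont.congr fun n => ((hu n).2 (huI n)).symm

lemma apply_Ioc_eq_of_ae_eq {θ : SignedMeasure ℝ} {h : ℝ → ℝ} {T : ℝ} (hT : 0 < T)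
    (hh : ContinuousOn h (Icc 0 T))
    (hae : ∀ᵐ s ∂volume.restrict (Icc 0 T), θ (Icc s T) = h s) : θ (Ioc 0 T) = h 0 := by
  obtain ⟨u, huanti, hu, hut⟩ := exists_seq_strictAnti_tendsto' hT
  have huI : ∀ n, u n ∈ Icc 0 T := fun n => Ioo_subset_Icc_self (hu n)
  have hlim : Tendsto (fun n => θ (Icc (u n) T)) atTop (𝓝 (θ (⋃ n, Icc (u n) T))) :=
    VectorMeasure.tendsto_vectorMeasure_iUnion_atTop_nat
      (fun _ _ hij => Icc_subset_Icc_left (huanti.antitone hij)) fun _ => measurableSet_Icc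
  have hunion : ⋃ n, Icc (u n) T = Ioc 0 T := by
    ext t
    simp only [mem_iUnion, mem_Icc, mem_Ioc]
    constructor
    · rintro ⟨n, hn⟩
      exact ⟨(hu n).1.trans_le hn.1, hn.2⟩
    · intro ht
      obtain ⟨n, hn⟩ := (hut.eventually (gt_mem_nhds ht.1)).exists
      exact ⟨n, hn.le, ht.2⟩
  rw [hunion] at hlim
  refine tendsto_nhds_unique hlim ?_
  have hcont := (hh 0 (left_mem_Icc.2 hT.le)).tendsto.comp
    (tendsto_nhdsWithin_iff.2 ⟨hut, Eventually.of_forall huI⟩)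
  exact hcont.congr fun n => (apply_Icc_eq_of_ae_eq hh hae ⟨(hu n).1, (hu n).2.le⟩).symm

namespace Saddle

variable {γ : ℝ} {ν : Measure ℝ} {K T : ℝ} {X h : ℝ → ℝ} {θ : SignedMeasure ℝ}

lemma restrict_eq_dual (S : Saddle γ ν K T X h) (hT : 0 < T)
    (hae : ∀ᵐ s ∂volume.restrict (Icc 0 T), θ (Icc s T) = h s) :
    θ.restrict (Ioc 0 T) = dual K T X h := by
  have hdual : ∀ B : Set ℝ, MeasurableSet B →
      dual K T X h B = ∫ t in B ∩ Icc 0 T, -density K T X h t := fun B hB => by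
    rw [dual, withDensityᵥ_apply S.integrable_neg_density hB, Measure.restrict_restrict hB]
  have hI : ∀ s ∈ Icc 0 T, ∫ t in Icc s T, -density K T X h t = h s := fun s hs => by
    rw [integral_neg, S.integral_density hs, neg_neg]
  have h0 : (0 : ℝ) ∈ Icc 0 T := left_mem_Icc.2 hT.le
  have hIoc := apply_Ioc_eq_of_ae_eq hT S.continuousOn_h hae
  refine VectorMeasure.ext_of_generateFrom (range Ici) ?_ ?_ isPiSystem_Ici ?_
  · rintro _ ⟨a, rfl⟩
    rw [VectorMeasure.restrict_apply _ measurableSet_Ioc measurableSet_Ici, hdual _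
        measurableSet_Ici]
    rcases le_or_gt a 0 with ha | ha
    · have e1 : Ici a ∩ Ioc 0 T = Ioc 0 T :=
        inter_eq_right.2 fun t ht => ha.trans ht.1.le
      have e2 : Ici a ∩ Icc 0 T = Icc 0 T := inter_eq_right.2 fun t ht => ha.trans ht.1
      rw [e1, e2, hIoc, hI 0 h0]
    · have e1 : Ici a ∩ Ioc 0 T = Icc a T := by
        ext t
        exact ⟨fun ht => ⟨ht.1, ht.2.2⟩, fun ht => ⟨ht.1, ha.trans_le ht.1, ht.2⟩⟩
      have e2 : Ici a ∩ Icc 0 T = Icc a T := by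
        ext t
        exact ⟨fun ht => ⟨ht.1, ht.2.2⟩, fun ht => ⟨ht.1, ha.le.trans ht.1, ht.2⟩⟩
      rw [e1, e2]
      rcases le_or_gt a T with haT | haT
      · rw [apply_Icc_eq_of_ae_eq S.continuousOn_h hae ⟨ha, haT⟩, hI a ⟨ha.le, haT⟩]
      · simp [Icc_eq_empty haT.not_ge]
  · rw [← borel_eq_generateFrom_Ici, BorelSpace.measurable_eq (α := ℝ)]
  · rw [VectorMeasure.restrict_apply_univ, hdual _ MeasurableSet.univ, univ_inter, hIoc, hI 0 h0]

/-! ### Saddle points and the boundary value problem. -/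

/-- In the absence of a jump at `0`, a saddle point solves the boundary value problem. -/
lemma solvesBVP (S : Saddle γ ν K T X h) (hν : IsLevyMeasure ν) (hK : 0 < K) (hT : 0 < T)
    (hi : h 0 ∈ interior (effDom γ ν)) (hX : X 0 = 0) :
    SolvesBVP γ ν K T (fun t => X (T - t) - Real.log (K / (1 - h 0)) + 1)
      (fun t => ∫ s in (T - t)..T, -density K T X h s) := by
  have hrev : ∀ t ∈ Icc 0 T, T - t ∈ Icc 0 T := fun t ht =>
    ⟨by linarith [ht.2], by linarith [ht.1]⟩
  have hψ : ∀ t ∈ Icc 0 T, ∫ s in (T - t)..T, -density K T X h s = h (T - t) := by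
    intro t ht
    rw [intervalIntegral.integral_of_le (hrev t ht).2, ← integral_Icc_eq_integral_Ioc,
      integral_neg, S.integral_density (hrev t ht), neg_neg]
  have hmem : ∀ s ∈ Icc 0 T, h s ∈ interior (effDom γ ν) := fun s hs => by
    rcases hs.1.eq_or_lt with rfl | h0
    · exact hi
    · exact S.mem_interior s ⟨h0, hs.2⟩
  have hTm : T ∈ Icc 0 T := right_mem_Icc.2 hT.le
  have hpos : 0 < 1 - h 0 := by linarith [S.nonpos]
  have hsub : ∀ t, HasDerivWithinAt (fun t => T - t) (-1) (Icc 0 T) t := fun t =>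
    ((hasDerivAt_id t).const_sub T).hasDerivWithinAt
  refine ⟨fun t ht => ?_, fun t ht => ?_, fun t ht => ?_, ?_, fun t ht => ?_, ?_⟩
  · rw [hψ t ht]; exact hmem _ (hrev t ht)
  · rw [hψ t ht]; exact differentiableAt_Gr hν (hmem _ (hrev t ht))
  · rw [hψ t ht]
    have := (S.deriv_X _ (hrev t ht) (hmem _ (hrev t ht))).comp t (hsub t) hrev
    rw [mul_neg_one] at this
    exact (this.sub_const _).add_const _
  -- The absence of a jump is what produces the terminal condition on `p`.
  · rw [hψ T hTm, sub_self, hX, zero_sub]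
  · have := (S.deriv_h _ (hrev t ht)).comp t (hsub t) hrev
    refine (this.congr_of_mem (fun r hr => hψ r hr) ht).congr_deriv ?_
    rw [add_sub_cancel_right, Real.exp_sub, Real.exp_log (by positivity)]
    field_simp
  · simp

end Saddle

/-- A solution of the boundary value problem is a saddle point without jump at `0`. -/
lemma SolvesBVP.saddle {γ : ℝ} {ν : Measure ℝ} {K T : ℝ} {q φ : ℝ → ℝ}
    (S : SolvesBVP γ ν K T q φ) (hK : 0 < K) (hT : 0 < T) :
    Saddle γ ν K T (fun s => q (T - s) - q T) (fun s => φ (T - s)) := by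
  have hrev : ∀ t ∈ Icc 0 T, T - t ∈ Icc 0 T := fun t ht =>
    ⟨by linarith [ht.2], by linarith [ht.1]⟩
  have hsub : ∀ t, HasDerivWithinAt (fun t => T - t) (-1) (Icc 0 T) t := fun t =>
    ((hasDerivAt_id t).const_sub T).hasDerivWithinAt
  have hanti : AntitoneOn φ (Icc 0 T) := by
    have hd : ∀ t ∈ Ioo 0 T, HasDerivAt φ (-(1 / T) * Real.exp (q t - 1)) t := fun t ht =>
      (S.state t (Ioo_subset_Icc_self ht)).hasDerivAt (Icc_mem_nhds ht.1 ht.2)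
    refine antitoneOn_of_deriv_nonpos (convex_Icc 0 T)
      (fun t ht => (S.state t ht).continuousWithinAt) ?_ ?_
    · intro t ht
      rw [interior_Icc] at ht
      exact (hd t ht).differentiableAt.differentiableWithinAt
    · intro t ht
      rw [interior_Icc] at ht
      rw [(hd t ht).deriv, neg_mul, neg_nonpos]
      positivity
  have hφT : φ T ≤ 0 := S.state_initial ▸
    hanti (left_mem_Icc.2 hT.le) (right_mem_Icc.2 hT.le) hT.le
  have hX : ∀ s ∈ Icc 0 T, HasDerivWithinAt (fun s => q (T - s) - q T)
      (deriv (Gr γ ν) (φ (T - s))) (Icc 0 T) s := fun s hs => by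
    have := (S.adjoint _ (hrev s hs)).comp s (hsub s) hrev
    rw [mul_neg_one, neg_neg] at this
    exact this.sub_const _
  have hpos : 0 < 1 - φ T := by linarith
  refine ⟨fun s hs => (hX s hs).continuousWithinAt, by simp [S.state_initial], by simpa,
    fun s hs => ?_, fun s hs _ => hX s hs, fun s hs => S.mem_interior _ (hrev s ⟨hs.1.le, hs.2⟩),
    interior_subset (S.mem_interior _ (hrev 0 (left_mem_Icc.2 hT.le))), by simp⟩
  refine ((S.state _ (hrev s hs)).comp s (hsub s) hrev).congr_deriv ?_
  -- The terminal condition on `q` supplies the factor `(1 - φ T) / K` of the saddle equation.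
  have e : q (T - s) - q T = q (T - s) - 1 + Real.log (K / (1 - φ T)) := by
    rw [S.adjoint_final]; ring
  rw [e, Real.exp_add, Real.exp_log (by positivity), sub_zero]
  field_simp

/-- The asymptotically optimal measure determines the solution of the boundary value problem. -/
lemma SolvesBVP.unique {γ : ℝ} {ν : Measure ℝ} {K T : ℝ} {p ψ q φ : ℝ → ℝ}
    {θ : SignedMeasure ℝ} (S : SolvesBVP γ ν K T p ψ) (R : SolvesBVP γ ν K T q φ)
    (hν : IsLevyMeasure ν) (h1 : AssumptionA1 ν) (h2 : AssumptionA2 γ ν) (hK : 0 < K) (hT : 0 < T)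
    (hθ : IsAsymptoticallyOptimal γ ν K T θ) : ∀ t ∈ Icc 0 T, q t = p t ∧ φ t = ψ t := by
  have hval : ∀ {p ψ : ℝ → ℝ}, SolvesBVP γ ν K T p ψ → ∀ t ∈ Ico 0 T,
      ψ t = θ (Icc (T - t) T) := by
    intro p ψ S t ht
    have S' := S.saddle hK hT
    have := apply_Icc_eq_of_ae_eq S'.continuousOn_h
      (S'.apply_Icc_eq_of_isAsymptoticallyOptimal hν h1 h2 hK hT hθ)
      (s := T - t) ⟨by linarith [ht.2], by linarith [ht.1]⟩
    rw [this, sub_sub_cancel]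
  have hvalT : ∀ {p ψ : ℝ → ℝ}, SolvesBVP γ ν K T p ψ → ψ T = θ (Ioc 0 T) := by
    intro p ψ S
    have S' := S.saddle hK hT
    have := apply_Ioc_eq_of_ae_eq hT S'.continuousOn_h
      (S'.apply_Icc_eq_of_isAsymptoticallyOptimal hν h1 h2 hK hT hθ)
    rw [this, sub_zero]
  have hφ : ∀ t ∈ Icc 0 T, φ t = ψ t := by
    intro t ht
    rcases ht.2.eq_or_lt with rfl | hlt
    · rw [hvalT R, hvalT S]
    · rw [hval R t ⟨ht.1, hlt⟩, hval S t ⟨ht.1, hlt⟩]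
  intro t ht
  refine ⟨?_, hφ t ht⟩
  -- Once `φ = ψ`, the two state equations have the same derivative, and injectivity of `exp` gives
  -- `q = p`.
  have := (uniqueDiffOn_Icc hT t ht).eq_deriv _ ((R.state t ht).congr_of_mem
    (fun s hs => (hφ s hs).symm) ht) (S.state t ht)
  have hne : -(1 / T) ≠ 0 := by simp [hT.ne']
  linarith [Real.exp_injective (mul_left_cancel₀ hne this)]

lemma exists_density_of_isAsymptoticallyOptimal {γ : ℝ} {ν : Measure ℝ} {K T : ℝ}
    {θ : SignedMeasure ℝ} (hK : 0 < K) (hT : 0 < T) (hν : IsLevyMeasure ν) (h1 : AssumptionA1 ν)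
    (h2 : AssumptionA2 γ ν) (hθ : IsAsymptoticallyOptimal γ ν K T θ)
    (hmem : θ (Ioc 0 T) ∈ interior (effDom γ ν)) :
    ∃ g p : ℝ → ℝ, HasNonposDensity T (θ.restrict (Ioc 0 T)) g ∧
      SolvesBVP γ ν K T p (fun t => ∫ s in (T - t)..T, g s) := by
  obtain ⟨X, h, S⟩ := exists_saddle hν h1 h2 hK hT
  have hae := S.apply_Icc_eq_of_isAsymptoticallyOptimal hν h1 h2 hK hT hθ
  have hi : h 0 ∈ interior (effDom γ ν) :=
    apply_Ioc_eq_of_ae_eq hT S.continuousOn_h hae ▸ hmem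
  -- At an interior point the normal cone is trivial: `h 0` may be moved by `r / 2` in both
  -- directions.
  have hX : X 0 = 0 := by
    obtain ⟨r, hr, hball⟩ := Metric.mem_nhds_iff.1 (mem_interior_iff_mem_nhds.1 hi)
    have hr2 : ∀ e : ℝ, |e| = r / 2 → X 0 * e ≤ 0 := fun e he => by
      have := S.normal (h 0 + e) (hball (by
        rw [Metric.mem_ball, Real.dist_eq, add_sub_cancel_left, he]; linarith))
      rwa [add_sub_cancel_left] at this
    have hp := hr2 (r / 2) (abs_of_pos (by positivity))
    have hn := hr2 (-(r / 2)) (by rw [abs_neg, abs_of_pos (by positivity)])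
    nlinarith
  exact ⟨_, _, ⟨S.integrable_neg_density,
    Eventually.of_forall fun t => neg_nonpos.2 (S.density_pos hK hT t).le,
    S.restrict_eq_dual hT hae⟩, S.solvesBVP hν hK hT hi hX⟩

end AsianPut

theorem mainTheorem4 (K T : ℝ) (hK : 0 < K) (hT : 0 < T) :
    -- i. the conjugate of the log-payoff
    (∀ θ ∈ AsianPut.M T,
      (∀ g : ℝ → ℝ, AsianPut.HasNonposDensity T θ g →
        AsianPut.Hhat K T θ =
          ((Real.log (K / (1 - ∫ t in (0 : ℝ)..T, g t)) : ℝ) : EReal) -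
            AsianPut.extIntegral (volume.restrict (Icc 0 T)) (fun t =>
              ((g t * Real.log (-(K * T * g t) / (1 - ∫ s in (0 : ℝ)..T, g s)) : ℝ) : EReal))) ∧
      ((¬ ∃ g : ℝ → ℝ, AsianPut.HasNonposDensity T θ g) → AsianPut.Hhat K T θ = ⊤)) ∧
    -- ii. the asymptotically optimal parameter
    (∀ (γ : ℝ) (ν : Measure ℝ), AsianPut.IsLevyMeasure ν → AsianPut.AssumptionA1 ν →
      AsianPut.AssumptionA2 γ ν →
      ∀ θ : SignedMeasure ℝ, AsianPut.IsAsymptoticallyOptimal γ ν K T θ →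
        θ (Ioc 0 T) ∈ interior (AsianPut.effDom γ ν) →
        ∃ g p : ℝ → ℝ, AsianPut.HasNonposDensity T (θ.restrict (Ioc 0 T)) g ∧
          AsianPut.SolvesBVP γ ν K T p (fun t => ∫ s in (T - t)..T, g s) ∧
          ∀ q φ : ℝ → ℝ, AsianPut.SolvesBVP γ ν K T q φ →
            ∀ t ∈ Icc 0 T, q t = p t ∧ φ t = ∫ s in (T - t)..T, g s) := by
  refine ⟨fun θ hθ => ⟨fun g hg => AsianPut.Hhat_eq_of_hasNonposDensity hK hT hg,
    AsianPut.Hhat_eq_top hK hT hθ⟩, fun γ ν hν h1 h2 θ hθ hmem => ?_⟩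
  obtain ⟨g, p, hg, S⟩ :=
    AsianPut.exists_density_of_isAsymptoticallyOptimal hK hT hν h1 h2 hθ hmem
  exact ⟨g, p, hg, S, fun q φ R => S.unique R hν h1 h2 hK hT hθ⟩
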